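/- **Setup.** Let $(W,S)$ be a Coxeter system, $n\ge3$, and let $s_1,\dots,s_{n-1}\in S$ be distinct simple reflections generating a parabolic subgroup of type $A_{n-1}$ ($s_as_b$ has order $3$ if $|a-b|=1$ and order $2$ if $|a-b|>1$). Identify this subgroup with the symmetric group $S_n$ so that $s_j=(j\;j{+}1)$. Let $V$ be the geometric representation of $W$: the real vector space with basis $(\alpha_s)_{s\in S}$, where $s$ acts by $v\mapsto v-2(\alpha_s,v)\alpha_s$ and $(\alpha_s,\alpha_{s'})=-\cos(\pi/\mathrm{ord}(ss'))$ (equal to $-1$ if the order is infinite). For every reflection $p\in W$ (conjugate of an element of $S$) fix a root $\alpha_p\in V$, i.e. a vector such that $p$ acts on $V$ by $v\mapsto v-f(v)\alpha_p$ for some $f\in V^*$ with $f(\alpha_p)=2$. Let $R=\mathrm{Sym}(V)$, graded so that $V$ has degree $2$; for a graded module $M$ let $M(k)_d=M_{k+d}$. *Subexpressions.* For a sequence of reflections $t=(t_1,\dots,t_m)$ and $w\in W$, let $\mathrm{Sub}(t,w)$ be the set of $\epsilon\in\{0,1\}^m$ with $t_1^{\epsilon_1}\cdots t_m^{\epsilon_m}=w$.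 Put $\epsilon^{<i}=t_1^{\epsilon_1}\cdots t_{i-1}^{\epsilon_{i-1}}$, $\epsilon^i=\epsilon^{<i}t_i(\epsilon^{<i})^{-1}$ and $M_p(\epsilon)=\{i:\epsilon^i=p\}$; let $f_Y\epsilon$ be obtained from $\epsilon$ by flipping the entries at the positions in $Y$. For $Y\subset X\subset\{1,\dots,m\}$, let $|Y|_X$ be the number of elements of $Y$ at odd positions of $X$ counted decreasingly. Let $\mathcal X_w(t)$ be the graded $R$-module of all functions $g:\mathrm{Sub}(t,w)\to R$ such that $$\sum_{Y\subset X,\ |Y|\text{ even}}(-1)^{|Y|_X}g(f_Y\epsilon)\in\alpha_p^{|X|-1}R$$ for all $\epsilon\in\mathrm{Sub}(t,w)$, all reflections $p$ and all nonempty $X\subset M_p(\epsilon)$; the grading is pointwise. *Algorithm 2.* Let $\Phi\subset\mathrm{Sub}(t,w)$ and $\epsilon\in\mathrm{Sub}(t,w)\setminus\Phi$. Let $n_p(\Phi,\epsilon)$ be the maximal cardinality of $X\subset M_p(\epsilon)$ such that every $\delta\in\mathrm{Sub}(t,w)$ that differs from $\epsilon$ only at positions of $X$ lies in $\Phi\cup\{\epsilon\}$.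 For $Y\subset\{1,\dots,m\}$ consider the graph whose vertices are the $\delta\in\mathrm{Sub}(t,w)$ that agree with $\epsilon$ at all positions of $Y$, distinct $\delta,\delta'$ being joined if there is $p$ such that $\delta_k\ne\delta'_k$ implies $\delta^k=p$; let $\mathrm{Sub}^Y_{con}(t,w,\epsilon)$ be the connected component of $\epsilon$. Then $\epsilon$ is *con-close* to $\Phi$ if for some $Y$ one has $|Y\cap M_p(\epsilon)|=n_p(\Phi,\epsilon)-1$ whenever $M_p(\epsilon)\ne\emptyset$, and $\mathrm{Sub}^Y_{con}(t,w,\epsilon)\cap\Phi=\emptyset$; then $\mathrm{cdist}(\Phi,\epsilon)=2|Y|$. Algorithm 2 applied to $\mathrm{Sub}(t,w)$ starts with $\mathscr G_0=\{(\emptyset,0)\}$ and, for $k<|\mathrm{Sub}(t,w)|$, forms the family $\mathscr G_{k+1}$ of all pairs $(\Phi\cup\{\epsilon\},P+v^{-\mathrm{cdist}(\Phi,\epsilon)})$ with $(\Phi,P)\in\mathscr G_k$ and $\epsilon$ con-close to $\Phi$. It stops prematurely at step $k<|\mathrm{Sub}(t,w)|$ if it has reached step $k$ and $\mathscr G_{k+1}=\emptyset$.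 *The sequences and the string modules.* For a rearrangement $\mathbf i=(i_1,\dots,i_n)$ of $(1,\dots,n)$ let $$D(\mathbf i)=\big((i_1i_2),(i_1i_3),\dots,(i_1i_n),(i_1i_2),(i_2i_3),\dots,(i_{n-1}i_n),(i_ni_1)\big),$$ a sequence of length $2n-1$. For $k\in\mathbb Z$ let $t=D(\mathbf i)[k]$ be its cyclic shift, $t_j=D(\mathbf i)_{k+j}$, indices modulo $2n-1$. For linearly independent $x_1,\dots,x_r\in V$, $r\ge2$, let $$\mathrm{St}_R(x_1,\dots,x_r)=\{(f_1,\dots,f_{r-1})\in R^{r-1}: x_1\mid f_1,\ x_r\mid f_{r-1},\ x_i\mid f_i-f_{i-1}\ (2\le i\le r-1)\},$$ graded as a submodule of $R^{r-1}$. For $A=\{a,n-1+a\}\subset\mathbb Z/(2n-1)\mathbb Z$, let $\mathbf t(A)$ be the reflection $p$ such that for some $\epsilon\in\mathrm{Sub}(t,1)$ and some reflection $q\ne p$ the residues modulo $2n-1$ of $M_p(\epsilon)$ form the set $A$ and those of $M_q(\epsilon)$ form the set $1+A$; put $\alpha^A=\alpha_{\mathbf t(A)}$. **Theorem.** Let $\mathbf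 i$ be a rearrangement of $(1,\dots,n)$ and $k\in\mathbb Z$. (i) If $n=3$, then Algorithm 2 applied to $\mathrm{Sub}(D(\mathbf i)[k],1)$ does not stop prematurely, and there is an isomorphism of graded $R$-modules $$\mathcal X_1(D(\mathbf i)[k])\cong R\oplus R(-2)^{\oplus3}\oplus R(-4).$$ (ii) If $n\ge4$, then Algorithm 2 applied to $\mathrm{Sub}(D(\mathbf i)[k],1)$ stops prematurely at step $n+1$. Moreover, for every $A=\{a,n-1+a\}$ the reflection $\mathbf t(A)$ exists and is unique, and for every such $A$ the roots $\alpha^A,\alpha^{1+A},\dots,\alpha^{n-2+A}$ are linearly independent and there is an isomorphism of graded $R$-modules $$\mathcal X_1(D(\mathbf i)[k])\cong R\oplus R(-2)^{\oplus n}\oplus\mathrm{St}_R(\alpha^A,\alpha^{1+A},\dots,\alpha^{n-2+A}).$$ -/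

import Mathlib

namespace ReflExpr

open scoped LaurentPolynomial

noncomputable section

/-! ### Reflection expressions and subexpressions

A reflection expression of length `m` is a function `t : Fin m → W` and a subexpression is a function
`ε : Fin m → Bool` (`true` stands for `1` and `false` for `0`). Positions are counted from `0` here,
so that the position `i : Fin m` is the position `i + 1` of the usual notation. -/

section Subexpressions

variable {W : Type*} [Group W] {m : ℕ}

/-- The cyclic shift `x[k]`, that is, `x[k]_i = x_{k+i}`, indices being taken modulo `m`. -/
def cyclicShift {X : Type*} (x : Fin m → X) (k : ℤ) : Fin m → X := fun i =>
  x ⟨(((i : ℕ) + k : ℤ) % (m : ℤ)).toNat, by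
    have hm : (0 : ℤ) < m := by have := i.isLt; omega
    have h₁ := Int.emod_nonneg ((i : ℕ) + k : ℤ) hm.ne'
    have h₂ := Int.emod_lt_of_pos ((i : ℕ) + k : ℤ) hm
    omega⟩

/-- The list `t_1^{ε_1}, …, t_m^{ε_m}`. -/
def factors (t : Fin m → W) (ε : Fin m → Bool) : List W :=
  List.ofFn fun i => if ε i then t i else 1

open Classical in
/-- `Sub(t, w)`: the subexpressions of `t` with target `w`. -/
def subTo (t : Fin m → W) (w : W) : Finset (Fin m → Bool) :=
  Finset.univ.filter fun ε => (factors t ε).prod = w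

/-- `ε^{<i} = t_1^{ε_1} ⋯ t_{i-1}^{ε_{i-1}}`. -/
def before (t : Fin m → W) (ε : Fin m → Bool) (i : Fin m) : W :=
  ((factors t ε).take i).prod

/-- `ε^i = ε^{<i} t_i (ε^{<i})⁻¹`. -/
def reflAt (t : Fin m → W) (ε : Fin m → Bool) (i : Fin m) : W :=
  before t ε i * t i * (before t ε i)⁻¹

open Classical in
/-- `M_p(ε)`: the set of positions `i` with `ε^i = p`. If the entries of `t` are reflections, then this
set is empty unless `p` is a reflection. -/
def posOf (t : Fin m → W) (ε : Fin m → Bool) (p : W) : Finset (Fin m) :=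
  Finset.univ.filter fun i => reflAt t ε i = p

/-- The folding operator `f_Y`, which flips the entries at the positions of `Y`. -/
def fold (Y : Finset (Fin m)) (ε : Fin m → Bool) : Fin m → Bool := fun i =>
  if i ∈ Y then !(ε i) else ε i

/-- `|Y|_X`: the number of elements of `Y` that are at odd positions of `X` counted decreasingly. -/
def relCard (Y X : Finset (Fin m)) : ℕ :=
  (Y.filter fun y => Odd (X.filter fun x => y ≤ x).card).card

/-- `Sub^X(t, w, ε)`: the positions of `X` are frozen. -/
def subFreeze (t : Fin m → W) (w : W) (ε : Fin m → Bool) (X : Finset (Fin m)) :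
    Set (Fin m → Bool) :=
  {δ | δ ∈ subTo t w ∧ ∀ i, ε i ≠ δ i → i ∉ X}

/-- `Sub_X(t, w, ε)`: only the positions of `X` are allowed to change. -/
def subUnfreeze (t : Fin m → W) (w : W) (ε : Fin m → Bool) (X : Finset (Fin m)) :
    Set (Fin m → Bool) :=
  {δ | δ ∈ subTo t w ∧ ∀ i, ε i ≠ δ i → i ∈ X}

/-- The graph `Gr(Φ)`: its vertices are the elements of `Φ`, and distinct `ε` and `δ` are joined if for
some `p` the inequality `ε_k ≠ δ_k` implies `ε^k = p`. -/
def graph (t : Fin m → W) (Φ : Set (Fin m → Bool)) : SimpleGraph Φ :=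
  SimpleGraph.fromRel fun ε δ => ∃ p : W, ∀ k, ε.1 k ≠ δ.1 k → reflAt t ε.1 k = p

/-- `Sub_con^X(t, w, ε)`: the connected component of `Sub^X(t, w, ε)` containing `ε`. -/
def subFreezeCon (t : Fin m → W) (w : W) (ε : Fin m → Bool) (X : Finset (Fin m)) :
    Set (Fin m → Bool) :=
  {δ | ∃ (hε : ε ∈ subFreeze t w ε X) (hδ : δ ∈ subFreeze t w ε X),
    (graph t (subFreeze t w ε X)).Reachable ⟨ε, hε⟩ ⟨δ, hδ⟩}

open Classical in
/-- `n_p(Φ, ε)`: the maximal cardinality of a subset `X` of `M_p(ε)` such that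
`Sub_X(t, w, ε) ⊆ Φ ∪ {ε}`. -/
def maxCard (t : Fin m → W) (w : W) (Φ : Finset (Fin m → Bool)) (ε : Fin m → Bool) (p : W) : ℕ :=
  ((posOf t ε p).powerset.filter fun X =>
    subUnfreeze t w ε X ⊆ insert ε (Φ : Set (Fin m → Bool))).sup Finset.card

/-- The set `Y` shows that `ε` is con-close to `Φ`:
`ε ∉ Φ`, `|Y ∩ M_p(ε)| = n_p(Φ, ε) - 1` whenever `M_p(ε) ≠ ∅`, and `Sub_con^Y(t, w, ε) ∩ Φ = ∅`. -/
def ConCloseVia (t : Fin m → W) (w : W) (Φ : Finset (Fin m → Bool)) (ε : Fin m → Bool)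
    (Y : Finset (Fin m)) : Prop :=
  ε ∉ Φ ∧
  (∀ p : W, (posOf t ε p).Nonempty → (Y ∩ posOf t ε p).card + 1 = maxCard t w Φ ε p) ∧
  Disjoint (subFreezeCon t w ε Y) (Φ : Set (Fin m → Bool))

/-- The con-distance from `Φ` to `ε`, which is `2|Y|` for any `Y` showing that `ε` is con-close to `Φ`
(`|Y|` does not depend on the choice of `Y`) and is `⊤` if `ε` is not con-close to `Φ`. -/
def conDist (t : Fin m → W) (w : W) (Φ : Finset (Fin m → Bool)) (ε : Fin m → Bool) : ℕ∞ :=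
  ⨅ (Y : Finset (Fin m)) (_ : ConCloseVia t w Φ ε Y), ((2 * Y.card : ℕ) : ℕ∞)

open Classical in
/-- The family of pairs `(Φ, P)` stored by Algorithm 2 applied to `Sub(t, w)` at a given step. -/
def family (t : Fin m → W) (w : W) : ℕ → Set (Finset (Fin m → Bool) × ℕ[T;T⁻¹])
  | 0 => {(∅, 0)}
  | k + 1 => {x | ∃ Φ P, (Φ, P) ∈ family t w k ∧ ∃ ε ∈ subTo t w, ∃ d : ℕ,
      conDist t w Φ ε = d ∧ x = (insert ε Φ, P + LaurentPolynomial.T (-(d : ℤ)))}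

/-- Algorithm 2 applied to `Sub(t, w)` reaches step `k`, which is smaller than `|Sub(t, w)|`, and stops
there because the next family is empty. -/
def StopsPrematurelyAt (t : Fin m → W) (w : W) (k : ℕ) : Prop :=
  k < (subTo t w).card ∧ (∀ j ≤ k, (family t w j).Nonempty) ∧ family t w (k + 1) = ∅

/-- The maximal chord `{a, n - 1 + a}` of `ℤ/m` (where `m = 2n - 1`). -/
def chord (n : ℕ) (a : ZMod m) : Set (ZMod m) := {a, ((n : ZMod m) - 1) + a}

/-- The set of residues modulo `m` of the positions of `M_p(ε)` (counted from `1`). -/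
def resPosOf (t : Fin m → W) (ε : Fin m → Bool) (p : W) : Set (ZMod m) :=
  {x | ∃ i ∈ posOf t ε p, x = ((i : ℕ) : ZMod m) + 1}

/-- `p` is the reflection attached to the chord `A = {a, n - 1 + a}`: for some `ε ∈ Sub(t, 1)`
and `q ≠ p`, the residues of `M_p(ε)` form `A` and the residues of `M_q(ε)` form `1 + A`. -/
def IsChordReflection (n : ℕ) (t : Fin m → W) (a : ZMod m) (p : W) : Prop :=
  ∃ ε ∈ subTo t 1, ∃ q, q ≠ p ∧ resPosOf t ε p = chord n a ∧ resPosOf t ε q = chord n (1 + a)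

end Subexpressions

/-! ### Graded modules

A grading of an `A`-module is given by the family of its homogeneous components. -/

section Graded

variable {A : Type*} [CommRing A]

/-- The shift: `N(k)_d = N_{k+d}`. -/
def shiftGr {N : Type*} [AddCommGroup N] (𝒩 : ℤ → AddSubgroup N) (k : ℤ) : ℤ → AddSubgroup N :=
  fun d => 𝒩 (k + d)

/-- The grading of a direct sum of two graded modules. -/
def prodGr {N N' : Type*} [AddCommGroup N] [AddCommGroup N'] (𝒩 : ℤ → AddSubgroup N)
    (𝒩' : ℤ → AddSubgroup N') : ℤ → AddSubgroup (N × N') :=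
  fun d => (𝒩 d).prod (𝒩' d)

/-- The grading of the direct sum of copies of a graded module indexed by `ι`. -/
def powGr (ι : Type*) {N : Type*} [AddCommGroup N] (𝒩 : ℤ → AddSubgroup N) :
    ℤ → AddSubgroup (ι → N) :=
  fun d => AddSubgroup.pi Set.univ fun _ => 𝒩 d

/-- The grading of a submodule. -/
def subGr {N : Type*} [AddCommGroup N] [Module A N] (𝒩 : ℤ → AddSubgroup N) (L : Submodule A N) :
    ℤ → AddSubgroup L :=
  fun d => (𝒩 d).comap L.subtype.toAddMonoidHom

/-- Existence of an `A`-linear isomorphism identifying the homogeneous components. -/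
def GradedIso (A : Type*) [CommRing A] {N N' : Type*} [AddCommGroup N] [Module A N]
    [AddCommGroup N'] [Module A N'] (𝒩 : ℤ → AddSubgroup N) (𝒩' : ℤ → AddSubgroup N') : Prop :=
  ∃ e : N ≃ₗ[A] N', ∀ (d : ℤ) (x : N), x ∈ 𝒩 d ↔ e x ∈ 𝒩' d

/-- The string module `St_A(x)` of a sequence `x` of length `l + 2` (with entries counted from `0`). -/
def stringModule {l : ℕ} (x : Fin (l + 2) → A) : Submodule A (Fin (l + 1) → A) where
  carrier := {f | x 0 ∣ f 0 ∧ x (Fin.last (l + 1)) ∣ f (Fin.last l) ∧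
    ∀ i : Fin l, x i.succ.castSucc ∣ f i.succ - f i.castSucc}
  zero_mem' := by simp
  add_mem' := by
    rintro f g ⟨hf₁, hf₂, hf₃⟩ ⟨hg₁, hg₂, hg₃⟩
    refine ⟨dvd_add hf₁ hg₁, dvd_add hf₂ hg₂, fun i => ?_⟩
    have h := dvd_add (hf₃ i) (hg₃ i)
    rwa [sub_add_sub_comm] at h
  smul_mem' := by
    rintro c f ⟨hf₁, hf₂, hf₃⟩
    refine ⟨Dvd.dvd.mul_left hf₁ c, Dvd.dvd.mul_left hf₂ c, fun i => ?_⟩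
    have h := Dvd.dvd.mul_left (hf₃ i) c
    rwa [mul_sub] at h

end Graded

/-! ### The module `X_w(t)` -/

section ModuleX

variable {W : Type*} [Group W] {m : ℕ} {A : Type*} [CommRing A]

/-- The value at `ε` of a function on `Sub(t, w)`; the value outside `Sub(t, w)` is irrelevant. -/
def valueAt (t : Fin m → W) (w : W) (g : subTo t w → A) (ε : Fin m → Bool) : A :=
  if h : ε ∈ subTo t w then g ⟨ε, h⟩ else 0

/-- `Σ_X^{ε,ev}(g)`: the sum of `(-1)^{|Y|_X} g(f_Y ε)` over all even subsets `Y` of `X`.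
If `ε ∈ Sub(t, w)` and `X ⊆ M_p(ε)`, then each `f_Y ε` belongs to `Sub(t, w)`. -/
def evenSum (t : Fin m → W) (w : W) (ε : Fin m → Bool) (X : Finset (Fin m)) (g : subTo t w → A) : A :=
  ∑ Y ∈ X.powerset.filter (fun Y => Even Y.card),
    (-1) ^ relCard Y X * valueAt t w g (fold Y ε)

/-- `X_w(t)`: the functions `g` on `Sub(t, w)` with values in `A` such that `Σ_X^{ε,ev}(g)` is divisible
by `α_p^{|X|-1}` for all `ε ∈ Sub(t, w)`, all `p` and all nonempty `X ⊆ M_p(ε)`. -/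
def moduleX (α : W → A) (t : Fin m → W) (w : W) : Submodule A (subTo t w → A) where
  carrier := {g | ∀ ε ∈ subTo t w, ∀ p : W, ∀ X ⊆ posOf t ε p, X.Nonempty →
    α p ^ (X.card - 1) ∣ evenSum t w ε X g}
  zero_mem' := by
    intro ε _ p X _ _
    simp [evenSum, valueAt]
  add_mem' := by
    intro f g hf hg ε hε p X hX hX'
    have h := dvd_add (hf ε hε p X hX hX') (hg ε hε p X hX hX')
    have e : evenSum t w ε X (f + g) = evenSum t w ε X f + evenSum t w ε X g := by
      unfold evenSum
      rw [← Finset.sum_add_distrib]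
      refine Finset.sum_congr rfl fun Y _ => ?_
      unfold valueAt
      split_ifs <;> simp [mul_add]
    rwa [e]
  smul_mem' := by
    intro c g hg ε hε p X hX hX'
    have h := Dvd.dvd.mul_left (hg ε hε p X hX hX') c
    have e : evenSum t w ε X (c • g) = c * evenSum t w ε X g := by
      unfold evenSum
      rw [Finset.mul_sum]
      refine Finset.sum_congr rfl fun Y _ => ?_
      unfold valueAt
      split_ifs <;> simp [mul_left_comm]
    rwa [e]

end ModuleX

/-! ### The geometric representation and the ring `R = Sym(V)` -/

section Geometric

variable {B : Type*}

/-- The coroot `2 (α_i, _)` on the space `V = B →₀ ℝ` with basis `(α_j)`, where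
`(α_i, α_j) = -cos (π / M i j)`. An infinite order is encoded by `M i j = 0`; then
`π / 0 = 0` and `(α_i, α_j) = -1`, as it should be. -/
def simpleCoroot (M : CoxeterMatrix B) (i : B) : Module.Dual ℝ (B →₀ ℝ) :=
  (2 : ℝ) • Finsupp.linearCombination ℝ fun j => -Real.cos (Real.pi / (M i j : ℝ))

theorem simpleCoroot_single (M : CoxeterMatrix B) (i j : B) :
    simpleCoroot M i (Finsupp.single j 1) = -2 * Real.cos (Real.pi / (M i j : ℝ)) := by
  simp [simpleCoroot]

theorem simpleCoroot_self (M : CoxeterMatrix B) (i : B) :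
    simpleCoroot M i (Finsupp.single i 1) = 2 := by
  simp [simpleCoroot_single]

/-- The reflection `v ↦ v - 2 (α_i, v) α_i`. -/
def simpleReflection (M : CoxeterMatrix B) (i : B) : Module.End ℝ (B →₀ ℝ) :=
  Module.preReflection (Finsupp.single i 1) (simpleCoroot M i)

/-- The braid relation between two reflections at the angle `π / m`. -/
theorem reflection_mul_pow (m : ℕ) (hm : 2 < m) {V : Type*} [AddCommGroup V] [Module ℝ V] {x y : V}
    {f g : Module.Dual ℝ V} (hf : f x = 2) (hg : g y = 2)
    (h1 : f y = -2 * Real.cos (Real.pi / m)) (h2 : g x = -2 * Real.cos (Real.pi / m)) :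
    (Module.reflection hf * Module.reflection hg) ^ m = 1 := by
  have hm0 : (0 : ℝ) < m := by positivity
  have hm2 : (2 : ℝ) < m := by exact_mod_cast hm
  set θ : ℝ := 2 * (Real.pi / m) with hθ
  have hmθ : (m : ℝ) * θ = 2 * Real.pi := by rw [hθ]; field_simp
  have hsin : Real.sin θ ≠ 0 := by
    refine (Real.sin_pos_of_pos_of_lt_pi (by positivity) ?_).ne'
    rw [hθ, ← mul_div_assoc, div_lt_iff₀ hm0]
    nlinarith [Real.pi_pos]
  have ht : 2 * Real.cos θ = f y * g x - 2 := by rw [h1, h2, hθ, Real.cos_two_mul]; ring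
  have hS : ∀ j : ℤ, (Polynomial.Chebyshev.S ℝ j).eval (2 * Real.cos θ) = Real.sin ((j + 1) * θ) / Real.sin θ := by
    intro j
    rw [eq_div_iff hsin, Polynomial.Chebyshev.S_two_mul_real_cos]
  have key : (Polynomial.Chebyshev.S ℝ (((m : ℤ) - 2) / 2)).eval (2 * Real.cos θ) *
        ((Polynomial.Chebyshev.S ℝ (((m : ℤ) - 1) / 2)).eval (2 * Real.cos θ) +
          (Polynomial.Chebyshev.S ℝ (((m : ℤ) - 3) / 2)).eval (2 * Real.cos θ)) = 0 ∧
      (Polynomial.Chebyshev.S ℝ (((m : ℤ) - 1) / 2)).eval (2 * Real.cos θ) *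
        ((Polynomial.Chebyshev.S ℝ ((m : ℤ) / 2)).eval (2 * Real.cos θ) +
          (Polynomial.Chebyshev.S ℝ (((m : ℤ) - 2) / 2)).eval (2 * Real.cos θ)) = 0 := by
    rcases Nat.even_or_odd' m with ⟨k, rfl | rfl⟩
    · have e1 : (((2 * k : ℕ) : ℤ) - 2) / 2 = k - 1 := by omega
      have e2 : (((2 * k : ℕ) : ℤ) - 1) / 2 = k - 1 := by omega
      have h0 : (Polynomial.Chebyshev.S ℝ ((k : ℤ) - 1)).eval (2 * Real.cos θ) = 0 := by
        rw [hS]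
        have : (((k : ℤ) - 1 : ℤ) + 1 : ℝ) * θ = Real.pi := by
          push_cast at hmθ ⊢; linarith
        rw [this]; simp
      rw [e1, e2, h0]; simp
    · have e1 : (((2 * k + 1 : ℕ) : ℤ) - 2) / 2 = k - 1 := by omega
      have e2 : (((2 * k + 1 : ℕ) : ℤ) - 1) / 2 = k := by omega
      have e3 : (((2 * k + 1 : ℕ) : ℤ) - 3) / 2 = k - 1 := by omega
      have e4 : (((2 * k + 1 : ℕ) : ℤ)) / 2 = k := by omega
      have h0 : (Polynomial.Chebyshev.S ℝ (k : ℤ)).eval (2 * Real.cos θ) +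
          (Polynomial.Chebyshev.S ℝ ((k : ℤ) - 1)).eval (2 * Real.cos θ) = 0 := by
        rw [hS, hS]
        have : (((k : ℤ) : ℝ) + 1) * θ = 2 * Real.pi - ((((k : ℤ) - 1 : ℤ) : ℝ) + 1) * θ := by
          push_cast at hmθ ⊢; linarith
        rw [this, Real.sin_two_pi_sub]; ring
      rw [e1, e2, e3, e4, h0]; simp
  ext z
  rw [Module.reflection_mul_reflection_pow_apply hf hg m z _ ht, key.1, key.2]
  simp

theorem simpleReflection_isLiftable (M : CoxeterMatrix B) :
    M.IsLiftable (simpleReflection M) := by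
  intro i j
  by_cases hij : i = j
  · subst hij
    rw [M.diagonal, pow_one]
    exact LinearMap.ext fun v => Module.involutive_preReflection (simpleCoroot_self M i) v
  have h1 : M i j ≠ 1 := M.off_diagonal i j hij
  rcases Nat.lt_or_ge 2 (M i j) with h2 | h2
  · have h := reflection_mul_pow (M i j) h2 (simpleCoroot_self M i) (simpleCoroot_self M j)
      (simpleCoroot_single M i j) (by rw [simpleCoroot_single, M.symmetric j i])
    have h' := congrArg
      (LinearEquiv.automorphismGroup.toLinearMapMonoidHom (R := ℝ) (M := B →₀ ℝ)) h
    rw [map_pow, map_mul, map_one] at h'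
    exact h'
  · interval_cases hM : M i j
    · exact pow_zero _
    · exact absurd rfl h1
    · have e1 : simpleCoroot M i (Finsupp.single j 1) = 0 := by
        rw [simpleCoroot_single, hM]; simp
      have e2 : simpleCoroot M j (Finsupp.single i 1) = 0 := by
        rw [simpleCoroot_single, M.symmetric j i, hM]; simp
      refine LinearMap.ext fun v => ?_
      simp only [pow_two, simpleReflection, Module.End.mul_apply, Module.preReflection_apply,
        map_sub, map_smul, e1, e2, simpleCoroot_self, Module.End.one_apply]
      module

variable {W : Type*} [Group W] {M : CoxeterMatrix B}

/-- The geometric representation of `W`. -/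
def geomRep (cs : CoxeterSystem M W) : W →* Module.End ℝ (B →₀ ℝ) :=
  cs.lift ⟨simpleReflection M, simpleReflection_isLiftable M⟩

/-- The element `w` acts on `V` as the reflection with root `v` (and a suitable coroot `f`). -/
def IsRootOf (cs : CoxeterSystem M W) (w : W) (v : B →₀ ℝ) : Prop :=
  ∃ f : Module.Dual ℝ (B →₀ ℝ), f v = 2 ∧ ∀ u, geomRep cs w u = u - f u • v

/-- The embedding of `V` in `R = Sym(V)`, the ring of polynomials in the variables `α_i`. -/
def toSym : (B →₀ ℝ) →ₗ[ℝ] MvPolynomial B ℝ :=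
  Finsupp.linearCombination ℝ fun b => MvPolynomial.X b

/-- The grading of `R`, where the elements of `V` have degree `2`. -/
def symGr (B : Type*) (d : ℤ) : AddSubgroup (MvPolynomial B ℝ) :=
  (MvPolynomial.weightedHomogeneousSubmodule ℝ (fun _ : B => (2 : ℤ)) d).toAddSubgroup

end Geometric

/-! ### Transpositions and `D`-sequences

Let `s_1, …, s_{n-1}` be simple reflections generating a parabolic subgroup of type `A_{n-1}`.
This subgroup is identified with the symmetric group so that `s_j` is the transposition `(j j+1)`. -/

section Transpositions

variable {B W : Type*} [Group W] {M : CoxeterMatrix B}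

/-- The element `(a b)` for `b = a + 1 + d`, obtained from
`(a b+1) = (b b+1) (a b) (b b+1)`; here `σ j` stands for `(j j+1)`. -/
def transpAux (σ : ℕ → W) (a : ℕ) : ℕ → W
  | 0 => σ a
  | d + 1 => σ (a + d + 1) * transpAux σ a d * σ (a + d + 1)

/-- The transposition `(a b)`, where `a ≠ b`, as an element of `W`. -/
def transp (cs : CoxeterSystem M W) {n : ℕ} (s : Fin (n - 1) → B) (a b : Fin n) : W :=
  transpAux (fun j => if h : j < n - 1 then cs.simple (s ⟨j, h⟩) else 1)
    (min (a : ℕ) b) (max (a : ℕ) b - min (a : ℕ) b - 1)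

/-- The sequence `((i_1 i_2), (i_1 i_3), …, (i_1 i_n))`. -/
def aSeq (cs : CoxeterSystem M W) {n : ℕ} (s : Fin (n - 1) → B) (i : Fin n → Fin n) :
    Fin (n - 1) → W := fun j =>
  transp cs s (i ⟨0, by have := j.isLt; omega⟩) (i ⟨j + 1, by have := j.isLt; omega⟩)

/-- The sequence `((i_1 i_2), (i_2 i_3), …, (i_{n-1} i_n), (i_n i_1))`. -/
def cSeq (cs : CoxeterSystem M W) {n : ℕ} (s : Fin (n - 1) → B) (i : Fin n → Fin n) :
    Fin n → W := fun j =>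
  transp cs s (i j) (i (finRotate n j))

/-- The sequence `D(i)` of length `2n - 1`, the concatenation of the two previous ones. -/
def DSeq (cs : CoxeterSystem M W) {n : ℕ} (s : Fin (n - 1) → B) (i : Fin n → Fin n) :
    Fin (n - 1 + n) → W :=
  Fin.append (aSeq cs s i) (cSeq cs s i)

end Transpositions

end

end ReflExpr

open ReflExpr

/-!
Put `m = 2n - 1`. The subexpressions of a shifted `D`-sequence with trivial target form a cycle of
length `m`, and both the run of the algorithm and the module of functions are read off this cycle.

*The cycle.* For a subexpression `ε`, the sequence `t` may be replaced by the sequence of the reflections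
`ε^i`: subexpressions of the latter correspond to changes of `ε` (`partialProd_xor`, `reflAt_xor`). A
`D`-sequence has two repeated entries, at the positions of two neighbouring maximal chords of `ℤ/m`.
Flipping both positions of the first entry gives again a `D`-sequence, with other labels and with the
initial entry moved by one position (`IsDSeq.step`). Starting from the trivial subexpression, this gives
`m` distinct subexpressions with trivial target, and there are no others: if each token moved by the
transpositions comes home, then the choices are forced up to a parameter with `m` values (`exists_stdSupport`,
`card_subTo_le`). The result is `exists_isSubCycle`: consecutive members of the cycle differ at the
positions of one chord, and the `m` chords carry reflections `ρ a`, which are the reflections attached to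
them (`IsSubCycle.isChordReflection_iff`). Moreover, `n - 1` consecutive reflections are transpositions that
form the edges of a tree on `n` points, so that their roots are a basis of the span of all roots of the
parabolic subgroup (`linearIndependent_of_tree`).

*The algorithm.* A set stored by the algorithm is an arc of the cycle, since a subexpression adjacent to
no element of a non-empty set requires `Y = ∅`, and then its component is the whole cycle. To prolong
an arc by a neighbour of its end, one of the two positions of a chord is frozen. This position lies on
exactly one other chord, and freezing it cuts the cycle at these two edges into arcs with `n - 1` and `n`
members. Hence the component has at least `n - 1` members: an arc with at most `n` members can be prolonged
(`IsSubCycle.exists_conCloseVia`), and an arc with `n + 1` members, whose complement has `n - 2`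
members, cannot be, unless this complement is a single subexpression, for which two positions are
frozen (`IsSubCycle.not_conCloseVia`, `IsSubCycle.exists_conCloseVia_last`). The latter happens
exactly for `n = 3`.

*The module.* The module `X_1(t)` consists of the functions on the cycle whose differences along the edges
are divisible by the roots of the corresponding reflections (`IsSubCycle.gradedIso_cycleModule`). Choose
`n - 1` consecutive edges. The value at a vertex is arbitrary, and so are the quotients of the `n`
differences along the other edges: their contributions to the sum around the cycle are linear combinations
of the `n - 1` chosen roots and can be compensated along the chosen edges. What remains is a sequence on the
chosen edges that starts and ends with `0`, which is a string (`gradedIso_split`). For two roots a string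
is a multiple of their product (`gradedIso_stringModule_two`).
-/

namespace ReflExpr

open scoped LaurentPolynomial

/-! ### Transpositions in a group with generators of type `A` -/

/-- The elements `σ 0, …, σ (N - 1)` satisfy the Coxeter relations of type `A_N`. -/
structure TypeARelations {W : Type*} [Group W] (σ : ℕ → W) (N : ℕ) : Prop where
  sq : ∀ j, j < N → σ j * σ j = 1
  comm : ∀ i j, i + 1 < j → j < N → Commute (σ i) (σ j)
  braid : ∀ j, j + 1 < N → σ j * σ (j + 1) * σ j = σ (j + 1) * σ j * σ (j + 1)

/-- The transposition `(a b)` with `a` and `b` in either order; `σ j` stands for `(j j+1)`. -/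
def trans {W : Type*} [Group W] (σ : ℕ → W) (a b : ℕ) : W :=
  transpAux σ (min a b) (max a b - min a b - 1)

section TypeA

variable {W : Type*} [Group W] {σ : ℕ → W} {N : ℕ}

theorem trans_comm (σ : ℕ → W) (a b : ℕ) : trans σ a b = trans σ b a := by
  simp only [trans, min_comm a b, max_comm a b]

theorem trans_add (σ : ℕ → W) (a d : ℕ) : trans σ a (a + d + 1) = transpAux σ a d := by
  have h1 : min a (a + d + 1) = a := by omega
  have h2 : max a (a + d + 1) - a - 1 = d := by omega
  rw [trans, h1, h2]

theorem trans_self_succ (σ : ℕ → W) (a : ℕ) : trans σ a (a + 1) = σ a := trans_add σ a 0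

theorem trans_succ (σ : ℕ → W) {a b : ℕ} (h : a < b) :
    trans σ a (b + 1) = σ b * trans σ a b * σ b := by
  obtain ⟨d, rfl⟩ : ∃ d, b = a + d + 1 := ⟨b - a - 1, by omega⟩
  rw [trans_add, show a + d + 1 + 1 = a + (d + 1) + 1 by ring, trans_add]
  rfl

namespace TypeARelations

variable (h : TypeARelations σ N)
include h

theorem inv_eq {j : ℕ} (hj : j < N) : (σ j)⁻¹ = σ j := inv_eq_of_mul_eq_one_right (h.sq j hj)

theorem mul_cancel_left {j : ℕ} (hj : j < N) (x : W) : σ j * (σ j * x) = x := by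
  rw [← mul_assoc, h.sq j hj, one_mul]

theorem conj_conj {j : ℕ} (hj : j < N) (x : W) : σ j * (σ j * x * σ j) * σ j = x := by
  simp only [mul_assoc, h.sq j hj, h.mul_cancel_left hj, mul_one]

theorem conj_of_commute {j : ℕ} (hj : j < N) {x : W} (hx : Commute (σ j) x) :
    σ j * x * σ j = x := by
  rw [hx.eq, mul_assoc, h.sq j hj, mul_one]

theorem commute_trans_of_gt {a b j : ℕ} (hab : a < b) (hbj : b < j) (hj : j < N) :
    Commute (σ j) (trans σ a b) := by
  induction b, hab using Nat.le_induction with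
  | base => rw [trans_self_succ]; exact (h.comm a j hbj hj).symm
  | succ b hab ih =>
    have hc : Commute (σ j) (σ b) := (h.comm b j hbj hj).symm
    rw [trans_succ σ hab]
    exact (hc.mul_right (ih (by omega))).mul_right hc

theorem commute_trans_of_lt {a b j : ℕ} (hab : a < b) (hja : j + 1 < a) (hb : b ≤ N) :
    Commute (σ j) (trans σ a b) := by
  induction b, hab using Nat.le_induction with
  | base => rw [trans_self_succ]; exact h.comm j a hja hb
  | succ b hab ih =>
    have hc : Commute (σ j) (σ b) := h.comm j b (by omega) (by omega)
    rw [trans_succ σ hab]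
    exact (hc.mul_right (ih (by omega))).mul_right hc

theorem commute_trans_of_mem {a b j : ℕ} (haj : a < j) (hjb : j + 1 < b) (hb : b ≤ N) :
    Commute (σ j) (trans σ a b) := by
  induction b, hjb using Nat.le_induction with
  | base =>
    have hZ : Commute (σ (j + 1)) (trans σ a j) :=
      h.commute_trans_of_gt haj (by omega) (by omega)
    have hB := h.braid j (by omega)
    rw [Nat.succ_eq_add_one, trans_succ σ (by omega : a < j + 1), trans_succ σ haj]
    generalize trans σ a j = Z at hZ
    generalize σ j = x at *
    generalize σ (j + 1) = y at *
    calc x * (y * (x * Z * x) * y) = (x * y * x) * Z * (x * y) := by group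
      _ = y * x * (y * Z) * (x * y) := by rw [hB]; group
      _ = y * x * Z * (y * x * y) := by rw [hZ.eq]; group
      _ = y * (x * Z * x) * y * x := by rw [← hB]; group
  | succ b hjb ih =>
    have hc : Commute (σ j) (σ b) := h.comm j b (by omega) (by omega)
    rw [trans_succ σ (by omega : a < b)]
    exact (hc.mul_right (ih (by omega))).mul_right hc

theorem conj_trans_pred {a b : ℕ} (hab : a + 1 < b) (hb : b ≤ N) :
    σ a * trans σ (a + 1) b * σ a = trans σ a b := by
  induction b, hab using Nat.le_induction with
  | base =>
    rw [Nat.succ_eq_add_one, trans_self_succ, trans_succ σ (by omega), trans_self_succ]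
    exact h.braid a (by omega)
  | succ b hab ih =>
    have hc : Commute (σ a) (σ b) := h.comm a b (by omega) (by omega)
    rw [trans_succ σ (by omega : a + 1 < b), trans_succ σ (by omega : a < b), ← ih (by omega)]
    generalize trans σ (a + 1) b = Z
    have h1 := hc.eq
    generalize σ a = x at *
    generalize σ b = y at *
    calc x * (y * Z * y) * x = (x * y) * Z * (y * x) := by group
      _ = y * x * Z * (x * y) := by rw [h1]
      _ = y * (x * Z * x) * y := by group

/-- The generator `σ j` conjugates `(a b)`, where `a < b`, as `(j j+1)` does; the cases are the possible
positions of `j` and `j + 1` with respect to `a` and `b`. -/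
theorem conj_trans_of_lt {a b j : ℕ} (hab : a < b) (hb : b ≤ N) (hj : j < N) :
    σ j * trans σ a b * σ j = trans σ (Equiv.swap j (j + 1) a) (Equiv.swap j (j + 1) b) := by
  rcases lt_trichotomy b j with hbj | rfl | hbj
  · rw [Equiv.swap_apply_of_ne_of_ne (by omega) (by omega),
      Equiv.swap_apply_of_ne_of_ne (by omega) (by omega),
      h.conj_of_commute hj (h.commute_trans_of_gt hab hbj hj)]
  · rw [Equiv.swap_apply_of_ne_of_ne (by omega) (by omega), Equiv.swap_apply_left, trans_succ σ hab]
  rcases lt_trichotomy (j + 1) a with hja | rfl | hja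
  · rw [Equiv.swap_apply_of_ne_of_ne (by omega) (by omega),
      Equiv.swap_apply_of_ne_of_ne (by omega) (by omega),
      h.conj_of_commute hj (h.commute_trans_of_lt hab hja hb)]
  · rw [Equiv.swap_apply_right, Equiv.swap_apply_of_ne_of_ne (by omega) (by omega),
      h.conj_trans_pred hab hb]
  rcases (show j + 1 = b ∨ j + 1 < b by omega) with rfl | hjb
  · rcases (show a = j ∨ a < j by omega) with rfl | haj
    · rw [Equiv.swap_apply_left, Equiv.swap_apply_right, trans_comm σ (a + 1), trans_self_succ,
        h.sq a hj, one_mul]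
    · rw [Equiv.swap_apply_right, Equiv.swap_apply_of_ne_of_ne (by omega) (by omega),
        trans_succ σ haj, h.conj_conj hj]
  · rcases (show a = j ∨ a < j by omega) with rfl | haj
    · rw [Equiv.swap_apply_left, Equiv.swap_apply_of_ne_of_ne (by omega) (by omega),
        ← h.conj_trans_pred hjb hb, h.conj_conj hj]
    · rw [Equiv.swap_apply_of_ne_of_ne (by omega) (by omega),
        Equiv.swap_apply_of_ne_of_ne (by omega) (by omega),
        h.conj_of_commute hj (h.commute_trans_of_mem haj hjb hb)]

theorem simple_conj_trans {a b j : ℕ} (hab : a ≠ b) (ha : a ≤ N) (hb : b ≤ N) (hj : j < N) :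
    σ j * trans σ a b * σ j = trans σ (Equiv.swap j (j + 1) a) (Equiv.swap j (j + 1) b) := by
  rcases hab.lt_or_gt with hab | hab
  · exact h.conj_trans_of_lt hab hb hj
  · rw [trans_comm σ a, h.conj_trans_of_lt hab ha hj, trans_comm]

theorem trans_conj_of_lt {a b c d : ℕ} (hab : a < b) (hb : b ≤ N) (hcd : c ≠ d) (hc : c ≤ N)
    (hd : d ≤ N) :
    trans σ a b * trans σ c d * trans σ a b =
      trans σ (Equiv.swap a b c) (Equiv.swap a b d) := by
  induction b, hab using Nat.le_induction generalizing c d with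
  | base =>
    rw [Nat.succ_eq_add_one, trans_self_succ]
    exact h.simple_conj_trans hcd hc hd hb
  | succ b hab ih =>
    have hle : ∀ x y z : ℕ, x ≤ N → y ≤ N → z ≤ N → Equiv.swap x y z ≤ N := by
      intro x y z hx hy hz
      rw [Equiv.swap_apply_def]; split_ifs <;> assumption
    have hsw : ∀ x, Equiv.swap b (b + 1) (Equiv.swap a b (Equiv.swap b (b + 1) x)) =
        Equiv.swap a (b + 1) x := by
      intro x
      simp only [Equiv.swap_apply_def]
      split_ifs <;> omega
    -- `(a b+1) = (b b+1) (a b) (b b+1)` both in `W` and in the symmetric group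
    rw [trans_succ σ (by omega : a < b)]
    have e := h.simple_conj_trans (j := b) hcd hc hd (by omega)
    have hcd' := (Equiv.swap b (b + 1)).injective.ne hcd
    have hc' := hle b (b + 1) c (by omega) (by omega) hc
    have hd' := hle b (b + 1) d (by omega) (by omega) hd
    have e2 := ih (by omega) hcd' hc' hd'
    have e3 := h.simple_conj_trans (j := b) ((Equiv.swap a b).injective.ne hcd')
      (hle a b _ (by omega) (by omega) hc') (hle a b _ (by omega) (by omega) hd') (by omega)
    rw [hsw, hsw] at e3
    rw [← e3, ← e2, ← e]
    simp only [mul_assoc]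

/-- Transpositions are conjugated as in the symmetric group. -/
theorem trans_conj {a b c d : ℕ} (hab : a ≠ b) (ha : a ≤ N) (hb : b ≤ N) (hcd : c ≠ d)
    (hc : c ≤ N) (hd : d ≤ N) :
    trans σ a b * trans σ c d * trans σ a b =
      trans σ (Equiv.swap a b c) (Equiv.swap a b d) := by
  rcases hab.lt_or_gt with hab | hab
  · exact h.trans_conj_of_lt hab hb hcd hc hd
  · rw [trans_comm σ a b, Equiv.swap_comm a b, h.trans_conj_of_lt hab ha hcd hc hd]

theorem trans_mul_self {a b : ℕ} (hab : a ≠ b) (ha : a ≤ N) (hb : b ≤ N) :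
    trans σ a b * trans σ a b = 1 := by
  have hlt : ∀ {a b : ℕ}, a < b → b ≤ N → trans σ a b * trans σ a b = 1 := by
    intro a b hab hb
    induction b, hab using Nat.le_induction with
    | base => rw [Nat.succ_eq_add_one, trans_self_succ, h.sq a hb]
    | succ b hab ih =>
      have := ih (by omega)
      have hb' := h.sq b (by omega)
      rw [trans_succ σ hab]
      calc _ = σ b * (trans σ a b * (σ b * σ b) * trans σ a b) * σ b := by group
        _ = 1 := by rw [hb', mul_one, this, mul_one, hb']
  rcases hab.lt_or_gt with hab | hab
  · exact hlt hab hb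
  · rw [trans_comm]; exact hlt hab ha

end TypeARelations

end TypeA

/-! ### The action on the roots of the parabolic subgroup -/

noncomputable section

variable {B W : Type*} [Group W] {M : CoxeterMatrix B} (cs : CoxeterSystem M W) {n : ℕ}
  (s : Fin (n - 1) → B)

/-- The simple reflections of the parabolic subgroup, extended by `1`. -/
def simpleSeq (j : ℕ) : W := if h : j < n - 1 then cs.simple (s ⟨j, h⟩) else 1

theorem transp_eq_trans (a b : Fin n) : transp cs s a b = trans (simpleSeq cs s) a b := rfl

/-- The simple roots of the parabolic subgroup, extended by `0`. -/
def simpleRoot (j : ℕ) : B →₀ ℝ := if h : j < n - 1 then Finsupp.single (s ⟨j, h⟩) 1 else 0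

/-- The partial sums of simple roots. The differences `vertexVec s b - vertexVec s a` are the roots
of the parabolic subgroup, so that `vertexVec s a` plays the role of a coordinate vector. -/
def vertexVec (c : ℕ) : B →₀ ℝ := ∑ j ∈ Finset.range c, simpleRoot s j

theorem vertexVec_succ (c : ℕ) : vertexVec s (c + 1) = vertexVec s c + simpleRoot s c :=
  Finset.sum_range_succ _ _

variable {s}
variable (hs : ∀ a b, M (s a) (s b) = CoxeterMatrix.A (n - 1) a b)
include hs

theorem coxeterMatrix_apply {i j : ℕ} (hi : i < n - 1) (hj : j < n - 1) :
    M (s ⟨i, hi⟩) (s ⟨j, hj⟩) = if i = j then 1 else if j + 1 = i ∨ i + 1 = j then 3 else 2 := by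
  rw [hs]
  simp [CoxeterMatrix.A]

theorem typeARelations_simpleSeq : TypeARelations (simpleSeq cs s) (n - 1) where
  sq j hj := by simp [simpleSeq, hj]
  comm i j hij hj := by
    have hi : i < n - 1 := by omega
    have e := cs.simple_mul_simple_pow (s ⟨i, hi⟩) (s ⟨j, hj⟩)
    rw [coxeterMatrix_apply hs hi hj, if_neg (by omega), if_neg (by omega), pow_two] at e
    simp only [simpleSeq, hi, hj, dif_pos]
    have := mul_eq_one_iff_eq_inv.mp e
    rw [mul_inv_rev, cs.inv_simple, cs.inv_simple] at this
    exact this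
  braid j hj := by
    have hj' : j < n - 1 := by omega
    have e := cs.simple_mul_simple_pow (s ⟨j, hj'⟩) (s ⟨j + 1, hj⟩)
    rw [coxeterMatrix_apply hs hj' hj, if_neg (by omega), if_pos (by omega)] at e
    simp only [simpleSeq, hj, hj', dif_pos]
    have e2 : (cs.simple (s ⟨j, hj'⟩) * cs.simple (s ⟨j + 1, hj⟩) * cs.simple (s ⟨j, hj'⟩)) *
        (cs.simple (s ⟨j + 1, hj⟩) * cs.simple (s ⟨j, hj'⟩) * cs.simple (s ⟨j + 1, hj⟩)) = 1 := by
      rw [← e]; simp only [pow_succ, pow_zero, one_mul, mul_assoc]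
    have := mul_eq_one_iff_eq_inv.mp e2
    simp only [mul_inv_rev, cs.inv_simple] at this
    rw [this]; simp only [mul_assoc]

theorem geomRep_simpleSeq_simpleRoot {i j : ℕ} (hi : i < n - 1) (hj : j < n - 1) :
    geomRep cs (simpleSeq cs s j) (simpleRoot s i) = simpleRoot s i -
      (if i = j then (2 : ℝ) else if j + 1 = i ∨ i + 1 = j then -1 else 0) • simpleRoot s j := by
  simp only [simpleSeq, simpleRoot, hi, hj, dif_pos]
  rw [geomRep, cs.lift_apply_simple, simpleReflection, Module.preReflection_apply,
    simpleCoroot_single, coxeterMatrix_apply hs hj hi]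
  congr 2
  by_cases h : i = j
  · simp [h]
  · rw [if_neg (Ne.symm h), if_neg h]
    by_cases h' : j + 1 = i ∨ i + 1 = j
    · rw [if_pos h', if_pos h'.symm]
      norm_num [Real.cos_pi_div_three]
    · rw [if_neg h', if_neg (fun h => h' h.symm)]
      simp [Real.cos_pi_div_two]

theorem geomRep_simpleSeq_vertexVec {c j : ℕ} (hc : c < n) (hj : j < n - 1) :
    geomRep cs (simpleSeq cs s j) (vertexVec s c) =
      vertexVec s (Equiv.swap j (j + 1) c) - vertexVec s (Equiv.swap j (j + 1) 0) := by
  induction c with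
  | zero => simp [vertexVec]
  | succ c ih =>
    rw [vertexVec_succ, map_add, ih (by omega), geomRep_simpleSeq_simpleRoot cs hs (by omega) hj,
      sub_add_eq_add_sub]
    congr 1
    rcases lt_trichotomy c j with h | rfl | h
    · rw [Equiv.swap_apply_of_ne_of_ne (x := c) (by omega) (by omega), if_neg (by omega)]
      rcases (show c + 1 = j ∨ c + 1 < j by omega) with rfl | h'
      · rw [Equiv.swap_apply_left, if_pos (by omega), vertexVec_succ, vertexVec_succ]
        module
      · rw [Equiv.swap_apply_of_ne_of_ne (by omega) (by omega), if_neg (by omega), vertexVec_succ]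
        module
    · rw [Equiv.swap_apply_left, Equiv.swap_apply_right, if_pos rfl, vertexVec_succ]
      module
    · rw [Equiv.swap_apply_of_ne_of_ne (x := c + 1) (by omega) (by omega), if_neg (by omega)]
      rcases (show c = j + 1 ∨ j + 1 < c by omega) with rfl | h'
      · rw [Equiv.swap_apply_right, if_pos (by omega), vertexVec_succ, vertexVec_succ]
        module
      · rw [Equiv.swap_apply_of_ne_of_ne (by omega) (by omega), if_neg (by omega), vertexVec_succ]
        module

theorem vertexVec_apply {c j : ℕ} (hj : j < n - 1) (hc : c < n) :
    vertexVec s c (s ⟨j, hj⟩) = if j < c then 1 else 0 := by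
  have hinj : ∀ {i j : ℕ} (hi : i < n - 1) (hj : j < n - 1), s ⟨i, hi⟩ = s ⟨j, hj⟩ → i = j := by
    intro i j hi hj e
    by_contra hne
    have h1 := coxeterMatrix_apply hs hi hj
    rw [e, M.diagonal, if_neg hne] at h1
    split_ifs at h1 <;> omega
  induction c with
  | zero => simp [vertexVec]
  | succ c ih =>
    have hc' : c < n - 1 := by omega
    rw [vertexVec_succ, Finsupp.add_apply, ih (by omega), simpleRoot, dif_pos hc']
    by_cases h : c = j
    · subst h; simp
    · rw [Finsupp.single_eq_of_ne (fun e => h (hinj hc' hj e.symm))]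
      by_cases h' : j < c
      · rw [if_pos h', if_pos (by omega), add_zero]
      · rw [if_neg h', if_neg (by omega), add_zero]

omit hs in
variable (s) in
/-- The functionals that distinguish the vectors `vertexVec s b` up to a common summand. -/
def vertexCoord (x : ℕ) (u : B →₀ ℝ) : ℝ :=
  (if h : 1 ≤ x ∧ x - 1 < n - 1 then u (s ⟨x - 1, h.2⟩) else 0) -
    (if h : x < n - 1 then u (s ⟨x, h⟩) else 0)

omit hs in
theorem vertexCoord_sub (x : ℕ) (u v : B →₀ ℝ) :
    vertexCoord s x (u - v) = vertexCoord s x u - vertexCoord s x v := by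
  unfold vertexCoord
  split_ifs <;> simp <;> ring

/-- The values at `s 0, …, s (n - 2)` of `vertexVec s c` are `1` before the place `c` and `0` from there on,
so that the descent at `c` can be read off. -/
theorem vertexCoord_vertexVec_sub {x a b : ℕ} (hx : x < n) (ha : a < n) (hb : b < n) :
    vertexCoord s x (vertexVec s a - vertexVec s b) =
      (if x = a then 1 else 0) - (if x = b then 1 else 0) := by
  have key : ∀ c, c < n → vertexCoord s x (vertexVec s c) =
      (if x = c then 1 else 0) - (if x = 0 then 1 else 0) := by
    intro c hc
    unfold vertexCoord
    split_ifs with h1 h2 h3 h4 h5 h6 h7 h8 h9 <;>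
      (try simp only [vertexVec_apply hs _ hc]) <;> (try split_ifs) <;> first | omega | norm_num
  rw [vertexCoord_sub, key a ha, key b hb]
  ring

theorem vertexVec_sub_inj {a b c d : ℕ} (ha : a < n) (hb : b < n) (hc : c < n) (hd : d < n)
    (hab : a ≠ b) (h : vertexVec s a - vertexVec s b = vertexVec s c - vertexVec s d) :
    a = c ∧ b = d := by
  have h1 := congrArg (vertexCoord s a) h
  have h2 := congrArg (vertexCoord s b) h
  rw [vertexCoord_vertexVec_sub hs ha ha hb, vertexCoord_vertexVec_sub hs ha hc hd] at h1
  rw [vertexCoord_vertexVec_sub hs hb ha hb, vertexCoord_vertexVec_sub hs hb hc hd] at h2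
  constructor
  · by_contra hne
    rw [if_pos rfl, if_neg hab, if_neg hne] at h1
    split_ifs at h1 <;> norm_num at h1
  · by_contra hne
    rw [if_pos rfl, if_neg hab.symm, if_neg hne] at h2
    split_ifs at h2 <;> norm_num at h2

omit hs in
variable (s) in
/-- The element `w` permutes the coordinate vectors as `f` does, up to a common summand. -/
def ActsAs (w : W) (f : ℕ → ℕ) : Prop :=
  (∀ a < n, f a < n) ∧ ∀ a < n, ∀ b < n,
    geomRep cs w (vertexVec s a - vertexVec s b) = vertexVec s (f a) - vertexVec s (f b)

omit hs in
theorem ActsAs.one : ActsAs cs s 1 id := ⟨fun _ h => h, fun _ _ _ _ => by simp⟩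

omit hs in
theorem ActsAs.mul {cs : CoxeterSystem M W} {w w' : W} {f f' : ℕ → ℕ} (h : ActsAs cs s w f)
    (h' : ActsAs cs s w' f') : ActsAs cs s (w * w') (f ∘ f') :=
  ⟨fun a ha => h.1 _ (h'.1 a ha), fun a ha b hb => by
    rw [map_mul, Module.End.mul_apply, h'.2 a ha b hb, h.2 _ (h'.1 a ha) _ (h'.1 b hb)]; rfl⟩

theorem ActsAs.unique {cs : CoxeterSystem M W} {w : W} {f f' : ℕ → ℕ} (hn : 2 ≤ n)
    (h : ActsAs cs s w f) (hf : Set.InjOn f (Set.Iio n)) (h' : ActsAs cs s w f') :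
    ∀ a < n, f a = f' a := by
  intro a ha
  obtain ⟨b, hb, hab⟩ : ∃ b, b < n ∧ a ≠ b := by
    by_cases h0 : a = 0
    · exact ⟨1, by omega, by omega⟩
    · exact ⟨0, by omega, h0⟩
  exact (vertexVec_sub_inj hs (h.1 a ha) (h.1 b hb) (h'.1 a ha) (h'.1 b hb)
    (fun e => hab (hf ha hb e)) ((h.2 a ha b hb).symm.trans (h'.2 a ha b hb))).1

theorem actsAs_simpleSeq {j : ℕ} (hj : j < n - 1) :
    ActsAs cs s (simpleSeq cs s j) (Equiv.swap j (j + 1)) := by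
  refine ⟨fun a ha => ?_, fun a ha b hb => ?_⟩
  · rw [Equiv.swap_apply_def]; split_ifs <;> omega
  · rw [map_sub, geomRep_simpleSeq_vertexVec cs hs ha hj, geomRep_simpleSeq_vertexVec cs hs hb hj]
    abel

theorem actsAs_trans {a b : ℕ} (hab : a ≠ b) (ha : a < n) (hb : b < n) :
    ActsAs cs s (trans (simpleSeq cs s) a b) (Equiv.swap a b) := by
  have hlt : ∀ {a b : ℕ}, a < b → b < n →
      ActsAs cs s (trans (simpleSeq cs s) a b) (Equiv.swap a b) := by
    intro a b hab hb
    induction b, hab using Nat.le_induction with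
    | base => rw [Nat.succ_eq_add_one, trans_self_succ]; exact actsAs_simpleSeq cs hs (by omega)
    | succ b hab ih =>
      have h1 := actsAs_simpleSeq cs hs (show b < n - 1 by omega)
      rw [trans_succ _ (by omega : a < b)]
      convert (h1.mul (ih (by omega))).mul h1 using 1
      funext x
      simp only [Function.comp, Equiv.swap_apply_def]
      split_ifs <;> omega
  rcases hab.lt_or_gt with hab | hab
  · exact hlt hab hb
  · rw [trans_comm, Equiv.swap_comm]; exact hlt hab ha

/-- The transpositions are non-trivial in `W`, since they act non-trivially on `V`. -/
theorem trans_ne_one (hn : 2 ≤ n) {a b : ℕ} (hab : a ≠ b) (ha : a < n) (hb : b < n) :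
    trans (simpleSeq cs s) a b ≠ 1 := by
  intro e
  have h := actsAs_trans cs hs hab ha hb
  rw [e] at h
  have := ActsAs.unique hs hn h (Equiv.injective _).injOn (ActsAs.one cs) a ha
  rw [Equiv.swap_apply_left] at this
  exact hab this.symm

/-- Distinct transpositions give distinct elements of `W`. -/
theorem trans_inj (hn : 2 ≤ n) {a b c d : ℕ} (hab : a ≠ b) (ha : a < n) (hb : b < n) (hcd : c ≠ d)
    (hc : c < n) (hd : d < n) (e : trans (simpleSeq cs s) a b = trans (simpleSeq cs s) c d) :
    (a = c ∧ b = d) ∨ (a = d ∧ b = c) := by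
  have h := actsAs_trans cs hs hab ha hb
  rw [e] at h
  have := ActsAs.unique hs hn h (Equiv.injective _).injOn (actsAs_trans cs hs hcd hc hd) a ha
  have hb' := ActsAs.unique hs hn h (Equiv.injective _).injOn (actsAs_trans cs hs hcd hc hd) b hb
  rw [Equiv.swap_apply_left, Equiv.swap_apply_def] at this
  rw [Equiv.swap_apply_right, Equiv.swap_apply_def] at hb'
  split_ifs at this hb' <;> omega

omit hs in
theorem isRootOf_conj {cs : CoxeterSystem M W} {w : W} {v : B →₀ ℝ} (h : IsRootOf cs w v) (g : W) :
    IsRootOf cs (g * w * g⁻¹) (geomRep cs g v) := by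
  obtain ⟨f, hf, h⟩ := h
  have hg : ∀ u, geomRep cs g⁻¹ (geomRep cs g u) = u := fun u => by
    rw [← Module.End.mul_apply, ← map_mul, inv_mul_cancel, map_one, Module.End.one_apply]
  have hg' : ∀ u, geomRep cs g (geomRep cs g⁻¹ u) = u := fun u => by
    rw [← Module.End.mul_apply, ← map_mul, mul_inv_cancel, map_one, Module.End.one_apply]
  refine ⟨f ∘ₗ geomRep cs g⁻¹, by rw [LinearMap.comp_apply, hg, hf], fun u => ?_⟩
  rw [map_mul, map_mul, Module.End.mul_apply, Module.End.mul_apply, h, map_sub, map_smul, hg']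
  rfl

omit hs in
/-- A root of a reflection is unique up to a non-zero scalar. -/
theorem isRootOf_unique {cs : CoxeterSystem M W} {w : W} {v v' : B →₀ ℝ} (h : IsRootOf cs w v)
    (h' : IsRootOf cs w v') : ∃ c : ℝ, c ≠ 0 ∧ v' = c • v := by
  obtain ⟨f, hf, h⟩ := h
  obtain ⟨g, hg, h'⟩ := h'
  have e := (h v').symm.trans (h' v')
  rw [hg, sub_right_inj] at e
  have e' : v' = (f v' / 2) • v := by
    rw [div_eq_inv_mul, mul_smul, e, smul_smul]; norm_num
  refine ⟨_, fun h0 => ?_, e'⟩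
  rw [h0, zero_smul] at e'
  rw [e', map_zero] at hg
  norm_num at hg

theorem isRootOf_trans {a b : ℕ} (hab : a < b) (hb : b < n) :
    IsRootOf cs (trans (simpleSeq cs s) a b) (vertexVec s b - vertexVec s a) := by
  induction b, hab using Nat.le_induction with
  | base =>
    have ha : a < n - 1 := by omega
    rw [Nat.succ_eq_add_one, trans_self_succ, vertexVec_succ, add_sub_cancel_left]
    simp only [simpleSeq, simpleRoot, ha, dif_pos]
    refine ⟨simpleCoroot M (s ⟨a, ha⟩), simpleCoroot_self M _, fun u => ?_⟩
    rw [geomRep, cs.lift_apply_simple]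
    rfl
  | succ b hab ih =>
    have hb' : b < n - 1 := by omega
    have h1 := isRootOf_conj (ih (by omega)) (simpleSeq cs s b)
    rw [(actsAs_simpleSeq cs hs hb').2 b (by omega) a (by omega), Equiv.swap_apply_left,
      Equiv.swap_apply_of_ne_of_ne (by omega) (by omega),
      (typeARelations_simpleSeq cs hs).inv_eq hb'] at h1
    rwa [trans_succ _ (by omega : a < b)]

theorem isReflection_trans {a b : ℕ} (hab : a ≠ b) (ha : a < n) (hb : b < n) :
    cs.IsReflection (trans (simpleSeq cs s) a b) := by
  have hlt : ∀ {a b : ℕ}, a < b → b < n → cs.IsReflection (trans (simpleSeq cs s) a b) := by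
    intro a b hab hb
    induction b, hab using Nat.le_induction with
    | base =>
      have ha : a < n - 1 := by omega
      rw [Nat.succ_eq_add_one, trans_self_succ]
      simp only [simpleSeq, ha, dif_pos]
      exact cs.isReflection_simple _
    | succ b hab ih =>
      have h1 := (ih (by omega)).conj (simpleSeq cs s b)
      rw [(typeARelations_simpleSeq cs hs).inv_eq (show b < n - 1 by omega)] at h1
      rwa [trans_succ _ (by omega : a < b)]
  rcases hab.lt_or_gt with hab | hab
  · exact hlt hab hb
  · rw [trans_comm]; exact hlt hab ha

/-- The chosen root of `(a b)` is a non-zero multiple of the difference of coordinate vectors. -/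
theorem root_trans {α : W → (B →₀ ℝ)} (hα : ∀ p, cs.IsReflection p → IsRootOf cs p (α p))
    {a b : ℕ} (hab : a ≠ b) (ha : a < n) (hb : b < n) :
    ∃ c : ℝ, c ≠ 0 ∧ α (trans (simpleSeq cs s) a b) = c • (vertexVec s b - vertexVec s a) := by
  have h1 := hα _ (isReflection_trans cs hs hab ha hb)
  rcases hab.lt_or_gt with h | h
  · exact isRootOf_unique (isRootOf_trans cs hs h hb) h1
  · rw [trans_comm] at h1 ⊢
    obtain ⟨c, hc, e⟩ := isRootOf_unique (isRootOf_trans cs hs h ha) h1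
    exact ⟨-c, neg_ne_zero.mpr hc, by rw [e]; module⟩

end

/-! ### Folding subexpressions -/

section Folding

variable {W : Type*} [Group W] {m : ℕ}

/-- The product of the first `k` factors of a subexpression. -/
def partialProd (t : Fin m → W) (ε : Fin m → Bool) (k : ℕ) : W := ((factors t ε).take k).prod

theorem partialProd_zero (t : Fin m → W) (ε : Fin m → Bool) : partialProd t ε 0 = 1 := rfl

theorem partialProd_succ (t : Fin m → W) (ε : Fin m → Bool) (i : Fin m) :
    partialProd t ε (i + 1) = partialProd t ε i * if ε i then t i else 1 := by
  unfold partialProd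
  rw [List.prod_take_succ _ _ (by simp [factors])]
  simp [factors]

theorem mem_subTo_one {t : Fin m → W} {ε : Fin m → Bool} :
    ε ∈ subTo t 1 ↔ partialProd t ε m = 1 := by
  rw [partialProd, List.take_of_length_le (by simp [factors])]
  simp [subTo]

theorem reflAt_eq (t : Fin m → W) (ε : Fin m → Bool) (i : Fin m) :
    reflAt t ε i = partialProd t ε i * t i * (partialProd t ε i)⁻¹ := rfl

/-- Changing `ε` by `y` multiplies the partial products by those of the subexpression `y` of the sequence
of the reflections `ε^i`. -/
theorem partialProd_xor {t : Fin m → W} (ht : ∀ i, t i * t i = 1) (ε y : Fin m → Bool) {k : ℕ}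
    (hk : k ≤ m) : partialProd t (fun i => xor (ε i) (y i)) k =
      partialProd (reflAt t ε) y k * partialProd t ε k := by
  induction k with
  | zero => simp [partialProd_zero]
  | succ k ih =>
    have e := partialProd_succ t (fun i => xor (ε i) (y i)) ⟨k, hk⟩
    have e' := partialProd_succ t ε ⟨k, hk⟩
    have e'' := partialProd_succ (reflAt t ε) y ⟨k, hk⟩
    have hk' := ht ⟨k, hk⟩
    simp only at e e' e''
    rw [e, e', e'', ih (by omega), reflAt_eq]
    rcases ε ⟨k, hk⟩ <;> rcases y ⟨k, hk⟩ <;> simp [mul_assoc, hk']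

/-- From the viewpoint of `ε`, the sequence `t` looks like the sequence of the reflections `ε^i`. -/
theorem reflAt_xor {t : Fin m → W} (ht : ∀ i, t i * t i = 1) (ε y : Fin m → Bool) (i : Fin m) :
    reflAt t (fun i => xor (ε i) (y i)) i = reflAt (reflAt t ε) y i := by
  rw [reflAt_eq, reflAt_eq, partialProd_xor ht ε y i.isLt.le, reflAt_eq t ε]
  simp only [mul_inv_rev, mul_assoc]

theorem fold_eq_xor (Y : Finset (Fin m)) (ε : Fin m → Bool) :
    fold Y ε = fun i => xor (ε i) (decide (i ∈ Y)) := by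
  funext i
  by_cases h : i ∈ Y <;> simp [fold, h]

theorem fold_fold (Y : Finset (Fin m)) (ε : Fin m → Bool) : fold Y (fold Y ε) = ε := by
  funext i
  by_cases h : i ∈ Y <;> simp [fold, h]

theorem fold_apply_ne_iff {Y : Finset (Fin m)} {ε : Fin m → Bool} {i : Fin m} :
    ε i ≠ fold Y ε i ↔ i ∈ Y := by
  by_cases h : i ∈ Y <;> simp [fold, h]

theorem fold_of_ne_iff {Y : Finset (Fin m)} {ε δ : Fin m → Bool} (h : ∀ i, ε i ≠ δ i ↔ i ∈ Y) :
    δ = fold Y ε := by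
  funext i
  by_cases hi : i ∈ Y
  · have := (h i).mpr hi
    simp only [fold, hi, if_true]
    revert this
    cases ε i <;> cases δ i <;> simp
  · have := not_not.mp (mt (h i).mp hi)
    simp [fold, hi, this]

theorem reflAt_mul_self {t : Fin m → W} (ht : ∀ i, t i * t i = 1) (ε : Fin m → Bool) (i : Fin m) :
    reflAt t ε i * reflAt t ε i = 1 := by
  rw [reflAt_eq]
  calc _ = partialProd t ε i * (t i * t i) * (partialProd t ε i)⁻¹ := by group
    _ = 1 := by rw [ht, mul_one, mul_inv_cancel]

/-- If only two positions with the same entry `p` are taken, then the partial products are `p` in between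
and `1` elsewhere. -/
theorem partialProd_pair {r : Fin m → W} {lo hi : Fin m} (hlt : lo < hi) {p : W} (hp : p * p = 1)
    (hlo : r lo = p) (hhi : r hi = p) {k : ℕ} (hk : k ≤ m) :
    partialProd r (fun i => decide (i ∈ ({lo, hi} : Finset (Fin m)))) k =
      if (lo : ℕ) < k ∧ k ≤ hi then p else 1 := by
  have hlt' : (lo : ℕ) < hi := hlt
  induction k with
  | zero => simp [partialProd_zero]
  | succ k ih =>
    have e := partialProd_succ r (fun i => decide (i ∈ ({lo, hi} : Finset (Fin m)))) ⟨k, hk⟩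
    simp only at e
    rw [e, ih (by omega)]
    by_cases h1 : (lo : ℕ) = k
    · obtain rfl : lo = ⟨k, hk⟩ := Fin.ext h1
      simp only at hlt'
      have h2 : ¬ (k < k ∧ k ≤ (hi : ℕ)) := by omega
      have h3 : k < k + 1 ∧ k + 1 ≤ (hi : ℕ) := by omega
      simp only [h2, h3, if_false, if_true, and_self]
      simp [hlo]
    · by_cases h2 : (hi : ℕ) = k
      · obtain rfl : hi = ⟨k, hk⟩ := Fin.ext h2
        simp only at hlt'
        have h2 : (lo : ℕ) < k ∧ k ≤ k := by omega
        have h3 : ¬ ((lo : ℕ) < k + 1 ∧ k + 1 ≤ k) := by omega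
        simp only [h2, h3, if_false, if_true, and_self]
        simp [hhi, hp]
      · have h3 : (⟨k, hk⟩ : Fin m) ∉ ({lo, hi} : Finset (Fin m)) := by
          simp only [Finset.mem_insert, Finset.mem_singleton, Fin.ext_iff]
          omega
        simp only [h3, decide_false, Bool.false_eq_true, if_false, mul_one]
        congr 1
        rw [eq_iff_iff]
        omega

/-- Flipping two positions with the same reflection `p` preserves the target. -/
theorem fold_pair_mem_subTo {t : Fin m → W} (ht : ∀ i, t i * t i = 1) {ε : Fin m → Bool}
    {lo hi : Fin m} (hlt : lo < hi) (he : reflAt t ε lo = reflAt t ε hi) (hε : ε ∈ subTo t 1) :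
    fold {lo, hi} ε ∈ subTo t 1 := by
  rw [mem_subTo_one] at hε ⊢
  rw [fold_eq_xor, partialProd_xor ht _ _ le_rfl, hε, mul_one,
    partialProd_pair hlt (reflAt_mul_self ht ε lo) rfl he.symm le_rfl, if_neg]
  have := hi.isLt
  omega

/-- Flipping two positions with the same reflection `p` conjugates by `p` the reflections in between
and preserves the other ones. -/
theorem reflAt_fold_pair {t : Fin m → W} (ht : ∀ i, t i * t i = 1) {ε : Fin m → Bool}
    {lo hi : Fin m} (hlt : lo < hi) {p : W} (hlo : reflAt t ε lo = p) (hhi : reflAt t ε hi = p)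
    (i : Fin m) : reflAt t (fold {lo, hi} ε) i =
      if lo < i ∧ i ≤ hi then p * reflAt t ε i * p else reflAt t ε i := by
  have hp : p * p = 1 := by rw [← hlo]; exact reflAt_mul_self ht ε lo
  rw [fold_eq_xor, reflAt_xor ht, reflAt_eq (reflAt t ε),
    partialProd_pair hlt hp hlo hhi i.isLt.le]
  simp only [Fin.lt_def, Fin.le_def]
  split_ifs
  · rw [inv_eq_of_mul_eq_one_right hp]
  · simp

/-- Flipping one position changes the target. -/
theorem fold_singleton_notMem_subTo {t : Fin m → W} (ht : ∀ i, t i * t i = 1) {ε : Fin m → Bool}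
    {i : Fin m} (hi : t i ≠ 1) (hε : ε ∈ subTo t 1) : fold {i} ε ∉ subTo t 1 := by
  have key : ∀ k ≤ m, partialProd (reflAt t ε) (fun j => decide (j ∈ ({i} : Finset (Fin m)))) k =
      if (i : ℕ) < k then reflAt t ε i else 1 := by
    intro k hk
    induction k with
    | zero => simp [partialProd_zero]
    | succ k ih =>
      have e := partialProd_succ (reflAt t ε)
        (fun j => decide (j ∈ ({i} : Finset (Fin m)))) ⟨k, hk⟩
      simp only at e
      rw [e, ih (by omega)]
      by_cases h1 : (i : ℕ) = k
      · obtain rfl : i = ⟨k, hk⟩ := Fin.ext h1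
        simp
      · have h3 : (⟨k, hk⟩ : Fin m) ∉ ({i} : Finset (Fin m)) := by
          simp only [Finset.mem_singleton, Fin.ext_iff]
          omega
        simp only [h3, decide_false, Bool.false_eq_true, if_false, mul_one]
        congr 1
        rw [eq_iff_iff]
        omega
  -- the target is multiplied by the reflection at the flipped position
  rw [mem_subTo_one] at hε ⊢
  rw [fold_eq_xor, partialProd_xor ht _ _ le_rfl, hε, mul_one, key m le_rfl, if_pos i.isLt, reflAt_eq]
  intro h
  apply hi
  rwa [mul_inv_eq_one, mul_eq_left] at h

end Folding

/-! ### Relabelled `D`-sequences -/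

/-- The first end of the `v`-th transposition of the standard `D`-sequence. -/
def dLeft (n v : ℕ) : ℕ := if v < n - 1 then 0 else v - (n - 1)

/-- The second end of the `v`-th transposition of the standard `D`-sequence. -/
def dRight (n v : ℕ) : ℕ :=
  if v < n - 1 then v + 1 else if v = n - 1 + n - 1 then 0 else v - (n - 1) + 1

theorem dLeft_lt {n v : ℕ} (hn : 3 ≤ n) (hv : v < n - 1 + n) : dLeft n v < n := by
  unfold dLeft; split_ifs <;> omega

theorem dRight_lt {n v : ℕ} (hn : 3 ≤ n) (hv : v < n - 1 + n) : dRight n v < n := by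
  unfold dRight; split_ifs <;> omega

theorem dLeft_ne_dRight {n v : ℕ} (hn : 3 ≤ n) : dLeft n v ≠ dRight n v := by
  unfold dLeft dRight; split_ifs <;> omega

/-- The `v`-th entry of the `D`-sequence with the labels `u 0, …, u (n - 1)`. -/
def dEntry {W : Type*} [Group W] (σ : ℕ → W) (n : ℕ) (u : ℕ → ℕ) (v : ℕ) : W :=
  trans σ (u (dLeft n v)) (u (dRight n v))

/-- `u` restricts to a permutation of `0, …, n - 1`. -/
structure IsLabelling (n : ℕ) (u : ℕ → ℕ) : Prop where
  lt : ∀ a < n, u a < n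
  injOn : ∀ a < n, ∀ b < n, u a = u b → a = b

/-- The labels moved by one place. -/
def rotLabel (n : ℕ) (u : ℕ → ℕ) (j : ℕ) : ℕ := if j + 1 < n then u (j + 1) else u 0

theorem IsLabelling.rotLabel {n : ℕ} {u : ℕ → ℕ} (h : IsLabelling n u) :
    IsLabelling n (rotLabel n u) where
  lt a ha := by
    unfold ReflExpr.rotLabel
    split_ifs with h'
    · exact h.lt _ h'
    · exact h.lt _ (by omega)
  injOn a ha b hb e := by
    unfold ReflExpr.rotLabel at e
    split_ifs at e with h1 h2 h2
    · have := h.injOn _ h1 _ h2 e; omega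
    · have := h.injOn _ h1 0 (by omega) e; omega
    · have := h.injOn 0 (by omega) _ h2 e; omega
    · omega

theorem IsLabelling.swap {n : ℕ} {u : ℕ → ℕ} (h : IsLabelling n u) {x y : ℕ} (hx : x < n)
    (hy : y < n) : IsLabelling n (fun j => Equiv.swap x y (u j)) where
  lt a ha := by
    have := h.lt a ha
    simp only [Equiv.swap_apply_def]
    split_ifs <;> assumption
  injOn a ha b hb e := h.injOn a ha b hb ((Equiv.swap x y).injective e)

section DEntry

variable {W : Type*} [Group W] {σ : ℕ → W} {n : ℕ} {u : ℕ → ℕ}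

theorem dEntry_ne (hn : 3 ≤ n) (hu : IsLabelling n u) {v : ℕ} (hv : v < n - 1 + n) :
    u (dLeft n v) ≠ u (dRight n v) := fun e =>
  dLeft_ne_dRight hn (hu.injOn _ (dLeft_lt hn hv) _ (dRight_lt hn hv) e)

theorem dEntry_conj (hσ : TypeARelations σ (n - 1)) (hn : 3 ≤ n) (hu : IsLabelling n u)
    {x y : ℕ} (hxy : x ≠ y) (hx : x < n) (hy : y < n) {v : ℕ} (hv : v < n - 1 + n) :
    trans σ x y * dEntry σ n u v * trans σ x y =
      dEntry σ n (fun j => Equiv.swap x y (u j)) v := by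
  have h1 := hu.lt _ (dLeft_lt hn hv)
  have h2 := hu.lt _ (dRight_lt hn hv)
  exact hσ.trans_conj hxy (by omega) (by omega) (dEntry_ne hn hu hv) (by omega) (by omega)

/-- Conjugating by the first entry the entries of a `D`-sequence up to the second occurrence of the
first one gives the `D`-sequence with rotated labels, read cyclically from another place. -/
theorem dEntry_rotLabel (hσ : TypeARelations σ (n - 1)) (hn : 3 ≤ n) (hu : IsLabelling n u)
    {v : ℕ} (hv : v < n - 1 + n) :
    dEntry σ n (rotLabel n u) (if v = 0 then n - 1 + n - 1 else v - 1) =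
      if 1 ≤ v ∧ v ≤ n - 1 then trans σ (u 0) (u 1) * dEntry σ n u v * trans σ (u 0) (u 1)
      else dEntry σ n u v := by
  have h01 : u 0 ≠ u 1 := fun e => by
    have := hu.injOn 0 (by omega) 1 (by omega) e
    omega
  have hu0 := hu.lt 0 (by omega)
  have hu1 := hu.lt 1 (by omega)
  rcases Nat.eq_zero_or_pos v with rfl | hv0
  · rw [if_pos rfl, if_neg (by omega)]
    have e1 : dLeft n (n - 1 + n - 1) = n - 1 := by unfold dLeft; split_ifs <;> omega
    have e2 : dRight n (n - 1 + n - 1) = 0 := by unfold dRight; split_ifs <;> omega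
    have e3 : dLeft n 0 = 0 := by unfold dLeft; split_ifs <;> omega
    have e4 : dRight n 0 = 1 := by unfold dRight; split_ifs <;> omega
    rw [dEntry, dEntry, e1, e2, e3, e4, rotLabel, rotLabel, if_neg (by omega), if_pos (by omega)]
  rw [if_neg (by omega)]
  by_cases h : v ≤ n - 1
  · rw [if_pos ⟨hv0, h⟩, dEntry_conj hσ hn hu h01 hu0 hu1 hv]
    have e1 : dLeft n (v - 1) = 0 := by unfold dLeft; split_ifs <;> omega
    have e2 : dRight n (v - 1) = v := by unfold dRight; split_ifs <;> omega
    have e3 : dLeft n v = 0 := by unfold dLeft; split_ifs <;> omega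
    have e6 : rotLabel n u 0 = u 1 := by rw [rotLabel, if_pos (by omega)]
    rw [dEntry, dEntry, e1, e2, e3, e6]
    simp only [Equiv.swap_apply_left]
    by_cases h' : v = n - 1
    · have e4 : dRight n v = 1 := by unfold dRight; split_ifs <;> omega
      rw [e4, Equiv.swap_apply_right, rotLabel, if_neg (by omega)]
    · have e4 : dRight n v = v + 1 := by unfold dRight; split_ifs <;> omega
      have hne0 : u (v + 1) ≠ u 0 := fun e => by
        have := hu.injOn (v + 1) (by omega) 0 (by omega) e
        omega
      have hne1 : u (v + 1) ≠ u 1 := fun e => by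
        have := hu.injOn (v + 1) (by omega) 1 (by omega) e
        omega
      rw [e4, Equiv.swap_apply_of_ne_of_ne hne0 hne1, rotLabel, if_pos (by omega)]
  · rw [if_neg (by omega)]
    have e1 : dLeft n (v - 1) = v - n := by unfold dLeft; split_ifs <;> omega
    have e2 : dRight n (v - 1) = v - n + 1 := by unfold dRight; split_ifs <;> omega
    have e3 : dLeft n v = v - n + 1 := by unfold dLeft; split_ifs <;> omega
    rw [dEntry, dEntry, e1, e2, e3, rotLabel, rotLabel, if_pos (by omega)]
    by_cases h' : v = n - 1 + n - 1
    · have e4 : dRight n v = 0 := by unfold dRight; split_ifs <;> omega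
      rw [e4, if_neg (by omega)]
    · have e4 : dRight n v = v - n + 1 + 1 := by unfold dRight; split_ifs <;> omega
      rw [e4, if_pos (by omega)]

end DEntry

/-! ### Positions modulo `2n - 1` -/

/-- The positions whose residues form the chord `{a, n - 1 + a}`. -/
noncomputable def chordPos (n : ℕ) (a : ZMod (n - 1 + n)) : Finset (Fin (n - 1 + n)) :=
  open Classical in Finset.univ.filter fun i => ((i : ℕ) : ZMod (n - 1 + n)) + 1 ∈ chord n a

section Positions

variable {n : ℕ}

theorem val_cast_sub (hn : 3 ≤ n) (a : ZMod (n - 1 + n)) (i : Fin (n - 1 + n)) :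
    (((i : ℕ) : ZMod (n - 1 + n)) - a).val =
      if a.val ≤ i then i - a.val else i + (n - 1 + n) - a.val := by
  have : NeZero (n - 1 + n) := ⟨by omega⟩
  have ha := ZMod.val_lt a
  have hi := i.isLt
  have e : a = (a.val : ZMod (n - 1 + n)) := (ZMod.natCast_zmod_val a).symm
  split_ifs with h
  · have : ((i : ℕ) : ZMod (n - 1 + n)) - a = ((i - a.val : ℕ) : ZMod (n - 1 + n)) := by
      rw [Nat.cast_sub h, ← e]
    rw [this, ZMod.val_natCast_of_lt (by omega)]
  · have : ((i : ℕ) : ZMod (n - 1 + n)) - a =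
        ((i + (n - 1 + n) - a.val : ℕ) : ZMod (n - 1 + n)) := by
      rw [Nat.cast_sub (by omega), ← e, Nat.cast_add, ZMod.natCast_self, add_zero]
    rw [this, ZMod.val_natCast_of_lt (by omega)]

theorem val_sub_one (hn : 3 ≤ n) (z : ZMod (n - 1 + n)) :
    (z - 1).val = if z.val = 0 then n - 1 + n - 1 else z.val - 1 := by
  have : NeZero (n - 1 + n) := ⟨by omega⟩
  have hz := ZMod.val_lt z
  have e : z = (z.val : ZMod (n - 1 + n)) := (ZMod.natCast_zmod_val z).symm
  split_ifs with h
  · have : z - 1 = ((n - 1 + n - 1 : ℕ) : ZMod (n - 1 + n)) := by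
      rw [Nat.cast_sub (by omega), ZMod.natCast_self, e, h]; simp
    rw [this, ZMod.val_natCast_of_lt (by omega)]
  · have : z - 1 = ((z.val - 1 : ℕ) : ZMod (n - 1 + n)) := by
      rw [Nat.cast_sub (by omega), ← e]; simp
    rw [this, ZMod.val_natCast_of_lt (by omega)]

theorem val_eq_iff (hn : 3 ≤ n) (z : ZMod (n - 1 + n)) {v : ℕ} (hv : v < n - 1 + n) :
    z.val = v ↔ z = v := by
  have : NeZero (n - 1 + n) := ⟨by omega⟩
  constructor
  · rintro rfl; simp
  · rintro rfl; exact ZMod.val_natCast_of_lt hv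

theorem natCast_pred (hn : 3 ≤ n) : ((n - 1 : ℕ) : ZMod (n - 1 + n)) = (n : ZMod (n - 1 + n)) - 1 := by
  rw [Nat.cast_sub (by omega), Nat.cast_one]

theorem two_mul_natCast_pred (hn : 3 ≤ n) :
    (n : ZMod (n - 1 + n)) - 1 + n = 0 := by
  rw [← natCast_pred hn, ← Nat.cast_add, ZMod.natCast_self]

/-- The chord `a + 1` consists of the places of the entry `(u 0 u 1)` of a `D`-sequence whose initial entry
is at the position `a`. -/
theorem mem_chordPos_succ (hn : 3 ≤ n) (a : ZMod (n - 1 + n)) (i : Fin (n - 1 + n)) :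
    i ∈ chordPos n (a + 1) ↔ (((i : ℕ) : ZMod (n - 1 + n)) - a).val = 0 ∨
      (((i : ℕ) : ZMod (n - 1 + n)) - a).val = n - 1 := by
  rw [val_eq_iff hn _ (by omega), val_eq_iff hn _ (by omega), natCast_pred hn]
  simp only [chordPos, Finset.mem_filter, Finset.mem_univ, true_and, chord, Set.mem_insert_iff,
    Set.mem_singleton_iff, Nat.cast_zero]
  constructor
  · rintro (h | h)
    · exact Or.inl (by linear_combination h)
    · exact Or.inr (by linear_combination h)
  · rintro (h | h)
    · exact Or.inl (by linear_combination h)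
    · exact Or.inr (by linear_combination h)

/-- The chord `a` consists of the places of the entry `(u 0 u (n - 1))` of a `D`-sequence whose initial entry
is at the position `a`. -/
theorem mem_chordPos (hn : 3 ≤ n) (a : ZMod (n - 1 + n)) (i : Fin (n - 1 + n)) :
    i ∈ chordPos n a ↔ (((i : ℕ) : ZMod (n - 1 + n)) - a).val = n - 2 ∨
      (((i : ℕ) : ZMod (n - 1 + n)) - a).val = n - 1 + n - 1 := by
  have : NeZero (n - 1 + n) := ⟨by omega⟩
  have h := mem_chordPos_succ hn (a - 1) i
  rw [sub_add_cancel] at h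
  have hlt := ZMod.val_lt (((i : ℕ) : ZMod (n - 1 + n)) - a)
  have h2 := val_sub_one hn (((i : ℕ) : ZMod (n - 1 + n)) - (a - 1))
  have hlt2 := ZMod.val_lt (((i : ℕ) : ZMod (n - 1 + n)) - (a - 1))
  rw [show ((i : ℕ) : ZMod (n - 1 + n)) - (a - 1) - 1 = ((i : ℕ) : ZMod (n - 1 + n)) - a by ring] at h2
  rw [h]
  split_ifs at h2 <;> omega

end Positions

/-- `r` is the `D`-sequence with the labels `u`, whose initial entry is at the position `a`. -/
def IsDSeq {W : Type*} [Group W] (σ : ℕ → W) (n : ℕ) (u : ℕ → ℕ) (a : ZMod (n - 1 + n))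
    (r : Fin (n - 1 + n) → W) : Prop :=
  ∀ i : Fin (n - 1 + n), r i = dEntry σ n u (((i : ℕ) : ZMod (n - 1 + n)) - a).val

section Step

variable {W : Type*} [Group W] {σ : ℕ → W} {n : ℕ} {u : ℕ → ℕ} {t : Fin (n - 1 + n) → W}
  {ε : Fin (n - 1 + n) → Bool} {a : ZMod (n - 1 + n)}

/-- The two positions `lo < hi` of a chord cut the positions, counted from `a` modulo `2n - 1`, into the
places `1, …, n - 1` and the other ones; the interval from `lo` to `hi` is one of these two parts,
depending on the place where the counting passes the end of the sequence. -/
theorem exists_chordPos_succ (hn : 3 ≤ n) (a : ZMod (n - 1 + n)) :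
    ∃ lo hi : Fin (n - 1 + n), lo < hi ∧ chordPos n (a + 1) = {lo, hi} ∧
      ((∀ i : Fin (n - 1 + n), (lo < i ∧ i ≤ hi) ↔
        1 ≤ (((i : ℕ) : ZMod (n - 1 + n)) - a).val ∧
          (((i : ℕ) : ZMod (n - 1 + n)) - a).val ≤ n - 1) ∨
      (∀ i : Fin (n - 1 + n), (lo < i ∧ i ≤ hi) ↔
        ¬ (1 ≤ (((i : ℕ) : ZMod (n - 1 + n)) - a).val ∧
          (((i : ℕ) : ZMod (n - 1 + n)) - a).val ≤ n - 1))) := by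
  have : NeZero (n - 1 + n) := ⟨by omega⟩
  have ha := ZMod.val_lt a
  rcases Nat.lt_or_ge (a.val + (n - 1)) (n - 1 + n) with h | h
  · refine ⟨⟨a.val, ha⟩, ⟨a.val + (n - 1), h⟩, Fin.lt_def.mpr (by dsimp only; omega), ?_, Or.inl fun i => ?_⟩
    · ext i
      have hi := i.isLt
      rw [mem_chordPos_succ hn, val_cast_sub hn]
      simp only [Finset.mem_insert, Finset.mem_singleton, Fin.ext_iff]
      split_ifs <;> omega
    · have hi := i.isLt
      rw [val_cast_sub hn]
      simp only [Fin.lt_def, Fin.le_def]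
      split_ifs <;> omega
  · refine ⟨⟨a.val - n, by omega⟩, ⟨a.val, ha⟩, Fin.lt_def.mpr (by dsimp only; omega), ?_, Or.inr fun i => ?_⟩
    · ext i
      have hi := i.isLt
      rw [mem_chordPos_succ hn, val_cast_sub hn]
      simp only [Finset.mem_insert, Finset.mem_singleton, Fin.ext_iff]
      split_ifs <;> omega
    · have hi := i.isLt
      rw [val_cast_sub hn]
      simp only [Fin.lt_def, Fin.le_def]
      split_ifs <;> omega

theorem dEntry_zero (hn : 3 ≤ n) : dEntry σ n u 0 = trans σ (u 0) (u 1) := by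
  have e3 : dLeft n 0 = 0 := by unfold dLeft; split_ifs <;> omega
  have e4 : dRight n 0 = 1 := by unfold dRight; split_ifs <;> omega
  rw [dEntry, e3, e4]

theorem dEntry_pred (hn : 3 ≤ n) : dEntry σ n u (n - 1) = trans σ (u 0) (u 1) := by
  have e3 : dLeft n (n - 1) = 0 := by unfold dLeft; split_ifs <;> omega
  have e4 : dRight n (n - 1) = 1 := by unfold dRight; split_ifs <;> omega
  rw [dEntry, e3, e4]

/-- Flipping the two positions of the initial entry of a `D`-sequence gives again a `D`-sequence,
whose initial entry is at the next position. -/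
theorem IsDSeq.step (hσ : TypeARelations σ (n - 1)) (hn : 3 ≤ n) (ht : ∀ i, t i * t i = 1)
    (hu : IsLabelling n u) (h : IsDSeq σ n u a (reflAt t ε)) :
    (∃ u', IsLabelling n u' ∧
      (u' = rotLabel n u ∨ u' = fun j => Equiv.swap (u 0) (u 1) (rotLabel n u j)) ∧
      IsDSeq σ n u' (a + 1) (reflAt t (fold (chordPos n (a + 1)) ε))) ∧
    (ε ∈ subTo t 1 → fold (chordPos n (a + 1)) ε ∈ subTo t 1) ∧
    ∀ i ∈ chordPos n (a + 1), reflAt t (fold (chordPos n (a + 1)) ε) i = trans σ (u 0) (u 1) := by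
  have : NeZero (n - 1 + n) := ⟨by omega⟩
  have h01 : u 0 ≠ u 1 := fun e => by
    have := hu.injOn 0 (by omega) 1 (by omega) e
    omega
  have hu0 := hu.lt 0 (by omega)
  have hu1 := hu.lt 1 (by omega)
  have hpp := hσ.trans_mul_self h01 (by omega) (by omega)
  have hp : ∀ i ∈ chordPos n (a + 1), reflAt t ε i = trans σ (u 0) (u 1) := by
    intro i hi
    rw [h i]
    rcases (mem_chordPos_succ hn a i).mp hi with e | e
    · rw [e, dEntry_zero hn]
    · rw [e, dEntry_pred hn]
  obtain ⟨lo, hi, hlt, hY, hint⟩ := exists_chordPos_succ hn a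
  have hlo := hp lo (by rw [hY]; simp)
  have hhi := hp hi (by rw [hY]; simp)
  have key := reflAt_fold_pair ht hlt hlo hhi
  rw [← hY] at key
  refine ⟨?_, fun hε => ?_, fun i hi' => ?_⟩
  · -- if the flipped positions enclose the complementary part, then all entries have to be conjugated
    -- once more by the first one, which interchanges the labels `u 0` and `u 1`
    rcases hint with hint | hint
    · refine ⟨_, hu.rotLabel, Or.inl rfl, fun i => ?_⟩
      have hv := ZMod.val_lt (((i : ℕ) : ZMod (n - 1 + n)) - a)
      rw [key, ← sub_sub, val_sub_one hn, dEntry_rotLabel hσ hn hu hv, ← h i]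
      simp only [hint]
    · refine ⟨_, hu.rotLabel.swap hu0 hu1, Or.inr rfl, fun i => ?_⟩
      have hv := ZMod.val_lt (((i : ℕ) : ZMod (n - 1 + n)) - a)
      rw [key, ← sub_sub, val_sub_one hn,
        ← dEntry_conj hσ hn hu.rotLabel h01 hu0 hu1 (by split_ifs <;> omega),
        dEntry_rotLabel hσ hn hu hv, ← h i]
      simp only [hint]
      split_ifs
      · calc _ = (trans σ (u 0) (u 1) * trans σ (u 0) (u 1)) * reflAt t ε i *
              (trans σ (u 0) (u 1) * trans σ (u 0) (u 1)) := by rw [hpp, one_mul, mul_one]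
          _ = _ := by group
      · rfl
  · rw [hY]
    exact fold_pair_mem_subTo ht hlt (hlo.trans hhi.symm) hε
  · rw [key, hp i hi', hpp, one_mul, ite_self]

end Step

/-- The labels given by a permutation, extended by `0`. -/
def permLabel {n : ℕ} (i : Equiv.Perm (Fin n)) (c : ℕ) : ℕ := if h : c < n then i ⟨c, h⟩ else 0

theorem isLabelling_permLabel {n : ℕ} (i : Equiv.Perm (Fin n)) : IsLabelling n (permLabel i) where
  lt a ha := by simp [permLabel, ha]
  injOn a ha b hb e := by
    simp only [permLabel, ha, hb, dif_pos] at e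
    simpa using i.injective (Fin.ext e)

theorem permLabel_val {n : ℕ} (i : Equiv.Perm (Fin n)) (c : Fin n) : permLabel i c = i c := by
  simp [permLabel]

theorem DSeq_apply {B W : Type*} [Group W] {M : CoxeterMatrix B} (cs : CoxeterSystem M W) {n : ℕ}
    (hn : 3 ≤ n) (s : Fin (n - 1) → B) (i : Equiv.Perm (Fin n)) (v : ℕ) (hv : v < n - 1 + n) :
    DSeq cs s i ⟨v, hv⟩ = dEntry (simpleSeq cs s) n (permLabel i) v := by
  by_cases h : v < n - 1
  · have e : (⟨v, hv⟩ : Fin (n - 1 + n)) = Fin.castAdd n ⟨v, h⟩ := rfl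
    rw [DSeq, e, Fin.append_left, aSeq, transp_eq_trans, ← permLabel_val, ← permLabel_val, dEntry]
    simp [dLeft, dRight, h]
  · have e : (⟨v, hv⟩ : Fin (n - 1 + n)) = Fin.natAdd (n - 1) ⟨v - (n - 1), by omega⟩ := by
      ext; simp; omega
    rw [DSeq, e, Fin.append_right, cSeq, transp_eq_trans, ← permLabel_val, ← permLabel_val, dEntry]
    simp only [dLeft, dRight, h, if_false]
    congr 2
    obtain ⟨k, rfl⟩ : ∃ k, n = k + 1 := ⟨n - 1, by omega⟩
    split_ifs with h'
    · subst h'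
      have : (⟨k + 1 - 1 + (k + 1) - 1 - (k + 1 - 1), by omega⟩ : Fin (k + 1)) = Fin.last k := by
        ext; simp
      rw [this, finRotate_last]; simp
    · have h2 : v - (k + 1 - 1) < k := by omega
      rw [finRotate_of_lt h2]

theorem isDSeq_cyclicShift {B W : Type*} [Group W] {M : CoxeterMatrix B} (cs : CoxeterSystem M W)
    {n : ℕ} (hn : 3 ≤ n) (s : Fin (n - 1) → B) (i : Equiv.Perm (Fin n)) (k : ℤ) :
    IsDSeq (simpleSeq cs s) n (permLabel i) ((-k : ℤ) : ZMod (n - 1 + n))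
      (cyclicShift (DSeq cs s i) k) := by
  intro j
  have : NeZero (n - 1 + n) := ⟨by omega⟩
  rw [cyclicShift, DSeq_apply cs hn]
  congr 1
  have e : ((j : ℕ) : ZMod (n - 1 + n)) - ((-k : ℤ) : ZMod (n - 1 + n)) =
      (((j : ℕ) + k : ℤ) : ZMod (n - 1 + n)) := by push_cast; ring
  rw [e, ← ZMod.val_intCast, Int.toNat_natCast]

/-! ### The number of subexpressions of a `D`-sequence with trivial target -/

/-- The permutations of the places `0, …, n - 1` given by the initial segments of a subexpression `e`
of the standard `D`-sequence: `token n e k x` is the token that is carried to the place `x` by the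
first `k` steps. -/
def token (n : ℕ) (e : ℕ → Bool) : ℕ → ℕ → ℕ
  | 0 => id
  | k + 1 => fun x => token n e k (if e k then Equiv.swap (dLeft n k) (dRight n k) x else x)

/-- The supports of the `2n - 1` subexpressions of the standard `D`-sequence with trivial target. -/
def stdSupport (n x k : ℕ) : Prop :=
  if x < n then k < x ∨ (n - 1 ≤ k ∧ k < n - 1 + x) else (x - n ≤ k ∧ k < n - 1) ∨ x ≤ k

section Token

variable {n : ℕ} {e : ℕ → Bool}

theorem token_succ_of_false {k : ℕ} (h : e k = false) (x : ℕ) :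
    token n e (k + 1) x = token n e k x := by simp [token, h]

theorem token_succ_star {k : ℕ} (hk : k < n - 1) (h : e k = true) (x : ℕ) :
    token n e (k + 1) x = token n e k (Equiv.swap 0 (k + 1) x) := by
  simp [token, h, dLeft, dRight, hk]

theorem token_succ_path {j : ℕ} (hj : j < n - 1) (h : e (n - 1 + j) = true) (x : ℕ) :
    token n e (n - 1 + j + 1) x = token n e (n - 1 + j) (Equiv.swap j (j + 1) x) := by
  have e1 : dLeft n (n - 1 + j) = j := by unfold dLeft; split_ifs <;> omega
  have e2 : dRight n (n - 1 + j) = j + 1 := by unfold dRight; split_ifs <;> omega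
  simp [token, h, e1, e2]

theorem token_succ_last (hn : 3 ≤ n) (h : e (n - 1 + (n - 1)) = true) (x : ℕ) :
    token n e (n - 1 + (n - 1) + 1) x =
      token n e (n - 1 + (n - 1)) (Equiv.swap (n - 1) 0 x) := by
  have e1 : dLeft n (n - 1 + (n - 1)) = n - 1 := by unfold dLeft; split_ifs <;> omega
  have e2 : dRight n (n - 1 + (n - 1)) = 0 := by unfold dRight; split_ifs <;> omega
  simp [token, h, e1, e2]

theorem token_star_of_gt {j : ℕ} (hj : j ≤ n - 1) {x : ℕ} (hx : j < x) : token n e j x = x := by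
  induction j with
  | zero => rfl
  | succ j ih =>
    rcases h : e j with _ | _
    · rw [token_succ_of_false h, ih (by omega) (by omega)]
    · rw [token_succ_star (by omega) h, Equiv.swap_apply_of_ne_of_ne (by omega) (by omega),
        ih (by omega) (by omega)]

theorem token_star_zero {j : ℕ} (hj : j < n - 1) :
    token n e (j + 1) 0 = if e j then j + 1 else token n e j 0 := by
  rcases h : e j with _ | _
  · simp [token_succ_of_false h]
  · rw [token_succ_star hj h, Equiv.swap_apply_left, token_star_of_gt hj.le (by omega)]
    simp

/-- The place `0` carries the last of the tokens that have been moved. -/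
theorem token_star_zero_spec {j : ℕ} (hj : j ≤ n - 1) :
    token n e j 0 ≤ j ∧ (1 ≤ token n e j 0 → e (token n e j 0 - 1) = true) ∧
      ∀ k, token n e j 0 ≤ k → k < j → e k = false := by
  induction j with
  | zero => simp [token]
  | succ j ih =>
    obtain ⟨h1, h2, h3⟩ := ih (by omega)
    rw [token_star_zero (by omega)]
    rcases h : e j with _ | _
    · simp only [Bool.false_eq_true, if_false]
      refine ⟨by omega, h2, fun k hk hk' => ?_⟩
      rcases (show k < j ∨ k = j by omega) with h' | rfl
      · exact h3 k hk h'
      · exact h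
    · simp only [if_true]
      exact ⟨le_rfl, fun _ => h, fun k hk hk' => by omega⟩

theorem token_star {x : ℕ} (hx : 1 ≤ x) (hx' : x ≤ n - 1) :
    token n e (n - 1) x = if e (x - 1) then token n e (x - 1) 0 else x := by
  have key : ∀ j, x ≤ j → j ≤ n - 1 →
      token n e j x = if e (x - 1) then token n e (x - 1) 0 else x := by
    intro j hxj hj
    induction j, hxj using Nat.le_induction with
    | base =>
      obtain ⟨y, rfl⟩ : ∃ y, x = y + 1 := ⟨x - 1, by omega⟩
      rw [Nat.add_sub_cancel]
      rcases h : e y with _ | _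
      · rw [token_succ_of_false h, token_star_of_gt (by omega) (by omega)]; simp
      · rw [token_succ_star (by omega) h, Equiv.swap_apply_right]; simp
    | succ j hxj ih =>
      rw [← ih (by omega)]
      rcases h : e j with _ | _
      · rw [token_succ_of_false h]
      · rw [token_succ_star (by omega) h, Equiv.swap_apply_of_ne_of_ne (by omega) (by omega)]
  exact key _ hx' le_rfl

theorem token_path_of_gt {j : ℕ} (hj : j ≤ n - 1) {x : ℕ} (hx : j < x) :
    token n e (n - 1 + j) x = token n e (n - 1) x := by
  induction j with
  | zero => rfl
  | succ j ih =>
    rcases h : e (n - 1 + j) with _ | _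
    · rw [← Nat.add_assoc, token_succ_of_false h, ih (by omega) (by omega)]
    · rw [← Nat.add_assoc, token_succ_path (by omega) h,
        Equiv.swap_apply_of_ne_of_ne (by omega) (by omega), ih (by omega) (by omega)]

theorem token_path_succ {j : ℕ} (hj : j < n - 1) :
    token n e (n - 1 + (j + 1)) (j + 1) =
      if e (n - 1 + j) then token n e (n - 1 + j) j else token n e (n - 1) (j + 1) := by
  rw [← Nat.add_assoc]
  rcases h : e (n - 1 + j) with _ | _
  · rw [token_succ_of_false h, token_path_of_gt hj.le (by omega)]; simp
  · rw [token_succ_path hj h, Equiv.swap_apply_right]; simp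

/-- After the step `x` of the path the place `x` is not moved any more before the last step. -/
theorem token_path_final {x : ℕ} (hx : x < n - 1) :
    token n e (n - 1 + (n - 1)) x =
      if e (n - 1 + x) then token n e (n - 1) (x + 1) else token n e (n - 1 + x) x := by
  have key : ∀ j, x + 1 ≤ j → j ≤ n - 1 → token n e (n - 1 + j) x =
      if e (n - 1 + x) then token n e (n - 1) (x + 1) else token n e (n - 1 + x) x := by
    intro j hxj hj
    induction j, hxj using Nat.le_induction with
    | base =>
      rw [← Nat.add_assoc]
      rcases h : e (n - 1 + x) with _ | _
      · rw [token_succ_of_false h]; simp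
      · rw [token_succ_path (by omega) h, Equiv.swap_apply_left,
          token_path_of_gt (by omega) (by omega)]; simp
    | succ j hxj ih =>
      rw [← ih (by omega), ← Nat.add_assoc]
      rcases h : e (n - 1 + j) with _ | _
      · rw [token_succ_of_false h]
      · rw [token_succ_path (by omega) h, Equiv.swap_apply_of_ne_of_ne (by omega) (by omega)]
  exact key _ (by omega) le_rfl

/-- If all tokens return to their places, then the subexpression is one of the standard ones. -/
theorem exists_stdSupport (hn : 3 ≤ n) (h : ∀ x < n, token n e (n - 1 + n) x = x) :
    ∃ x < n - 1 + n, ∀ k < n - 1 + n, e k = true ↔ stdSupport n x k := by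
  have hm : n - 1 + n = n - 1 + (n - 1) + 1 := by omega
  rw [hm] at h
  -- the token of an intermediate place `x` is settled by the step `n - 1 + x` of the path: it comes
  -- from the place `x + 1` if this step is taken, and is the one carried along the path otherwise
  have hmid : ∀ x, 1 ≤ x → x < n - 1 →
      (if e (n - 1 + x) then token n e (n - 1) (x + 1) else token n e (n - 1 + x) x) = x := by
    intro x hx hx'
    rw [← token_path_final hx']
    have := h x (by omega)
    rcases hl : e (n - 1 + (n - 1)) with _ | _
    · rwa [token_succ_of_false hl] at this
    · rwa [token_succ_last hn hl, Equiv.swap_apply_of_ne_of_ne (by omega) (by omega)] at this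
  have hT : ∀ j, j < n - 1 → token n e (n - 1) (j + 1) = j → e j = true := by
    intro j hj he
    by_contra hne
    rw [token_star (by omega) (by omega), Nat.add_sub_cancel, if_neg hne] at he
    omega
  have hT' : ∀ j, j < n - 1 → e j = false → token n e (n - 1) (j + 1) = j + 1 := by
    intro j hj he
    rw [token_star (by omega) (by omega), Nat.add_sub_cancel, he]
    simp
  -- the two cases are whether the last step, which is the transposition of `n - 1` and `0`, is omitted
  -- or taken
  obtain ⟨hL1, hL2, hL3⟩ := token_star_zero_spec (e := e) (le_refl (n - 1))
  rcases hl : e (n - 1 + (n - 1)) with _ | _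
  · have h0 := h 0 (by omega)
    rw [token_succ_of_false hl, token_path_final (by omega)] at h0
    simp only [Nat.zero_add, Nat.add_zero] at h0
    -- the token carried along the path is the last one that was moved along the star
    generalize hx : token n e (n - 1) 0 = x at h0 hL1 hL2 hL3
    -- when this token has arrived at its place `x`, no further step of the path is taken
    have hphase2 : token n e (n - 1 + x) x = x → (x = 0 → e (n - 1) = false) →
        ∀ j, x ≤ j → j ≤ n - 1 → token n e (n - 1 + j) j = j ∧
          ∀ k, x ≤ k → k < j → e (n - 1 + k) = false := by
      intro hc hz j hxj hj
      induction j, hxj using Nat.le_induction with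
      | base => exact ⟨hc, fun k hk hk' => by omega⟩
      | succ j hxj ih =>
        obtain ⟨ih1, ih2⟩ := ih (by omega)
        have hd : e (n - 1 + j) = false := by
          rcases Nat.eq_zero_or_pos j with rfl | hj0
          · exact hz (by omega)
          · by_contra hne
            rw [Bool.not_eq_false] at hne
            have := hmid j hj0 (by omega)
            rw [hne, if_pos rfl, hT' j (by omega) (hL3 j hxj (by omega))] at this
            omega
        refine ⟨?_, fun k hk hk' => ?_⟩
        · rw [token_path_succ (by omega), hd, hT' j (by omega) (hL3 j hxj (by omega))]
          simp
        · rcases (show k < j ∨ k = j by omega) with h' | rfl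
          · exact ih2 k hk h'
          · exact hd
    -- before its arrival all steps are taken
    have hphase1 : ∀ j, j ≤ x → (e (n - 1) = true ∨ x = 0) → token n e (n - 1 + j) j = x ∧
        ∀ k, k < j → e k = true ∧ e (n - 1 + k) = true := by
      intro j hj hz
      induction j with
      | zero => exact ⟨hx, fun k hk => by omega⟩
      | succ j ih =>
        obtain ⟨ih1, ih2⟩ := ih (by omega)
        have hd : e (n - 1 + j) = true ∧ token n e (n - 1) (j + 1) = j := by
          rcases Nat.eq_zero_or_pos j with rfl | hj0
          · have hz' := hz.resolve_right (by omega)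
            rw [hz', if_pos rfl] at h0
            exact ⟨hz', h0⟩
          · have := hmid j hj0 (by omega)
            rw [ih1] at this
            rcases hd : e (n - 1 + j) with _ | _
            · rw [hd] at this; simp at this; omega
            · rw [hd, if_pos rfl] at this; exact ⟨rfl, this⟩
        refine ⟨?_, fun k hk => ?_⟩
        · rw [token_path_succ (by omega), hd.1, if_pos rfl, ih1]
        · rcases (show k < j ∨ k = j by omega) with h' | rfl
          · exact ih2 k h'
          · exact ⟨hT _ (by omega) hd.2, hd.1⟩
    have hz : (e (n - 1) = true ∨ x = 0) ∧ (x = 0 → e (n - 1) = false) := by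
      rcases hd : e (n - 1) with _ | _
      · rw [hd] at h0
        exact ⟨Or.inr h0, fun _ => rfl⟩
      · rw [hd, if_pos rfl] at h0
        refine ⟨Or.inl rfl, fun hx0 => ?_⟩
        have e1 := hT 0 (by omega) h0
        rw [hL3 0 (by omega) (by omega)] at e1
        exact e1.symm
    obtain ⟨p1, p2⟩ := hphase1 x le_rfl hz.1
    obtain ⟨-, p3⟩ := hphase2 p1 hz.2 (n - 1) hL1 le_rfl
    refine ⟨x, by omega, fun k hk => ?_⟩
    rw [stdSupport, if_pos (by omega)]
    rcases Nat.lt_or_ge k (n - 1) with hk1 | hk1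
    · rcases Nat.lt_or_ge k x with hk2 | hk2
      · simp [(p2 k hk2).1, hk2]
      · simp [hL3 k hk2 hk1]; omega
    · obtain ⟨y, rfl⟩ : ∃ y, k = n - 1 + y := ⟨k - (n - 1), by omega⟩
      rcases Nat.lt_or_ge y x with hk2 | hk2
      · simp [(p2 y hk2).2, hk2]
      · have : e (n - 1 + y) = false := by
          rcases (show y < n - 1 ∨ y = n - 1 by omega) with h' | rfl
          · exact p3 y hk2 h'
          · exact hl
        simp [this]; omega
  · have h0 := h (n - 1) (by omega)
    rw [token_succ_last hn hl, Equiv.swap_apply_left, token_path_final (by omega)] at h0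
    simp only [Nat.zero_add, Nat.add_zero] at h0
    -- the token `n - 1` can be returned by the last step only from the place `0`
    have hd0 : e (n - 1) = false := by
      by_contra hne
      rw [Bool.not_eq_false] at hne
      rw [hne, if_pos rfl, token_star le_rfl (by omega), Nat.sub_self] at h0
      simp only [token, id] at h0
      split_ifs at h0 <;> omega
    rw [hd0] at h0
    simp only [Bool.false_eq_true, if_false] at h0
    have hex : ∃ f, e f = true := ⟨_, hL2 (by omega)⟩
    classical
    -- the first token moved along the star
    obtain ⟨f, hf, hfmin, hfn⟩ : ∃ f, e f = true ∧ (∀ k < f, e k = false) ∧ f < n - 1 := by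
      refine ⟨Nat.find hex, Nat.find_spec hex, fun k hk => ?_, ?_⟩
      · simpa using Nat.find_min hex hk
      · have := Nat.find_min' hex (hL2 (by omega))
        omega
    have hLf : ∀ j ≤ f, token n e j 0 = 0 := by
      intro j hj
      induction j with
      | zero => rfl
      | succ j ih =>
        rw [token_star_zero (by omega), hfmin j (by omega), ih (by omega)]
        simp
    -- the tokens before `f` have not been moved along the star and are not moved along the path
    have hphase1 : ∀ j, 1 ≤ j → j ≤ f → token n e (n - 1 + j) j = j ∧
        ∀ k < j, e (n - 1 + k) = false := by
      intro j hj hjf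
      induction j, hj using Nat.le_induction with
      | base =>
        have := token_path_succ (e := e) (n := n) (j := 0) (by omega)
        simp only [Nat.zero_add, Nat.add_zero, hd0, Bool.false_eq_true, if_false] at this
        rw [this, ← Nat.zero_add 1, hT' 0 (by omega) (hfmin 0 (by omega))]
        refine ⟨rfl, fun k hk => ?_⟩
        obtain rfl : k = 0 := by omega
        exact hd0
      | succ j hj ih =>
        obtain ⟨ih1, ih2⟩ := ih (by omega)
        have hd : e (n - 1 + j) = false := by
          by_contra hne
          rw [Bool.not_eq_false] at hne
          have := hmid j hj (by omega)
          rw [hne, if_pos rfl, hT' j (by omega) (hfmin j (by omega))] at this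
          omega
        refine ⟨?_, fun k hk => ?_⟩
        · rw [token_path_succ (by omega), hd, hT' j (by omega) (hfmin j (by omega))]
          simp
        · rcases (show k < j ∨ k = j by omega) with h' | rfl
          · exact ih2 k h'
          · exact hd
    have hdf : ∀ k ≤ f, e (n - 1 + k) = false := by
      intro k hk
      rcases Nat.eq_zero_or_pos k with rfl | hk0
      · exact hd0
      rcases (show k < f ∨ k = f by omega) with h' | rfl
      · exact (hphase1 f (by omega) le_rfl).2 k h'
      · by_contra hne
        rw [Bool.not_eq_false] at hne
        have := hmid k hk0 hfn
        rw [hne, if_pos rfl, token_star (by omega) (by omega), Nat.add_sub_cancel, hf, if_pos rfl,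
          hLf k le_rfl] at this
        omega
    -- from the place `f + 1` on, the token `0` is carried along the path and all steps are taken
    have hphase2 : ∀ j, f + 1 ≤ j → j ≤ n - 1 → token n e (n - 1 + j) j = 0 ∧
        ∀ k, f < k → k < j → e k = true ∧ e (n - 1 + k) = true := by
      intro j hj hjn
      induction j, hj using Nat.le_induction with
      | base =>
        refine ⟨?_, fun k hk hk' => by omega⟩
        rw [token_path_succ hfn, hdf f le_rfl, token_star (by omega) (by omega), Nat.add_sub_cancel,
          hf, hLf f le_rfl]
        simp
      | succ j hj ih =>
        obtain ⟨ih1, ih2⟩ := ih (by omega)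
        have := hmid j (by omega) (by omega)
        rw [ih1] at this
        have hd : e (n - 1 + j) = true := by
          by_contra hne
          rw [if_neg hne] at this
          omega
        rw [hd, if_pos rfl] at this
        refine ⟨?_, fun k hk hk' => ?_⟩
        · rw [token_path_succ (by omega), hd, if_pos rfl, ih1]
        · rcases (show k < j ∨ k = j by omega) with h' | rfl
          · exact ih2 k hk h'
          · exact ⟨hT _ (by omega) this, hd⟩
    obtain ⟨-, p2⟩ := hphase2 (n - 1) (by omega) le_rfl
    refine ⟨n + f, by omega, fun k hk => ?_⟩
    rw [stdSupport, if_neg (by omega)]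
    rcases Nat.lt_or_ge k (n - 1) with hk1 | hk1
    · rcases lt_trichotomy k f with hk2 | rfl | hk2
      · simp [hfmin k hk2]; omega
      · simp [hf]; omega
      · simp [(p2 k hk2 hk1).1]; omega
    · obtain ⟨y, rfl⟩ : ∃ y, k = n - 1 + y := ⟨k - (n - 1), by omega⟩
      rcases Nat.lt_or_ge f y with hk2 | hk2
      · have : e (n - 1 + y) = true := by
          rcases (show y < n - 1 ∨ y = n - 1 by omega) with h' | rfl
          · exact (p2 y hk2 h').2
          · exact hl
        simp [this]; omega
      · simp [hdf y hk2]; omega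

end Token

section Bound

variable {B W : Type*} [Group W] {M : CoxeterMatrix B} (cs : CoxeterSystem M W) {n : ℕ}
  {s : Fin (n - 1) → B} (hs : ∀ a b, M (s a) (s b) = CoxeterMatrix.A (n - 1) a b)
include hs

/-- A subexpression with trivial target fixes the roots of the parabolic subgroup and hence returns all
tokens to their places, so that it is one of the `2n - 1` standard ones. -/
theorem card_subTo_le (hn : 3 ≤ n) {u : ℕ → ℕ} (hu : IsLabelling n u)
    {r : Fin (n - 1 + n) → W} (hr : IsDSeq (simpleSeq cs s) n u 0 r) :
    (subTo r 1).card ≤ n - 1 + n := by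
  classical
  have : NeZero (n - 1 + n) := ⟨by omega⟩
  have hr' : ∀ i : Fin (n - 1 + n), r i = dEntry (simpleSeq cs s) n u i := fun i => by
    rw [hr i, sub_zero, ZMod.val_natCast_of_lt i.isLt]
  have key : ∀ δ ∈ subTo r 1, ∃ x < n - 1 + n, ∀ i : Fin (n - 1 + n),
      δ i = true ↔ stdSupport n x i := by
    intro δ hδ
    rw [mem_subTo_one] at hδ
    -- the first `k` factors act on the differences of the coordinate vectors as the tokens are moved
    have hact : ∀ k ≤ n - 1 + n,
        (∀ a < n, token n (fun j => if h : j < n - 1 + n then δ ⟨j, h⟩ else false) k a < n) ∧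
        ∀ a < n, ∀ b < n, geomRep cs (partialProd r δ k)
            (vertexVec s (u a) - vertexVec s (u b)) =
          vertexVec s (u (token n (fun j => if h : j < n - 1 + n then δ ⟨j, h⟩ else false) k a)) -
          vertexVec s (u (token n (fun j => if h : j < n - 1 + n then δ ⟨j, h⟩ else false) k b)) := by
      intro k hk
      induction k with
      | zero =>
        refine ⟨fun a ha => ha, fun a ha b hb => ?_⟩
        rw [partialProd_zero, map_one]; rfl
      | succ k ih =>
        obtain ⟨ih1, ih2⟩ := ih (by omega)
        have e1 := partialProd_succ r δ ⟨k, hk⟩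
        simp only at e1
        rcases hd : δ ⟨k, hk⟩ with _ | _
        · have e2 : (fun j => if h : j < n - 1 + n then δ ⟨j, h⟩ else false) k = false := by
            simp only [show k < n - 1 + n from hk, dif_pos, hd]
          rw [e1, hd]
          simp only [Bool.false_eq_true, if_false, mul_one]
          exact ⟨fun a ha => by rw [token_succ_of_false e2]; exact ih1 a ha, fun a ha b hb => by
            rw [token_succ_of_false e2, token_succ_of_false e2]; exact ih2 a ha b hb⟩
        · have hl := dLeft_lt (v := k) hn hk
          have hrr := dRight_lt (v := k) hn hk
          have e2 : ∀ x, token n (fun j => if h : j < n - 1 + n then δ ⟨j, h⟩ else false) (k + 1) x =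
              token n (fun j => if h : j < n - 1 + n then δ ⟨j, h⟩ else false) k
                (Equiv.swap (dLeft n k) (dRight n k) x) := by
            intro x
            simp [token, show k < n - 1 + n from hk, hd]
          have hsw : ∀ a < n, Equiv.swap (dLeft n k) (dRight n k) a < n := by
            intro a ha
            rw [Equiv.swap_apply_def]; split_ifs <;> assumption
          have hsu : ∀ a < n, Equiv.swap (u (dLeft n k)) (u (dRight n k)) (u a) =
              u (Equiv.swap (dLeft n k) (dRight n k) a) := by
            intro a ha
            by_cases h1 : a = dLeft n k
            · rw [h1, Equiv.swap_apply_left, Equiv.swap_apply_left]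
            by_cases h2 : a = dRight n k
            · rw [h2, Equiv.swap_apply_right, Equiv.swap_apply_right]
            rw [Equiv.swap_apply_of_ne_of_ne h1 h2, Equiv.swap_apply_of_ne_of_ne
              (fun e => h1 (hu.injOn _ ha _ hl e)) (fun e => h2 (hu.injOn _ ha _ hrr e))]
          have hA := actsAs_trans cs hs (dEntry_ne hn hu hk) (hu.lt _ hl) (hu.lt _ hrr)
          refine ⟨fun a ha => by rw [e2]; exact ih1 _ (hsw a ha), fun a ha b hb => ?_⟩
          rw [e1, hd, if_pos rfl, map_mul, Module.End.mul_apply, hr', dEntry,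
            hA.2 _ (hu.lt a ha) _ (hu.lt b hb), hsu a ha, hsu b hb,
            ih2 _ (hsw a ha) _ (hsw b hb), e2, e2]
    obtain ⟨h1, h2⟩ := hact _ le_rfl
    have hfix : ∀ a < n,
        token n (fun j => if h : j < n - 1 + n then δ ⟨j, h⟩ else false) (n - 1 + n) a = a := by
      intro a ha
      obtain ⟨b, hb, hab⟩ : ∃ b, b < n ∧ a ≠ b := by
        by_cases h0 : a = 0
        · exact ⟨1, by omega, by omega⟩
        · exact ⟨0, by omega, h0⟩
      have e := h2 a ha b hb
      rw [hδ, map_one, Module.End.one_apply] at e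
      exact (hu.injOn _ ha _ (h1 a ha) (vertexVec_sub_inj hs (hu.lt a ha) (hu.lt b hb)
        (hu.lt _ (h1 a ha)) (hu.lt _ (h1 b hb)) (fun e => hab (hu.injOn _ ha _ hb e)) e).1).symm
    obtain ⟨x, hx, hx'⟩ := exists_stdSupport hn hfix
    refine ⟨x, hx, fun i => ?_⟩
    rw [← hx' i i.isLt]
    simp
  have hsub : subTo r 1 ⊆ (Finset.range (n - 1 + n)).image
      (fun x (i : Fin (n - 1 + n)) => decide (stdSupport n x i)) := by
    intro δ hδ
    obtain ⟨x, hx, hx'⟩ := key δ hδ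
    rw [Finset.mem_image]
    refine ⟨x, Finset.mem_range.mpr hx, funext fun i => ?_⟩
    rw [Bool.eq_iff_iff, decide_eq_true_iff, hx' i]
  exact (Finset.card_le_card hsub).trans (Finset.card_image_le.trans (by simp))

end Bound

/-! ### Subexpressions with trivial target form a cycle -/

section Chords

variable {n : ℕ}

theorem mem_chordPos_iff (a : ZMod (n - 1 + n)) (i : Fin (n - 1 + n)) :
    i ∈ chordPos n a ↔ ((i : ℕ) : ZMod (n - 1 + n)) + 1 = a ∨
      ((i : ℕ) : ZMod (n - 1 + n)) + 1 = (n : ZMod (n - 1 + n)) - 1 + a := by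
  simp [chordPos, chord]

theorem card_chordPos (hn : 3 ≤ n) (a : ZMod (n - 1 + n)) : (chordPos n a).card = 2 := by
  obtain ⟨lo, hi, hlt, h, -⟩ := exists_chordPos_succ hn (a - 1)
  rw [sub_add_cancel] at h
  rw [h, Finset.card_pair hlt.ne]

theorem exists_fin_add_one_eq (hn : 3 ≤ n) (z : ZMod (n - 1 + n)) :
    ∃ i : Fin (n - 1 + n), ((i : ℕ) : ZMod (n - 1 + n)) + 1 = z := by
  have : NeZero (n - 1 + n) := ⟨by omega⟩
  exact ⟨⟨(z - 1).val, ZMod.val_lt _⟩, by simp⟩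

/-- A natural number between `1` and `2n - 2` is not `0` modulo `2n - 1`. -/
theorem natCast_ne_zero {v : ℕ} (h0 : 0 < v) (hv : v < n - 1 + n) :
    (v : ZMod (n - 1 + n)) ≠ 0 := by
  rw [Ne, ZMod.natCast_eq_zero_iff]
  exact fun h => absurd (Nat.le_of_dvd h0 h) (by omega)

theorem chord_injective (hn : 3 ≤ n) : Function.Injective (chord (m := n - 1 + n) n) := by
  intro a b h
  have ha : a ∈ chord n b := by rw [← h]; exact Set.mem_insert _ _
  have hb : b ∈ chord n a := by rw [h]; exact Set.mem_insert _ _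
  rcases ha with ha | ha
  · exact ha
  · rcases hb with hb | hb
    · exact hb.symm
    · exfalso
      have h2 := two_mul_natCast_pred hn
      simp only [Set.mem_singleton_iff] at ha hb
      refine natCast_ne_zero (n := n) one_pos (by omega) ?_
      rw [Nat.cast_one]
      linear_combination h2 + ha + hb

theorem chordPos_injective (hn : 3 ≤ n) : Function.Injective (chordPos n) := by
  intro a b h
  apply chord_injective hn
  ext z
  obtain ⟨i, rfl⟩ := exists_fin_add_one_eq hn z
  have := Finset.ext_iff.mp h i
  simpa [chordPos] using this

theorem eq_of_mem_pair (hn : 3 ≤ n) {a b : ZMod (n - 1 + n)} (h1 : a = b ∨ a = b + 1)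
    (h2 : a + 1 = b ∨ a + 1 = b + 1) : a = b := by
  rcases h1 with h1 | h1
  · exact h1
  · rcases h2 with h2 | h2
    · exfalso
      refine natCast_ne_zero (n := n) (v := 2) two_pos (by omega) ?_
      push_cast
      linear_combination h2 - h1
    · exact add_right_cancel h2

end Chords

/-- The subexpressions of `t` with trivial target form a cycle `ε`: consecutive ones differ exactly at
the positions of a chord, and the reflections of `ε a` at the different positions are distinct, except
for the reflection `ρ a` at the chord with number `a` and the reflection `ρ (a + 1)` at the chord
with number `a + 1`. -/
structure IsSubCycle {W : Type*} [Group W] {n : ℕ} (t : Fin (n - 1 + n) → W)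
    (ε : ZMod (n - 1 + n) → Fin (n - 1 + n) → Bool) (ρ : ZMod (n - 1 + n) → W) : Prop where
  three_le : 3 ≤ n
  mem_iff : ∀ δ, δ ∈ subTo t 1 ↔ ∃ a, ε a = δ
  succ : ∀ a, ε (a + 1) = fold (chordPos n (a + 1)) (ε a)
  posOf_left : ∀ a, posOf t (ε a) (ρ a) = chordPos n a
  posOf_right : ∀ a, posOf t (ε a) (ρ (a + 1)) = chordPos n (a + 1)
  posOf_other : ∀ a p, p ≠ ρ a → p ≠ ρ (a + 1) → (posOf t (ε a) p).card ≤ 1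
  fold_singleton : ∀ δ ∈ subTo t 1, ∀ i, fold {i} δ ∉ subTo t 1

section Injective

variable {W : Type*} [Group W] {n : ℕ} {t : Fin (n - 1 + n) → W}
  {ε : ZMod (n - 1 + n) → Fin (n - 1 + n) → Bool} {ρ : ZMod (n - 1 + n) → W}

theorem eq_or_eq_of_posOf (hn : 3 ≤ n) (h1 : ∀ a, posOf t (ε a) (ρ a) = chordPos n a)
    (h2 : ∀ a, posOf t (ε a) (ρ (a + 1)) = chordPos n (a + 1))
    (h3 : ∀ a p, p ≠ ρ a → p ≠ ρ (a + 1) → (posOf t (ε a) p).card ≤ 1)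
    {a b : ZMod (n - 1 + n)} {p : W} (h : posOf t (ε b) p = chordPos n a) :
    (a = b ∧ p = ρ b) ∨ (a = b + 1 ∧ p = ρ (b + 1)) := by
  by_cases e1 : p = ρ b
  · exact Or.inl ⟨chordPos_injective hn (by rw [← h, e1, h1]), e1⟩
  by_cases e2 : p = ρ (b + 1)
  · exact Or.inr ⟨chordPos_injective hn (by rw [← h, e2, h2]), e2⟩
  have := h3 b p e1 e2
  rw [h, card_chordPos hn] at this
  omega

theorem injective_of_posOf (hn : 3 ≤ n) (h1 : ∀ a, posOf t (ε a) (ρ a) = chordPos n a)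
    (h2 : ∀ a, posOf t (ε a) (ρ (a + 1)) = chordPos n (a + 1))
    (h3 : ∀ a p, p ≠ ρ a → p ≠ ρ (a + 1) → (posOf t (ε a) p).card ≤ 1) :
    Function.Injective ε := by
  intro a b h
  have e1 := h1 a
  have e2 := h2 a
  rw [h] at e1 e2
  exact eq_of_mem_pair hn ((eq_or_eq_of_posOf hn h1 h2 h3 e1).imp And.left And.left)
    ((eq_or_eq_of_posOf hn h1 h2 h3 e2).imp And.left And.left)

namespace IsSubCycle

variable (h : IsSubCycle t ε ρ)
include h

theorem injective : Function.Injective ε :=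
  injective_of_posOf h.three_le h.posOf_left h.posOf_right h.posOf_other

theorem mem (a : ZMod (n - 1 + n)) : ε a ∈ subTo t 1 := (h.mem_iff _).mpr ⟨a, rfl⟩

theorem card_subTo : (subTo t 1).card = n - 1 + n := by
  classical
  have hn := h.three_le
  have : NeZero (n - 1 + n) := ⟨by omega⟩
  have e : subTo t 1 = Finset.univ.image ε := by
    ext δ
    simp [h.mem_iff]
  rw [e, Finset.card_image_of_injective _ h.injective, Finset.card_univ, ZMod.card]

theorem ne_succ (a : ZMod (n - 1 + n)) : ρ a ≠ ρ (a + 1) := by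
  intro e
  have h1 := h.posOf_left a
  rw [e, h.posOf_right a] at h1
  have h2 := chordPos_injective h.three_le h1
  have hn := h.three_le
  exact natCast_ne_zero (n := n) one_pos (by omega) (by rw [Nat.cast_one]; linear_combination h2)

theorem pred (a : ZMod (n - 1 + n)) : ε (a - 1) = fold (chordPos n a) (ε a) := by
  have e := h.succ (a - 1)
  rw [sub_add_cancel] at e
  rw [e, fold_fold]

/-- The reflection attached to a chord is well-defined and is the one of the cycle. -/
theorem isChordReflection_iff (a : ZMod (n - 1 + n)) (p : W) :
    IsChordReflection n t a p ↔ p = ρ a := by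
  classical
  have hn := h.three_le
  have hres : ∀ (δ : Fin (n - 1 + n) → Bool) (q : W) (b : ZMod (n - 1 + n)),
      resPosOf t δ q = chord n b ↔ posOf t δ q = chordPos n b := by
    have hcast : ∀ i j : Fin (n - 1 + n),
        ((i : ℕ) : ZMod (n - 1 + n)) + 1 = ((j : ℕ) : ZMod (n - 1 + n)) + 1 → i = j := by
      intro i j e
      have e' := congrArg ZMod.val (add_right_cancel e)
      rw [ZMod.val_natCast_of_lt i.isLt, ZMod.val_natCast_of_lt j.isLt] at e'
      exact Fin.ext e'
    intro δ q b
    constructor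
    · intro e
      ext i
      rw [chordPos, Finset.mem_filter, ← e]
      simp only [Finset.mem_univ, true_and, resPosOf, Set.mem_ofPred_eq]
      constructor
      · exact fun hi => ⟨i, hi, rfl⟩
      · rintro ⟨j, hj, e⟩
        rwa [hcast i j e]
    · intro e
      ext z
      obtain ⟨i, rfl⟩ := exists_fin_add_one_eq hn z
      simp only [resPosOf, Set.mem_ofPred_eq, e]
      constructor
      · rintro ⟨j, hj, e'⟩
        rw [hcast i j e']
        simpa [chordPos] using hj
      · intro hi
        exact ⟨i, by simpa [chordPos] using hi, rfl⟩
  constructor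
  · rintro ⟨δ, hδ, q, -, h1, h2⟩
    obtain ⟨b, rfl⟩ := (h.mem_iff δ).mp hδ
    rw [hres] at h1 h2
    have e1 := eq_or_eq_of_posOf hn h.posOf_left h.posOf_right h.posOf_other h1
    have e2 := eq_or_eq_of_posOf hn h.posOf_left h.posOf_right h.posOf_other h2
    have e := eq_of_mem_pair hn (e1.imp And.left And.left)
      (e2.imp (fun x => (add_comm a 1).trans x.1) (fun x => (add_comm a 1).trans x.1))
    rcases e1 with ⟨-, e1⟩ | ⟨e1, -⟩
    · rw [e1, e]
    · exfalso
      refine natCast_ne_zero (n := n) one_pos (by omega) ?_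
      rw [Nat.cast_one]; linear_combination e - e1
  · rintro rfl
    refine ⟨ε a, h.mem a, ρ (a + 1), (h.ne_succ a).symm, ?_, ?_⟩
    · rw [hres, h.posOf_left]
    · rw [hres, h.posOf_right, add_comm a 1]

end IsSubCycle

end Injective

/-- The subexpression obtained from the trivial one by flipping in turn the positions of the chords
`K + 1, …, a`: the position `i` belongs to the chords `i + 1` and `i + 1 - (n - 1)`. -/
def cycleSub (n : ℕ) (K a : ZMod (n - 1 + n)) : Fin (n - 1 + n) → Bool := fun i =>
  xor (decide ((((i : ℕ) : ZMod (n - 1 + n)) - K).val < (a - K).val))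
    (decide ((((i : ℕ) : ZMod (n - 1 + n)) - K - ((n - 1 : ℕ) : ZMod (n - 1 + n))).val < (a - K).val))

section CycleSub

variable {n : ℕ}

theorem cycleSub_self (K : ZMod (n - 1 + n)) : cycleSub n K K = fun _ => false := by
  funext i
  simp [cycleSub]

theorem cycleSub_succ (hn : 3 ≤ n) (K a : ZMod (n - 1 + n)) :
    cycleSub n K (a + 1) = fold (chordPos n (a + 1)) (cycleSub n K a) := by
  have : NeZero (n - 1 + n) := ⟨by omega⟩
  symm
  have key : ∀ i : Fin (n - 1 + n), i ∈ chordPos n (a + 1) ↔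
      (((i : ℕ) : ZMod (n - 1 + n)) - K).val = (a - K).val ∨
      (((i : ℕ) : ZMod (n - 1 + n)) - K - ((n - 1 : ℕ) : ZMod (n - 1 + n))).val = (a - K).val := by
    intro i
    rw [mem_chordPos_succ hn, val_eq_iff hn _ (by omega), val_eq_iff hn _ (by omega),
      (ZMod.val_injective _).eq_iff, (ZMod.val_injective _).eq_iff]
    constructor
    · rintro (h | h)
      · exact Or.inl (by rw [Nat.cast_zero] at h; linear_combination h)
      · exact Or.inr (by linear_combination h)
    · rintro (h | h)
      · exact Or.inl (by rw [Nat.cast_zero]; linear_combination h)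
      · exact Or.inr (by linear_combination h)
  have hne : ∀ i : Fin (n - 1 + n), (((i : ℕ) : ZMod (n - 1 + n)) - K).val ≠
      (((i : ℕ) : ZMod (n - 1 + n)) - K - ((n - 1 : ℕ) : ZMod (n - 1 + n))).val := by
    intro i e
    have e' := ZMod.val_injective _ e
    exact natCast_ne_zero (n := n) (v := n - 1) (by omega) (by omega) (by linear_combination e')
  have hsucc := val_sub_one hn (a + 1 - K)
  rw [show a + 1 - K - 1 = a - K by ring] at hsucc
  funext i
  have h1 := key i
  have h2 := hne i
  have l1 := ZMod.val_lt (((i : ℕ) : ZMod (n - 1 + n)) - K)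
  have l2 := ZMod.val_lt (((i : ℕ) : ZMod (n - 1 + n)) - K -
    ((n - 1 : ℕ) : ZMod (n - 1 + n)))
  have l3 := ZMod.val_lt (a + 1 - K)
  simp only [fold, cycleSub, h1]
  generalize (((i : ℕ) : ZMod (n - 1 + n)) - K).val = x at *
  generalize (((i : ℕ) : ZMod (n - 1 + n)) - K - ((n - 1 : ℕ) : ZMod (n - 1 + n))).val = y at *
  generalize (a - K).val = w at *
  generalize (a + 1 - K).val = w' at *
  by_cases c1 : x < w <;> by_cases c2 : y < w <;> by_cases c3 : x < w' <;>
    by_cases c4 : y < w' <;> by_cases c5 : x = w <;> by_cases c6 : y = w <;>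
    first
    | (exfalso; split_ifs at hsucc <;> omega)
    | (simp [c1, c2, c3, c4, c5, c6]; done)
    | (simp [c1, c2, c3, c4, c5, c6]; omega)

end CycleSub

section Existence

variable {B W : Type*} [Group W] {M : CoxeterMatrix B} (cs : CoxeterSystem M W) {n : ℕ}
  {s : Fin (n - 1) → B} (hs : ∀ a b, M (s a) (s b) = CoxeterMatrix.A (n - 1) a b)
include hs

/-- The only repetitions in a `D`-sequence are those of `(u 0 u 1)` and of `(u 0 u (n - 1))`. -/
theorem dEntry_eq_imp (hn : 3 ≤ n) {u : ℕ → ℕ} (hu : IsLabelling n u) {v w : ℕ}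
    (hv : v < n - 1 + n) (hw : w < n - 1 + n)
    (h : dEntry (simpleSeq cs s) n u v = dEntry (simpleSeq cs s) n u w) :
    v = w ∨ ((v = 0 ∨ v = n - 1) ∧ (w = 0 ∨ w = n - 1)) ∨
      ((v = n - 2 ∨ v = n - 1 + n - 1) ∧ (w = n - 2 ∨ w = n - 1 + n - 1)) := by
  have l1 := dLeft_lt hn hv
  have l2 := dRight_lt hn hv
  have l3 := dLeft_lt hn hw
  have l4 := dRight_lt hn hw
  have h' := trans_inj cs hs (by omega) (dEntry_ne hn hu hv) (hu.lt _ l1) (hu.lt _ l2)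
    (dEntry_ne hn hu hw) (hu.lt _ l3) (hu.lt _ l4) h
  have h'' : (dLeft n v = dLeft n w ∧ dRight n v = dRight n w) ∨
      (dLeft n v = dRight n w ∧ dRight n v = dLeft n w) :=
    h'.imp (fun e => ⟨hu.injOn _ l1 _ l3 e.1, hu.injOn _ l2 _ l4 e.2⟩)
      (fun e => ⟨hu.injOn _ l1 _ l4 e.1, hu.injOn _ l2 _ l3 e.2⟩)
  have hcases : ∀ x < n - 1 + n, (x < n - 1 ∧ dLeft n x = 0 ∧ dRight n x = x + 1) ∨
      (x = n - 1 + n - 1 ∧ dLeft n x = n - 1 ∧ dRight n x = 0) ∨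
      (n - 1 ≤ x ∧ x < n - 1 + n - 1 ∧ dLeft n x = x - (n - 1) ∧ dRight n x = x - (n - 1) + 1) := by
    intro x hx
    unfold dLeft dRight
    split_ifs <;> omega
  have hcv := hcases v hv
  have hcw := hcases w hw
  omega

theorem IsDSeq.mem_chordPos_of_eq (hn : 3 ≤ n) {u : ℕ → ℕ} (hu : IsLabelling n u) {a : ZMod (n - 1 + n)}
    {r : Fin (n - 1 + n) → W} (hr : IsDSeq (simpleSeq cs s) n u a r) {i j : Fin (n - 1 + n)}
    (h : r i = r j) :
    i = j ∨ (i ∈ chordPos n a ∧ j ∈ chordPos n a) ∨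
      (i ∈ chordPos n (a + 1) ∧ j ∈ chordPos n (a + 1)) := by
  have : NeZero (n - 1 + n) := ⟨by omega⟩
  rw [hr i, hr j] at h
  rw [mem_chordPos hn, mem_chordPos hn, mem_chordPos_succ hn, mem_chordPos_succ hn]
  rcases dEntry_eq_imp cs hs hn hu (ZMod.val_lt _) (ZMod.val_lt _) h with h | h | h
  · left
    have e := sub_left_injective (ZMod.val_injective _ h)
    have e' := congrArg ZMod.val e
    rw [ZMod.val_natCast_of_lt i.isLt, ZMod.val_natCast_of_lt j.isLt] at e'
    exact Fin.ext e'
  · exact Or.inr (Or.inr h)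
  · exact Or.inr (Or.inl h)

omit hs in
theorem IsDSeq.eq_of_mem_chordPos (hn : 3 ≤ n) {σ : ℕ → W} {u : ℕ → ℕ}
    {a : ZMod (n - 1 + n)} {r : Fin (n - 1 + n) → W} (hr : IsDSeq σ n u a r)
    {i j : Fin (n - 1 + n)} (hi : i ∈ chordPos n a) (hj : j ∈ chordPos n a) : r i = r j := by
  have e : ∀ i ∈ chordPos n a, r i = trans σ (u (n - 1)) (u 0) := by
    intro i hi
    have e1 : dLeft n (n - 1 + n - 1) = n - 1 := by unfold dLeft; split_ifs <;> omega
    have e2 : dRight n (n - 1 + n - 1) = 0 := by unfold dRight; split_ifs <;> omega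
    have e3 : dLeft n (n - 2) = 0 := by unfold dLeft; split_ifs <;> omega
    have e4 : dRight n (n - 2) = n - 1 := by unfold dRight; split_ifs <;> omega
    rw [hr i]
    rcases (mem_chordPos hn a i).mp hi with h | h
    · rw [h, dEntry, e3, e4, trans_comm]
    · rw [h, dEntry, e1, e2]
  rw [e i hi, e j hj]

omit hs in
theorem disjoint_chordPos (hn : 3 ≤ n) (a : ZMod (n - 1 + n)) {i : Fin (n - 1 + n)}
    (h1 : i ∈ chordPos n a) (h2 : i ∈ chordPos n (a + 1)) : False := by
  rw [mem_chordPos hn] at h1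
  rw [mem_chordPos_succ hn] at h2
  omega

theorem posOf_of_mem_chordPos (hn : 3 ≤ n) {u : ℕ → ℕ} (hu : IsLabelling n u)
    {a : ZMod (n - 1 + n)} {t : Fin (n - 1 + n) → W} {δ : Fin (n - 1 + n) → Bool}
    (hr : IsDSeq (simpleSeq cs s) n u a (reflAt t δ)) {i : Fin (n - 1 + n)}
    (hi : i ∈ chordPos n a) : posOf t δ (reflAt t δ i) = chordPos n a := by
  classical
  ext j
  simp only [posOf, Finset.mem_filter, Finset.mem_univ, true_and]
  constructor
  · intro h
    rcases IsDSeq.mem_chordPos_of_eq cs hs hn hu hr h with rfl | h | h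
    · exact hi
    · exact h.1
    · exact (disjoint_chordPos hn a hi h.2).elim
  · exact fun hj => IsDSeq.eq_of_mem_chordPos hn hr hj hi

theorem posOf_of_mem_chordPos_succ (hn : 3 ≤ n) {u : ℕ → ℕ} (hu : IsLabelling n u)
    {a : ZMod (n - 1 + n)} {t : Fin (n - 1 + n) → W} {δ : Fin (n - 1 + n) → Bool}
    (hr : IsDSeq (simpleSeq cs s) n u a (reflAt t δ)) :
    posOf t δ (trans (simpleSeq cs s) (u 0) (u 1)) = chordPos n (a + 1) := by
  classical
  have h0 : ∀ j ∈ chordPos n (a + 1), reflAt t δ j = trans (simpleSeq cs s) (u 0) (u 1) := by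
    intro j hj
    rw [hr j]
    rcases (mem_chordPos_succ hn a j).mp hj with e | e
    · rw [e, dEntry_zero hn]
    · rw [e, dEntry_pred hn]
  obtain ⟨i, hi⟩ : (chordPos n (a + 1)).Nonempty := by
    rw [← Finset.card_pos, card_chordPos hn]; norm_num
  ext j
  simp only [posOf, Finset.mem_filter, Finset.mem_univ, true_and]
  constructor
  · intro h
    rw [← h0 i hi] at h
    rcases IsDSeq.mem_chordPos_of_eq cs hs hn hu hr h with rfl | h | h
    · exact hi
    · exact (disjoint_chordPos hn a h.2 hi).elim
    · exact h.1
  · exact h0 j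

/-- The cyclic structure of the subexpressions of a shifted `D`-sequence. Moreover, `n - 1` consecutive
reflections `ρ (a + 1), …, ρ (a + n - 1)` are transpositions, each of which joins a new label to a
previous one. -/
theorem exists_isSubCycle (hn : 3 ≤ n) {u₀ : ℕ → ℕ} (hu₀ : IsLabelling n u₀)
    {K : ZMod (n - 1 + n)} {t : Fin (n - 1 + n) → W}
    (ht : IsDSeq (simpleSeq cs s) n u₀ K t) :
    ∃ ε ρ, IsSubCycle t ε ρ ∧ ∀ a : ZMod (n - 1 + n), ∃ u, IsLabelling n u ∧
      ∀ j < n - 1, ∃ y ≤ j, ρ ((j : ZMod (n - 1 + n)) + (a + 1)) =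
        trans (simpleSeq cs s) (u y) (u (j + 1)) := by
  classical
  have : NeZero (n - 1 + n) := ⟨by omega⟩
  have hσ := typeARelations_simpleSeq cs hs
  have hinv : ∀ i, t i * t i = 1 := by
    intro i
    have hv := ZMod.val_lt (((i : ℕ) : ZMod (n - 1 + n)) - K)
    have l1 := hu₀.lt _ (dLeft_lt hn hv)
    have l2 := hu₀.lt _ (dRight_lt hn hv)
    rw [ht i]
    exact hσ.trans_mul_self (dEntry_ne hn hu₀ hv) (by omega) (by omega)
  have hne1 : ∀ i, t i ≠ 1 := by
    intro i
    have hv := ZMod.val_lt (((i : ℕ) : ZMod (n - 1 + n)) - K)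
    rw [ht i]
    exact trans_ne_one cs hs (by omega) (dEntry_ne hn hu₀ hv) (hu₀.lt _ (dLeft_lt hn hv))
      (hu₀.lt _ (dRight_lt hn hv))
  -- each member of the cycle sees a relabelled `D`-sequence with the initial entry at its own number
  have hstate : ∀ a, cycleSub n K a ∈ subTo t 1 ∧ ∃ u, IsLabelling n u ∧
      IsDSeq (simpleSeq cs s) n u a (reflAt t (cycleSub n K a)) := by
    have hind : ∀ j : ℕ, cycleSub n K (K + j) ∈ subTo t 1 ∧ ∃ u, IsLabelling n u ∧
        IsDSeq (simpleSeq cs s) n u (K + j) (reflAt t (cycleSub n K (K + j))) := by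
      intro j
      induction j with
      | zero =>
        have hpp : ∀ k ≤ n - 1 + n, partialProd t (fun _ => false) k = 1 := by
          intro k hk
          induction k with
          | zero => rfl
          | succ k ih =>
            have e := partialProd_succ t (fun _ => false) ⟨k, hk⟩
            simp only at e
            rw [e, ih (by omega)]
            simp
        rw [Nat.cast_zero, add_zero, cycleSub_self]
        refine ⟨mem_subTo_one.mpr (hpp _ le_rfl), u₀, hu₀, fun i => ?_⟩
        rw [reflAt_eq, hpp _ i.isLt.le, ← ht i]
        simp
      | succ j ih =>
        obtain ⟨ih1, u, hu, ih2⟩ := ih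
        obtain ⟨⟨u', hu', -, h1⟩, h2, -⟩ := ih2.step hσ hn hinv hu
        rw [Nat.cast_succ, ← add_assoc, cycleSub_succ hn]
        exact ⟨h2 ih1, u', hu', h1⟩
    intro a
    have := hind (a - K).val
    rwa [ZMod.natCast_zmod_val, add_sub_cancel] at this
  -- the reflection at the chord `a` is the same for the two members that differ at this chord
  have hρ : ∀ a, ∃ p, posOf t (cycleSub n K (a - 1)) p = chordPos n a ∧
      posOf t (cycleSub n K a) p = chordPos n a := by
    intro a
    obtain ⟨-, u, hu, h⟩ := hstate (a - 1)
    obtain ⟨-, u', hu', h'⟩ := hstate a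
    obtain ⟨-, -, h3⟩ := h.step hσ hn hinv hu
    have h4 := posOf_of_mem_chordPos_succ cs hs hn hu h
    rw [sub_add_cancel] at h3 h4
    refine ⟨_, h4, ?_⟩
    obtain ⟨i, hi⟩ : (chordPos n a).Nonempty := by
      rw [← Finset.card_pos, card_chordPos hn]; norm_num
    have hc := cycleSub_succ hn K (a - 1)
    rw [sub_add_cancel] at hc
    rw [← h3 i hi, ← hc]
    exact posOf_of_mem_chordPos cs hs hn hu' h' hi
  choose ρ hρ1 hρ2 using hρ
  have hright : ∀ a, posOf t (cycleSub n K a) (ρ (a + 1)) = chordPos n (a + 1) := by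
    intro a
    have := hρ1 (a + 1)
    rwa [add_sub_cancel_right] at this
  have hother : ∀ a p, p ≠ ρ a → p ≠ ρ (a + 1) → (posOf t (cycleSub n K a) p).card ≤ 1 := by
    intro a p h1 h2
    obtain ⟨-, u, hu, h⟩ := hstate a
    rw [Finset.card_le_one]
    intro i hi j hj
    have hmem : ∀ i q, i ∈ posOf t (cycleSub n K a) q ↔ reflAt t (cycleSub n K a) i = q := by
      intro i q
      simp [posOf]
    rw [hmem] at hi hj
    rcases IsDSeq.mem_chordPos_of_eq cs hs hn hu h (hi.trans hj.symm) with e | e | e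
    · exact e
    · exfalso
      have := e.1
      rw [← hρ2, hmem] at this
      exact h1 (hi.symm.trans this)
    · exfalso
      have := e.1
      rw [← hright, hmem] at this
      exact h2 (hi.symm.trans this)
  have hinj := injective_of_posOf hn hρ2 hright hother
  have himage : Finset.univ.image (cycleSub n K) = subTo t 1 := by
    refine Finset.eq_of_subset_of_card_le ?_ ?_
    · intro δ hδ
      obtain ⟨a, -, rfl⟩ := Finset.mem_image.mp hδ
      exact (hstate a).1
    · rw [Finset.card_image_of_injective _ hinj, Finset.card_univ, ZMod.card]
      obtain ⟨h0, u, hu, h⟩ := hstate 0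
      -- seen from the member of the cycle with number `0`, the sequence `t` is an unshifted
      -- `D`-sequence
      refine le_trans ?_ (card_subTo_le cs hs hn hu h)
      refine Finset.card_le_card_of_injOn (fun δ i => xor (cycleSub n K 0 i) (δ i)) ?_ ?_
      · intro δ hδ
        have hδ' := mem_subTo_one.mp hδ
        rw [mem_subTo_one] at h0
        rw [Finset.mem_coe, mem_subTo_one]
        have e := partialProd_xor hinv (cycleSub n K 0)
          (fun i => xor (cycleSub n K 0 i) (δ i)) le_rfl
        rw [h0, mul_one] at e
        rw [← e, ← hδ']
        simp
      · intro δ _ δ' _ e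
        funext i
        simpa using congrFun e i
  refine ⟨cycleSub n K, ρ, ⟨hn, fun δ => ?_, cycleSub_succ hn K, hρ2, hright, hother,
    fun δ hδ i => fold_singleton_notMem_subTo hinv (hne1 i) hδ⟩, fun a => ?_⟩
  · rw [← himage]; simp
  obtain ⟨-, u, hu, h⟩ := hstate a
  refine ⟨u, hu, ?_⟩
  -- after `j` steps the label at the place `0` is one of the first `j + 1` labels, and the following
  -- labels are the remaining ones in the old order
  have key : ∀ j : ℕ, j ≤ n - 1 → ∃ v, IsLabelling n v ∧
      IsDSeq (simpleSeq cs s) n v (a + j) (reflAt t (cycleSub n K (a + j))) ∧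
      (∀ i, 1 ≤ i → i + j ≤ n - 1 → v i = u (i + j)) ∧ ∃ y ≤ j, v 0 = u y := by
    intro j hj
    induction j with
    | zero =>
      rw [Nat.cast_zero, add_zero]
      exact ⟨u, hu, h, fun i _ _ => rfl, 0, le_rfl, rfl⟩
    | succ j ih =>
      obtain ⟨v, hv, h1, h2, y, hy, h3⟩ := ih (by omega)
      obtain ⟨⟨v', hv', hvv, h4⟩, -, -⟩ := h1.step hσ hn hinv hv
      rw [Nat.cast_succ, ← add_assoc, cycleSub_succ hn]
      refine ⟨v', hv', h4, ?_, ?_⟩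
      · intro i hi hij
        have e : rotLabel n v i = u (i + (j + 1)) := by
          rw [rotLabel, if_pos (by omega), h2 (i + 1) (by omega) (by omega)]
          congr 1; omega
        rcases hvv with rfl | rfl
        · exact e
        · have e1 : rotLabel n v i = v (i + 1) := by rw [rotLabel, if_pos (by omega)]
          have n0 : v (i + 1) ≠ v 0 := fun e => by
            have := hv.injOn _ (by omega) _ (by omega) e; omega
          have n1 : v (i + 1) ≠ v 1 := fun e => by
            have := hv.injOn _ (by omega) _ (by omega) e; omega
          simp only
          rw [← e, e1, Equiv.swap_apply_of_ne_of_ne n0 n1]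
      · have e1 : rotLabel n v 0 = v 1 := by rw [rotLabel, if_pos (by omega)]
        rcases hvv with rfl | rfl
        · exact ⟨j + 1, le_rfl, by rw [e1, h2 1 le_rfl (by omega), add_comm]⟩
        · refine ⟨y, by omega, ?_⟩
          simp only
          rw [e1, Equiv.swap_apply_right, h3]
  intro j hj
  obtain ⟨v, hv, h1, h2, y, hy, h3⟩ := key j (by omega)
  refine ⟨y, hy, ?_⟩
  have e1 := posOf_of_mem_chordPos_succ cs hs hn hv h1
  rw [← h3, show u (j + 1) = v 1 by rw [h2 1 le_rfl (by omega), add_comm],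
    show (j : ZMod (n - 1 + n)) + (a + 1) = a + j + 1 by ring]
  rcases eq_or_eq_of_posOf hn hρ2 hright hother e1 with ⟨e, -⟩ | ⟨-, e⟩
  · exfalso
    exact natCast_ne_zero (n := n) one_pos (by omega) (by rw [Nat.cast_one]; linear_combination e)
  · exact e.symm

end Existence

/-! ### Linear independence of consecutive roots -/

section Roots

variable {B W : Type*} [Group W] {M : CoxeterMatrix B} (cs : CoxeterSystem M W) {n : ℕ}
  {s : Fin (n - 1) → B} (hs : ∀ a b, M (s a) (s b) = CoxeterMatrix.A (n - 1) a b)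
include hs

/-- Transpositions that join in turn a new label to a previous one are the edges of a spanning tree,
so that their roots form a basis of the span of all roots of the parabolic subgroup. -/
theorem linearIndependent_of_tree {α : W → (B →₀ ℝ)}
    (hα : ∀ p, cs.IsReflection p → IsRootOf cs p (α p)) (hn : 3 ≤ n) {u : ℕ → ℕ}
    (hu : IsLabelling n u) {q : Fin (n - 1) → W}
    (hq : ∀ j : Fin (n - 1), ∃ y ≤ (j : ℕ), q j = trans (simpleSeq cs s) (u y) (u (j + 1))) :
    LinearIndependent ℝ (fun j => α (q j)) ∧
      ∀ x < n, ∀ y < n, x ≠ y →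
        α (trans (simpleSeq cs s) x y) ∈ Submodule.span ℝ (Set.range fun j => α (q j)) := by
  have h1 : ∀ x < n, vertexVec s (u x) - vertexVec s (u 0) ∈
      Submodule.span ℝ (Set.range fun j => α (q j)) := by
    intro x
    induction x using Nat.strong_induction_on with
    | _ x ih =>
      intro hx
      rcases Nat.eq_zero_or_pos x with rfl | hx0
      · simp
      obtain ⟨y, hy, e⟩ := hq ⟨x - 1, by omega⟩
      simp only [show x - 1 + 1 = x by omega] at e hy
      have hne : u y ≠ u x := fun e => by
        have := hu.injOn y (by omega) x hx e
        omega
      obtain ⟨c, hc, e'⟩ := root_trans cs hs hα hne (hu.lt y (by omega)) (hu.lt x hx)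
      have h2 := ih y (by omega) (by omega)
      have h3 : c⁻¹ • α (q ⟨x - 1, by omega⟩) ∈ Submodule.span ℝ (Set.range fun j => α (q j)) :=
        Submodule.smul_mem _ _ (Submodule.subset_span ⟨_, rfl⟩)
      rw [e, e', smul_smul, inv_mul_cancel₀ hc, one_smul] at h3
      have h4 := Submodule.add_mem _ h3 h2
      rwa [sub_add_sub_cancel] at h4
  have hsurj : ∀ x < n, ∃ y < n, u y = x := by
    intro x hx
    have hinj : Function.Injective (fun y : Fin n => (⟨u y, hu.lt y y.isLt⟩ : Fin n)) := by
      intro a b e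
      exact Fin.ext (hu.injOn _ a.isLt _ b.isLt (congrArg Fin.val e))
    obtain ⟨y, hy⟩ := Finite.surjective_of_injective hinj ⟨x, hx⟩
    exact ⟨y, y.isLt, congrArg Fin.val hy⟩
  have h2 : ∀ x < n, ∀ y < n, vertexVec s x - vertexVec s y ∈
      Submodule.span ℝ (Set.range fun j => α (q j)) := by
    intro x hx y hy
    obtain ⟨x', hx', rfl⟩ := hsurj x hx
    obtain ⟨y', hy', rfl⟩ := hsurj y hy
    have := Submodule.sub_mem _ (h1 x' hx') (h1 y' hy')
    rwa [sub_sub_sub_cancel_right] at this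
  refine ⟨?_, fun x hx y hy hxy => ?_⟩
  · have hinj : Function.Injective s := by
      intro a b e
      by_contra hne
      have h := coxeterMatrix_apply hs a.isLt b.isLt
      have hne' : (a : ℕ) ≠ b := fun e => hne (Fin.ext e)
      rw [Fin.eta, Fin.eta, e, M.diagonal, if_neg hne'] at h
      split_ifs at h <;> omega
    have hli : LinearIndependent ℝ (fun j : Fin (n - 1) => (Finsupp.single (s j) (1 : ℝ))) :=
      (Finsupp.linearIndependent_single_one ℝ B).comp s hinj
    have hle : Submodule.span ℝ (Set.range fun j : Fin (n - 1) => Finsupp.single (s j) (1 : ℝ)) ≤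
        Submodule.span ℝ (Set.range fun j => α (q j)) := by
      rw [Submodule.span_le]
      rintro _ ⟨j, rfl⟩
      have := h2 (j + 1) (by omega) j (by omega)
      rw [vertexVec_succ, add_sub_cancel_left, simpleRoot, dif_pos j.isLt] at this
      exact this
    rw [linearIndependent_iff_card_le_finrank_span, Set.finrank]
    have hfin : FiniteDimensional ℝ (Submodule.span ℝ (Set.range fun j => α (q j))) :=
      FiniteDimensional.span_of_finite ℝ (Set.finite_range _)
    calc Fintype.card (Fin (n - 1)) = _ := (finrank_span_eq_card hli).symm
      _ ≤ _ := Submodule.finrank_mono hle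
  · obtain ⟨c, -, e⟩ := root_trans cs hs hα hxy hx hy
    rw [e]
    exact Submodule.smul_mem _ _ (h2 y hy x hx)

end Roots

/-! ### The numbers `n_p(Φ, ε)` -/

section MaxCard

variable {W : Type*} [Group W] {m : ℕ} {t : Fin m → W} {w : W}
  {Φ : Finset (Fin m → Bool)} {δ : Fin m → Bool} {p : W}

theorem exists_fold_eq (δ δ' : Fin m → Bool) :
    ∃ D : Finset (Fin m), (∀ i, δ i ≠ δ' i ↔ i ∈ D) ∧ δ' = fold D δ := by
  classical
  have e : ∀ i, δ i ≠ δ' i ↔ i ∈ Finset.univ.filter (fun i => δ i ≠ δ' i) := by simp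
  exact ⟨_, e, fold_of_ne_iff e⟩

theorem fold_ne_self {D : Finset (Fin m)} (hD : D.Nonempty) (δ : Fin m → Bool) : fold D δ ≠ δ := by
  obtain ⟨i, hi⟩ := hD
  intro e
  exact (fold_apply_ne_iff (ε := δ)).mpr hi (by rw [e])

theorem fold_empty (δ : Fin m → Bool) : fold ∅ δ = δ := by
  funext i
  simp [fold]

theorem card_ne_one_of_fold_mem (hs : ∀ δ ∈ subTo t w, ∀ i, fold {i} δ ∉ subTo t w)
    (hδ : δ ∈ subTo t w) {D : Finset (Fin m)} (hD : fold D δ ∈ subTo t w) : D.card ≠ 1 := by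
  intro h
  obtain ⟨i, rfl⟩ := Finset.card_eq_one.mp h
  exact hs δ hδ i hD

theorem maxCard_le : maxCard t w Φ δ p ≤ (posOf t δ p).card := by
  classical
  refine Finset.sup_le fun X hX => ?_
  exact Finset.card_le_card (Finset.mem_powerset.mp (Finset.mem_filter.mp hX).1)

theorem le_maxCard {X : Finset (Fin m)} (hX : X ⊆ posOf t δ p)
    (h : subUnfreeze t w δ X ⊆ insert δ (Φ : Set (Fin m → Bool))) :
    X.card ≤ maxCard t w Φ δ p := by
  classical
  exact Finset.le_sup (f := Finset.card)
    (Finset.mem_filter.mpr ⟨Finset.mem_powerset.mpr hX, h⟩)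

theorem one_le_maxCard (hs : ∀ δ ∈ subTo t w, ∀ i, fold {i} δ ∉ subTo t w) (hδ : δ ∈ subTo t w)
    (hp : (posOf t δ p).Nonempty) : 1 ≤ maxCard t w Φ δ p := by
  obtain ⟨i, hi⟩ := hp
  have := le_maxCard (t := t) (w := w) (Φ := Φ) (δ := δ) (p := p) (X := {i}) (by simpa using hi) (by
    rintro δ' ⟨hδ', hd⟩
    obtain ⟨D, hD, rfl⟩ := exists_fold_eq δ δ'
    have hsub : D ⊆ {i} := fun k hk => hd k ((hD k).mpr hk)
    rcases Finset.subset_singleton_iff.mp hsub with rfl | rfl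
    · exact Or.inl (fold_empty δ)
    · exact absurd hδ' (hs δ hδ i))
  simpa using this

theorem maxCard_eq_one (hs : ∀ δ ∈ subTo t w, ∀ i, fold {i} δ ∉ subTo t w) (hδ : δ ∈ subTo t w)
    (hp : (posOf t δ p).Nonempty) (hc : (posOf t δ p).card ≤ 1) : maxCard t w Φ δ p = 1 :=
  le_antisymm (maxCard_le.trans hc) (one_le_maxCard hs hδ hp)

open Classical in
/-- If `M_p(δ)` has two elements, then only the subexpression obtained by flipping both matters. -/
theorem maxCard_of_card_eq_two (hs : ∀ δ ∈ subTo t w, ∀ i, fold {i} δ ∉ subTo t w)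
    (hδ : δ ∈ subTo t w) (hc : (posOf t δ p).card = 2) (hf : fold (posOf t δ p) δ ∈ subTo t w) :
    maxCard t w Φ δ p = if fold (posOf t δ p) δ ∈ Φ then 2 else 1 := by
  have hne : (posOf t δ p).Nonempty := by rw [← Finset.card_pos, hc]; norm_num
  have h1 := one_le_maxCard (Φ := Φ) hs hδ hne
  have h2 : maxCard t w Φ δ p ≤ 2 := hc ▸ maxCard_le
  split_ifs with h
  · refine le_antisymm h2 ?_
    rw [← hc]
    refine le_maxCard subset_rfl ?_
    rintro δ' ⟨hδ', hd⟩
    obtain ⟨D, hD, rfl⟩ := exists_fold_eq δ δ'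
    have hsub : D ⊆ posOf t δ p := fun k hk => hd k ((hD k).mpr hk)
    have h3 := card_ne_one_of_fold_mem hs hδ hδ'
    rcases Nat.eq_zero_or_pos D.card with h0 | h0
    · rw [Finset.card_eq_zero.mp h0]; exact Or.inl (fold_empty δ)
    · rw [Finset.eq_of_subset_of_card_le hsub (by omega)]
      exact Or.inr h
  · refine le_antisymm ?_ h1
    by_contra hlt
    obtain ⟨X, hX, hXc⟩ := Finset.exists_mem_eq_sup
      ((posOf t δ p).powerset.filter fun X => subUnfreeze t w δ X ⊆ insert δ (Φ : Set (Fin m → Bool)))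
      (Finset.nonempty_of_ne_empty (fun e => by
        have : maxCard t w Φ δ p = 0 := by rw [maxCard, e]; rfl
        omega)) Finset.card
    have hXc' : maxCard t w Φ δ p = X.card := hXc
    obtain ⟨hX1, hX2⟩ := Finset.mem_filter.mp hX
    have hXe := Finset.eq_of_subset_of_card_le (Finset.mem_powerset.mp hX1) (by omega)
    rw [hXe] at hX2
    rcases hX2 ⟨hf, fun i hi => fold_apply_ne_iff.mp hi⟩ with e | e
    · exact fold_ne_self hne δ e
    · exact h e

theorem exists_conCloseVia_of_conDist {d : ℕ} (h : conDist t w Φ δ = d) :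
    ∃ Y, ConCloseVia t w Φ δ Y := by
  by_contra hne
  push Not at hne
  have : conDist t w Φ δ = ⊤ := by simp [conDist, hne]
  rw [this] at h
  exact ENat.top_ne_natCast d h

theorem exists_conDist_eq {Y : Finset (Fin m)} (h : ConCloseVia t w Φ δ Y) :
    ∃ d : ℕ, conDist t w Φ δ = d := by
  have hle : conDist t w Φ δ ≤ ((2 * Y.card : ℕ) : ℕ∞) := iInf₂_le Y h
  obtain ⟨d, hd⟩ := ENat.ne_top_iff_exists.mp (ne_top_of_le_ne_top (ENat.natCast_ne_top _) hle)
  exact ⟨d, hd.symm⟩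

end MaxCard

/-! ### Algorithm 2 on a cycle -/

namespace IsSubCycle

variable {W : Type*} [Group W] {n : ℕ} {t : Fin (n - 1 + n) → W}
  {ε : ZMod (n - 1 + n) → Fin (n - 1 + n) → Bool} {ρ : ZMod (n - 1 + n) → W}
  (h : IsSubCycle t ε ρ) {Φ : Finset (Fin (n - 1 + n) → Bool)}

include h

open Classical in
theorem maxCard_left (a : ZMod (n - 1 + n)) :
    maxCard t 1 Φ (ε a) (ρ a) = if ε (a - 1) ∈ Φ then 2 else 1 := by
  have e := maxCard_of_card_eq_two (Φ := Φ) (p := ρ a) h.fold_singleton (h.mem a)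
    (by rw [h.posOf_left, card_chordPos h.three_le])
    (by rw [h.posOf_left, ← h.pred]; exact h.mem _)
  rw [e, h.posOf_left, ← h.pred]

open Classical in
theorem maxCard_right (a : ZMod (n - 1 + n)) :
    maxCard t 1 Φ (ε a) (ρ (a + 1)) = if ε (a + 1) ∈ Φ then 2 else 1 := by
  have e := maxCard_of_card_eq_two (Φ := Φ) (p := ρ (a + 1)) h.fold_singleton (h.mem a)
    (by rw [h.posOf_right, card_chordPos h.three_le])
    (by rw [h.posOf_right, ← h.succ]; exact h.mem _)
  rw [e, h.posOf_right, ← h.succ]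

omit h in
theorem mem_posOf_iff {δ : Fin (n - 1 + n) → Bool} {p : W} {i : Fin (n - 1 + n)} :
    i ∈ posOf t δ p ↔ reflAt t δ i = p := by
  simp [posOf]

/-- The members of the cycle adjacent to a given one are its two neighbours. -/
theorem eq_or_eq_of_rel {a : ZMod (n - 1 + n)} {δ : Fin (n - 1 + n) → Bool} (hδ : δ ∈ subTo t 1)
    (hne : ε a ≠ δ) {p : W} (hp : ∀ k, ε a k ≠ δ k → reflAt t (ε a) k = p) :
    δ = ε (a + 1) ∨ δ = ε (a - 1) := by
  obtain ⟨D, hD, rfl⟩ := exists_fold_eq (ε a) δ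
  have hsub : D ⊆ posOf t (ε a) p := fun k hk => mem_posOf_iff.mpr (hp k ((hD k).mpr hk))
  have h1 := card_ne_one_of_fold_mem h.fold_singleton (h.mem a) hδ
  have h0 : D.card ≠ 0 := by
    intro e
    rw [Finset.card_eq_zero.mp e, fold_empty] at hne
    exact hne rfl
  have h2 := Finset.card_le_card hsub
  by_cases e1 : p = ρ a
  · right
    rw [e1, h.posOf_left] at hsub
    rw [h.pred, Finset.eq_of_subset_of_card_le hsub (by rw [card_chordPos h.three_le]; omega)]
  by_cases e2 : p = ρ (a + 1)
  · left
    rw [e2, h.posOf_right] at hsub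
    rw [h.succ, Finset.eq_of_subset_of_card_le hsub (by rw [card_chordPos h.three_le]; omega)]
  have := h.posOf_other a p e1 e2
  omega

/-- The component of `ε c` stays inside `S` if each edge that leaves `S` flips a frozen position. -/
theorem subFreezeCon_subset {c : ZMod (n - 1 + n)} {Y : Finset (Fin (n - 1 + n))}
    {S : Set (ZMod (n - 1 + n))} (hc : c ∈ S)
    (hup : ∀ a ∈ S, a + 1 ∉ S → ∃ y ∈ Y, y ∈ chordPos n (a + 1))
    (hdown : ∀ a ∈ S, a - 1 ∉ S → ∃ y ∈ Y, y ∈ chordPos n a) :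
    subFreezeCon t 1 (ε c) Y ⊆ ε '' S := by
  rintro δ ⟨hc', hδ, hreach⟩
  have key : ∀ (x : subFreeze t 1 (ε c) Y) (y : subFreeze t 1 (ε c) Y), x.1 ∈ ε '' S →
      (graph t (subFreeze t 1 (ε c) Y)).Adj x y → y.1 ∈ ε '' S := by
    rintro ⟨x, hx⟩ ⟨y, hy⟩ ⟨a, ha, rfl⟩ hadj
    obtain ⟨hne, hrel⟩ := hadj
    have hne' : ε a ≠ y := fun e => hne (Subtype.ext e)
    have hnb : y = ε (a + 1) ∨ y = ε (a - 1) := by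
      rcases hrel with ⟨p, hp⟩ | ⟨p, hp⟩
      · exact h.eq_or_eq_of_rel hy.1 hne' hp
      · obtain ⟨b, rfl⟩ := (h.mem_iff y).mp hy.1
        rcases h.eq_or_eq_of_rel (h.mem a) hne'.symm hp with e | e
        · right; rw [h.injective e, add_sub_cancel_right]
        · left; rw [h.injective e, sub_add_cancel]
    have hagree : ∀ i ∈ Y, ε a i = y i := by
      intro i hi
      have e1 : ε c i = ε a i := by_contra fun e => hx.2 i e hi
      have e2 : ε c i = y i := by_contra fun e => hy.2 i e hi
      rw [← e1, e2]
    rcases hnb with rfl | rfl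
    · by_contra hcon
      obtain ⟨y, hy1, hy2⟩ := hup a ha (fun hm => hcon ⟨_, hm, rfl⟩)
      have := hagree y hy1
      rw [h.succ] at this
      exact fold_apply_ne_iff.mpr hy2 this
    · by_contra hcon
      obtain ⟨y, hy1, hy2⟩ := hdown a ha (fun hm => hcon ⟨_, hm, rfl⟩)
      have := hagree y hy1
      rw [h.pred] at this
      exact fold_apply_ne_iff.mpr hy2 this
  obtain ⟨walk⟩ := hreach
  have hwalk : ∀ (x y : subFreeze t 1 (ε c) Y), (graph t (subFreeze t 1 (ε c) Y)).Walk x y →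
      x.1 ∈ ε '' S → y.1 ∈ ε '' S := by
    intro x y walk
    induction walk with
    | nil => exact id
    | cons hadj _ ih => exact fun hx => ih (key _ _ hx hadj)
  exact hwalk _ _ walk ⟨c, hc, rfl⟩

theorem mem_subFreezeCon_self (c : ZMod (n - 1 + n)) (Y : Finset (Fin (n - 1 + n))) :
    ε c ∈ subFreezeCon t 1 (ε c) Y :=
  ⟨⟨h.mem c, fun _ hi => absurd rfl hi⟩, ⟨h.mem c, fun _ hi => absurd rfl hi⟩,
    SimpleGraph.Reachable.refl _⟩

theorem mem_subFreezeCon_succ {c a : ZMod (n - 1 + n)} {Y : Finset (Fin (n - 1 + n))}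
    (ha : ε a ∈ subFreezeCon t 1 (ε c) Y) (hY : Disjoint Y (chordPos n (a + 1))) :
    ε (a + 1) ∈ subFreezeCon t 1 (ε c) Y := by
  obtain ⟨h1, h2, hr⟩ := ha
  have h3 : ε (a + 1) ∈ subFreeze t 1 (ε c) Y := by
    refine ⟨h.mem _, fun i hi hiY => hi ?_⟩
    rw [h.succ]
    have e1 : ε c i = ε a i := by_contra fun e => h2.2 i e hiY
    rw [e1]
    exact by_contra fun e => Finset.disjoint_left.mp hY hiY (fold_apply_ne_iff.mp e)
  refine ⟨h1, h3, hr.trans (SimpleGraph.Adj.reachable ⟨?_, Or.inl ⟨ρ (a + 1), fun k hk => ?_⟩⟩)⟩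
  · intro e
    have e' := h.injective (congrArg Subtype.val e)
    have hn := h.three_le
    exact natCast_ne_zero (n := n) one_pos (by omega) (by rw [Nat.cast_one]; linear_combination -e')
  · change ε a k ≠ ε (a + 1) k at hk
    change reflAt t (ε a) k = _
    rw [h.succ] at hk
    have := fold_apply_ne_iff.mp hk
    rwa [← h.posOf_right, mem_posOf_iff] at this

theorem mem_subFreezeCon_pred {c a : ZMod (n - 1 + n)} {Y : Finset (Fin (n - 1 + n))}
    (ha : ε a ∈ subFreezeCon t 1 (ε c) Y) (hY : Disjoint Y (chordPos n a)) :
    ε (a - 1) ∈ subFreezeCon t 1 (ε c) Y := by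
  obtain ⟨h1, h2, hr⟩ := ha
  have h3 : ε (a - 1) ∈ subFreeze t 1 (ε c) Y := by
    refine ⟨h.mem _, fun i hi hiY => hi ?_⟩
    rw [h.pred]
    have e1 : ε c i = ε a i := by_contra fun e => h2.2 i e hiY
    rw [e1]
    exact by_contra fun e => Finset.disjoint_left.mp hY hiY (fold_apply_ne_iff.mp e)
  refine ⟨h1, h3, hr.trans (SimpleGraph.Adj.reachable ⟨?_, Or.inl ⟨ρ a, fun k hk => ?_⟩⟩)⟩
  · intro e
    have e' := h.injective (congrArg Subtype.val e)
    have hn := h.three_le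
    exact natCast_ne_zero (n := n) one_pos (by omega) (by rw [Nat.cast_one]; linear_combination e')
  · change ε a k ≠ ε (a - 1) k at hk
    change reflAt t (ε a) k = _
    rw [h.pred] at hk
    have := fold_apply_ne_iff.mp hk
    rwa [← h.posOf_left, mem_posOf_iff] at this

theorem mem_subFreezeCon_add {c : ZMod (n - 1 + n)} {Y : Finset (Fin (n - 1 + n))} (J : ℕ)
    (hY : ∀ i < J, Disjoint Y (chordPos n (c + i + 1))) :
    ε (c + J) ∈ subFreezeCon t 1 (ε c) Y := by
  induction J with
  | zero => rw [Nat.cast_zero, add_zero]; exact h.mem_subFreezeCon_self c Y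
  | succ J ih =>
    rw [Nat.cast_succ, ← add_assoc]
    exact h.mem_subFreezeCon_succ (ih fun i hi => hY i (by omega)) (hY J (by omega))

theorem mem_subFreezeCon_sub {c : ZMod (n - 1 + n)} {Y : Finset (Fin (n - 1 + n))} (J : ℕ)
    (hY : ∀ i < J, Disjoint Y (chordPos n (c - i))) :
    ε (c - J) ∈ subFreezeCon t 1 (ε c) Y := by
  induction J with
  | zero => rw [Nat.cast_zero, sub_zero]; exact h.mem_subFreezeCon_self c Y
  | succ J ih =>
    rw [Nat.cast_succ, ← sub_sub]
    exact h.mem_subFreezeCon_pred (ih fun i hi => hY i (by omega)) (hY J (by omega))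

omit h in
/-- The arc `ε b, ε (b + 1), …, ε (b + r - 1)` of the cycle. -/
def arc (ε : ZMod (n - 1 + n) → Fin (n - 1 + n) → Bool) (b : ZMod (n - 1 + n)) (r : ℕ) :
    Finset (Fin (n - 1 + n) → Bool) :=
  (Finset.range r).image fun j : ℕ => ε (b + j)

theorem mem_arc {b c : ZMod (n - 1 + n)} {r : ℕ} (hr : r ≤ n - 1 + n) :
    ε c ∈ arc ε b r ↔ (c - b).val < r := by
  have hn := h.three_le
  have : NeZero (n - 1 + n) := ⟨by omega⟩
  simp only [arc, Finset.mem_image, Finset.mem_range]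
  constructor
  · rintro ⟨j, hj, e⟩
    rw [← h.injective e, add_sub_cancel_left, ZMod.val_natCast_of_lt (by omega)]
    exact hj
  · intro hlt
    exact ⟨_, hlt, by rw [ZMod.natCast_zmod_val, add_sub_cancel]⟩

omit h in
theorem insert_arc_top (b : ZMod (n - 1 + n)) (r : ℕ) :
    insert (ε (b + r)) (arc ε b r) = arc ε b (r + 1) := by
  rw [arc, arc, Finset.range_add_one, Finset.image_insert]

omit h in
theorem insert_arc_bot (b : ZMod (n - 1 + n)) (r : ℕ) :
    insert (ε (b - 1)) (arc ε b r) = arc ε (b - 1) (r + 1) := by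
  ext δ
  simp only [arc, Finset.mem_insert, Finset.mem_image, Finset.mem_range]
  constructor
  · rintro (rfl | ⟨j, hj, rfl⟩)
    · exact ⟨0, by omega, by simp⟩
    · exact ⟨j + 1, by omega, by push_cast; congr 1; ring⟩
  · rintro ⟨j, hj, rfl⟩
    rcases Nat.eq_zero_or_pos j with rfl | hj0
    · left; simp
    · right
      refine ⟨j - 1, by omega, ?_⟩
      rw [Nat.cast_sub hj0]; congr 1; push_cast; ring

/-- The first condition of con-closeness says that `Y` contains no position outside of the two chords
of `ε c`, and one position or no position of each chord, as the neighbour of `ε c` belongs to `Φ`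
or not. -/
theorem card_inter_iff {c : ZMod (n - 1 + n)} {Y : Finset (Fin (n - 1 + n))} :
    (∀ p : W, (posOf t (ε c) p).Nonempty →
      (Y ∩ posOf t (ε c) p).card + 1 = maxCard t 1 Φ (ε c) p) ↔
    ((Y ∩ chordPos n c).card = 1 ∧ ε (c - 1) ∈ Φ ∨ Y ∩ chordPos n c = ∅ ∧ ε (c - 1) ∉ Φ) ∧
    ((Y ∩ chordPos n (c + 1)).card = 1 ∧ ε (c + 1) ∈ Φ ∨
      Y ∩ chordPos n (c + 1) = ∅ ∧ ε (c + 1) ∉ Φ) ∧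
    Y ⊆ chordPos n c ∪ chordPos n (c + 1) := by
  classical
  have hn := h.three_le
  have hne : ∀ a, (chordPos n a).Nonempty := fun a => by
    rw [← Finset.card_pos, card_chordPos hn]; norm_num
  constructor
  · intro H
    have h1 := H (ρ c) (by rw [h.posOf_left]; exact hne c)
    have h2 := H (ρ (c + 1)) (by rw [h.posOf_right]; exact hne _)
    rw [h.posOf_left, h.maxCard_left] at h1
    rw [h.posOf_right, h.maxCard_right] at h2
    refine ⟨?_, ?_, fun i hi => ?_⟩
    · split_ifs at h1 with hΦ
      · exact Or.inl ⟨by omega, hΦ⟩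
      · exact Or.inr ⟨Finset.card_eq_zero.mp (by omega), hΦ⟩
    · split_ifs at h2 with hΦ
      · exact Or.inl ⟨by omega, hΦ⟩
      · exact Or.inr ⟨Finset.card_eq_zero.mp (by omega), hΦ⟩
    · have hi' : i ∈ posOf t (ε c) (reflAt t (ε c) i) := mem_posOf_iff.mpr rfl
      rw [Finset.mem_union, ← h.posOf_left c, ← h.posOf_right c, mem_posOf_iff, mem_posOf_iff]
      by_contra hcon
      push Not at hcon
      have h3 := H (reflAt t (ε c) i) ⟨i, hi'⟩
      rw [maxCard_eq_one h.fold_singleton (h.mem c) ⟨i, hi'⟩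
        (h.posOf_other c _ hcon.1 hcon.2)] at h3
      have h4 : Y ∩ posOf t (ε c) (reflAt t (ε c) i) = ∅ := Finset.card_eq_zero.mp (by omega)
      have := Finset.mem_inter.mpr ⟨hi, hi'⟩
      rw [h4] at this
      simp at this
  · rintro ⟨h1, h2, h3⟩ p hp
    by_cases e1 : p = ρ c
    · rw [e1, h.posOf_left, h.maxCard_left]
      rcases h1 with ⟨h1, hΦ⟩ | ⟨h1, hΦ⟩
      · rw [h1, if_pos hΦ]
      · rw [h1, if_neg hΦ]; rfl
    by_cases e2 : p = ρ (c + 1)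
    · rw [e2, h.posOf_right, h.maxCard_right]
      rcases h2 with ⟨h2, hΦ⟩ | ⟨h2, hΦ⟩
      · rw [h2, if_pos hΦ]
      · rw [h2, if_neg hΦ]; rfl
    rw [maxCard_eq_one h.fold_singleton (h.mem c) hp (h.posOf_other c _ e1 e2)]
    have h4 : Y ∩ posOf t (ε c) p = ∅ := by
      rw [Finset.eq_empty_iff_forall_notMem]
      intro i hi
      obtain ⟨hi1, hi2⟩ := Finset.mem_inter.mp hi
      have := h3 hi1
      rw [Finset.mem_union, ← h.posOf_left c, ← h.posOf_right c, mem_posOf_iff, mem_posOf_iff] at this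
      rw [mem_posOf_iff] at hi2
      rcases this with e | e
      · exact e1 (hi2.symm.trans e)
      · exact e2 (hi2.symm.trans e)
    rw [h4]; rfl

/-- A subexpression that is con-close to a non-empty arc is adjacent to one of its ends: otherwise
nothing is frozen and its component is the whole cycle. -/
theorem eq_or_eq_of_conCloseVia {b c : ZMod (n - 1 + n)} {r : ℕ} (hr0 : 1 ≤ r)
    (hr : r < n - 1 + n) {Y : Finset (Fin (n - 1 + n))}
    (hY : ConCloseVia t 1 (arc ε b r) (ε c) Y) :
    (c = b + r ∧ ε (c - 1) ∈ arc ε b r) ∨ (c = b - 1 ∧ ε (c + 1) ∈ arc ε b r) := by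
  have hn := h.three_le
  have : NeZero (n - 1 + n) := ⟨by omega⟩
  obtain ⟨hY1, hY2, hY3⟩ := hY
  rw [h.card_inter_iff] at hY2
  obtain ⟨h1, h2, h3⟩ := hY2
  rw [h.mem_arc hr.le] at hY1
  rcases h1 with ⟨-, h1⟩ | ⟨h1, h1'⟩
  · left
    refine ⟨?_, h1⟩
    rw [h.mem_arc hr.le, show c - 1 - b = c - b - 1 by ring, val_sub_one hn] at h1
    have hv : (c - b).val = r := by split_ifs at h1 <;> omega
    rw [val_eq_iff hn _ hr] at hv
    linear_combination hv
  rcases h2 with ⟨-, h2⟩ | ⟨h2, h2'⟩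
  · right
    refine ⟨?_, h2⟩
    rw [h.mem_arc hr.le] at h2
    have hv := val_sub_one hn (c + 1 - b)
    rw [show c + 1 - b - 1 = c - b by ring] at hv
    have hv' : (c + 1 - b).val = 0 := by
      by_contra hne
      rw [if_neg hne] at hv
      omega
    rw [ZMod.val_eq_zero] at hv'
    linear_combination hv'
  -- neither neighbour belongs to the arc, so that nothing is frozen
  exfalso
  have hYe : Y = ∅ := by
    rw [Finset.eq_empty_iff_forall_notMem]
    intro i hi
    rcases Finset.mem_union.mp (h3 hi) with hi' | hi'
    · have := Finset.mem_inter.mpr ⟨hi, hi'⟩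
      rw [h1] at this; simp at this
    · have := Finset.mem_inter.mpr ⟨hi, hi'⟩
      rw [h2] at this; simp at this
  have hmem := h.mem_subFreezeCon_add (c := c) (Y := Y) (b - c).val
    (fun i _ => by rw [hYe]; exact Finset.disjoint_empty_left _)
  rw [ZMod.natCast_zmod_val, add_sub_cancel] at hmem
  refine Set.disjoint_left.mp hY3 hmem ?_
  rw [Finset.mem_coe, h.mem_arc hr.le, sub_self, ZMod.val_zero]
  exact hr0

theorem conCloseVia_empty (c : ZMod (n - 1 + n)) : ConCloseVia t 1 ∅ (ε c) ∅ := by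
  refine ⟨by simp, h.card_inter_iff.mpr ⟨Or.inr (by simp), Or.inr (by simp), by simp⟩, by simp⟩

/-- An arc with at most `n` members can be prolonged. -/
theorem exists_conCloseVia {b : ZMod (n - 1 + n)} {r : ℕ} (hr0 : 1 ≤ r) (hr : r ≤ n) :
    ∃ Y, ConCloseVia t 1 (arc ε b r) (ε (b + r)) Y := by
  have hn := h.three_le
  have : NeZero (n - 1 + n) := ⟨by omega⟩
  have h2n := two_mul_natCast_pred hn
  -- the frozen position is the one of the chord that is shared with the chord `n - 1` steps ahead
  obtain ⟨y, hy⟩ := exists_fin_add_one_eq hn ((n : ZMod (n - 1 + n)) - 1 + (b + r))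
  have hy1 : y ∈ chordPos n (b + r) := (mem_chordPos_iff _ _).mpr (Or.inr hy)
  have hy2 : y ∈ chordPos n ((n : ZMod (n - 1 + n)) - 1 + (b + r)) :=
    (mem_chordPos_iff _ _).mpr (Or.inl hy)
  have hy3 : y ∉ chordPos n (b + r + 1) := fun h' => disjoint_chordPos hn _ hy1 h'
  have hsub : ∀ j : ℕ, j < n - 1 + n → (b + (j : ZMod (n - 1 + n)) - b).val = j := fun j hj => by
    rw [add_sub_cancel_left, ZMod.val_natCast_of_lt hj]
  refine ⟨{y}, ?_, h.card_inter_iff.mpr ⟨Or.inl ⟨?_, ?_⟩, Or.inr ⟨?_, ?_⟩, ?_⟩, ?_⟩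
  · rw [h.mem_arc (by omega), hsub r (by omega)]; omega
  · rw [Finset.singleton_inter_of_mem hy1, Finset.card_singleton]
  · rw [h.mem_arc (by omega), show b + (r : ZMod (n - 1 + n)) - 1 - b = b + r - b - 1 by ring,
      val_sub_one hn, hsub r (by omega), if_neg (by omega)]
    omega
  · exact Finset.singleton_inter_of_notMem hy3
  · have e : b + (r : ZMod (n - 1 + n)) + 1 = b + ((r + 1 : ℕ) : ZMod (n - 1 + n)) := by
      push_cast; ring
    rw [h.mem_arc (by omega), e, hsub _ (by omega)]; omega
  · simp [hy1]
  · -- the component is contained in the arc of length `n - 1` between the two chords through `y`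
    refine Set.disjoint_of_subset_left (h.subFreezeCon_subset
      (S := {a | ∃ j : ℕ, j < n - 1 ∧ a = b + r + j}) ⟨0, by omega, by simp⟩ ?_ ?_) ?_
    · rintro _ ⟨j, hj, rfl⟩ hnot
      refine ⟨y, by simp, ?_⟩
      have hj' : j + 1 = n - 1 := by
        by_contra hne
        exact hnot ⟨j + 1, by omega, by push_cast; ring⟩
      have e : b + (r : ZMod (n - 1 + n)) + j + 1 = (n : ZMod (n - 1 + n)) - 1 + (b + r) := by
        have e0 := congrArg (Nat.cast : ℕ → ZMod (n - 1 + n)) hj'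
        rw [natCast_pred hn] at e0
        push_cast at e0
        linear_combination e0
      rw [e]; exact hy2
    · rintro _ ⟨j, hj, rfl⟩ hnot
      refine ⟨y, by simp, ?_⟩
      have hj' : j = 0 := by
        by_contra hne
        exact hnot ⟨j - 1, by omega, by rw [Nat.cast_sub (by omega)]; push_cast; ring⟩
      rw [hj', Nat.cast_zero, add_zero]; exact hy1
    · rw [Set.disjoint_left]
      rintro _ ⟨_, ⟨j, hj, rfl⟩, rfl⟩ hmem
      have e : b + (r : ZMod (n - 1 + n)) + j = b + ((r + j : ℕ) : ZMod (n - 1 + n)) := by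
        push_cast; ring
      rw [Finset.mem_coe, h.mem_arc (by omega), e, hsub _ (by omega)] at hmem
      omega

/-- The last member of the cycle is con-close to the arc of the other ones. -/
theorem exists_conCloseVia_last (b : ZMod (n - 1 + n)) :
    ∃ Y, ConCloseVia t 1 (arc ε b (n - 1 + n - 1)) (ε (b - 1)) Y := by
  have hn := h.three_le
  have : NeZero (n - 1 + n) := ⟨by omega⟩
  have hlast : ε (b - 1) ∉ arc ε b (n - 1 + n - 1) := by
    rw [h.mem_arc (by omega), show b - 1 - b = 0 - 1 by ring, val_sub_one hn, if_pos (by simp)]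
    omega
  have hother : ∀ c, c ≠ b - 1 → ε c ∈ arc ε b (n - 1 + n - 1) := by
    intro c hc
    rw [h.mem_arc (by omega)]
    have h1 := ZMod.val_lt (c - b)
    by_contra hge
    have h2 : (c - b).val = n - 1 + n - 1 := by omega
    rw [val_eq_iff hn _ (by omega), Nat.cast_sub (by omega), ZMod.natCast_self] at h2
    refine hc ?_
    push_cast at h2
    linear_combination h2
  obtain ⟨y, hy⟩ : (chordPos n (b - 1)).Nonempty := by
    rw [← Finset.card_pos, card_chordPos hn]; norm_num
  obtain ⟨z, hz⟩ : (chordPos n (b - 1 + 1)).Nonempty := by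
    rw [← Finset.card_pos, card_chordPos hn]; norm_num
  have hy' : y ∉ chordPos n (b - 1 + 1) := fun h' => disjoint_chordPos hn _ hy h'
  have hz' : z ∉ chordPos n (b - 1) := fun h' => disjoint_chordPos hn _ h' hz
  have hne : ∀ a : ZMod (n - 1 + n), a + 1 ≠ a := fun a e =>
    natCast_ne_zero (n := n) one_pos (by omega) (by rw [Nat.cast_one]; linear_combination e)
  refine ⟨{y, z}, hlast, h.card_inter_iff.mpr ⟨Or.inl ⟨?_, ?_⟩, Or.inl ⟨?_, ?_⟩, ?_⟩, ?_⟩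
  · rw [Finset.insert_inter_of_mem hy, Finset.singleton_inter_of_notMem hz', insert_empty_eq,
      Finset.card_singleton]
  · exact hother _ fun e => hne (b - 1) (by linear_combination -e)
  · rw [Finset.insert_inter_of_notMem hy', Finset.singleton_inter_of_mem hz, Finset.card_singleton]
  · exact hother _ (hne _)
  · intro i hi
    rcases Finset.mem_insert.mp hi with rfl | hi
    · exact Finset.mem_union_left _ hy
    · rw [Finset.mem_singleton.mp hi]; exact Finset.mem_union_right _ hz
  · refine Set.disjoint_of_subset_left (h.subFreezeCon_subset (S := {b - 1}) rfl ?_ ?_) ?_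
    · rintro _ rfl -
      exact ⟨z, by simp, hz⟩
    · rintro _ rfl -
      exact ⟨y, by simp, hy⟩
    · rw [Set.disjoint_left]
      rintro _ ⟨_, rfl, rfl⟩
      exact hlast

/-- If `n ≥ 4`, then nothing is con-close to an arc with `n + 1` members: only one position is frozen,
and the component has `n - 1` members, which is more than the complement of the arc has. -/
theorem not_conCloseVia (hn4 : 4 ≤ n) {b c : ZMod (n - 1 + n)} {Y : Finset (Fin (n - 1 + n))}
    (hY : ConCloseVia t 1 (arc ε b (n + 1)) (ε c) Y) : False := by
  have hn := h.three_le
  have : NeZero (n - 1 + n) := ⟨by omega⟩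
  have h2n := two_mul_natCast_pred hn
  have hend := h.eq_or_eq_of_conCloseVia (by omega) (by omega) hY
  obtain ⟨-, hY2, hY3⟩ := hY
  obtain ⟨h1, h2, h3⟩ := h.card_inter_iff.mp hY2
  -- the candidate follows the arc or precedes it; in both cases `n - 2` steps away from the arc lead to
  -- its opposite end, and none of them flips the frozen position
  rcases hend with ⟨rfl, -⟩ | ⟨rfl, -⟩
  · have hout : ε (b + ((n + 1 : ℕ) : ZMod (n - 1 + n)) + 1) ∉ arc ε b (n + 1) := by
      have e : b + ((n + 1 : ℕ) : ZMod (n - 1 + n)) + 1 - b = ((n + 2 : ℕ) : ZMod (n - 1 + n)) := by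
        push_cast; ring
      rw [h.mem_arc (by omega), e, ZMod.val_natCast_of_lt (by omega)]
      omega
    have h2' := (h2.resolve_left fun h' => hout h'.2).1
    have hYsub : ∀ y ∈ Y, y ∈ chordPos n (b + ((n + 1 : ℕ) : ZMod (n - 1 + n))) := by
      intro y hy
      rcases Finset.mem_union.mp (h3 hy) with h' | h'
      · exact h'
      · have := Finset.mem_inter.mpr ⟨hy, h'⟩
        rw [h2'] at this; simp at this
    have hmem := h.mem_subFreezeCon_add (c := b + ((n + 1 : ℕ) : ZMod (n - 1 + n))) (Y := Y) (n - 2)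
      (fun i hi => by
        rw [Finset.disjoint_left]
        intro y hy hy'
        have hy1 := hYsub y hy
        rw [mem_chordPos_iff] at hy1 hy'
        rcases hy1 with e1 | e1 <;> rcases hy' with e2 | e2
        · refine natCast_ne_zero (n := n) (v := i + 1) (by omega) (by omega) ?_
          push_cast; linear_combination e1 - e2
        · refine natCast_ne_zero (n := n) (v := n + i) (by omega) (by omega) ?_
          push_cast; linear_combination e1 - e2
        · refine natCast_ne_zero (n := n) (v := n - 2 - i) (by omega) (by omega) ?_
          rw [Nat.cast_sub (by omega), Nat.cast_sub (by omega)]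
          push_cast; linear_combination e2 - e1
        · refine natCast_ne_zero (n := n) (v := i + 1) (by omega) (by omega) ?_
          push_cast; linear_combination e1 - e2)
    refine Set.disjoint_left.mp hY3 hmem ?_
    have e : b + ((n + 1 : ℕ) : ZMod (n - 1 + n)) + ((n - 2 : ℕ) : ZMod (n - 1 + n)) = b := by
      rw [Nat.cast_sub (by omega)]; push_cast; linear_combination h2n
    rw [Finset.mem_coe, e, h.mem_arc (by omega), sub_self, ZMod.val_zero]
    omega
  · have hout : ε (b - 1 - 1) ∉ arc ε b (n + 1) := by
      rw [h.mem_arc (by omega), show b - 1 - 1 - b = 0 - 1 - 1 by ring, val_sub_one hn,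
        val_sub_one hn, if_pos (ZMod.val_zero), if_neg (by omega)]
      omega
    have h1' := (h1.resolve_left fun h' => hout h'.2).1
    have hYsub : ∀ y ∈ Y, y ∈ chordPos n (b - 1 + 1) := by
      intro y hy
      rcases Finset.mem_union.mp (h3 hy) with h' | h'
      · have := Finset.mem_inter.mpr ⟨hy, h'⟩
        rw [h1'] at this; simp at this
      · exact h'
    have hmem := h.mem_subFreezeCon_sub (c := b - 1) (Y := Y) (n - 2)
      (fun i hi => by
        rw [Finset.disjoint_left]
        intro y hy hy'
        have hy1 := hYsub y hy
        rw [mem_chordPos_iff] at hy1 hy'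
        rcases hy1 with e1 | e1 <;> rcases hy' with e2 | e2
        · refine natCast_ne_zero (n := n) (v := i + 1) (by omega) (by omega) ?_
          push_cast; linear_combination e2 - e1
        · refine natCast_ne_zero (n := n) (v := n - 2 - i) (by omega) (by omega) ?_
          rw [Nat.cast_sub (by omega), Nat.cast_sub (by omega)]
          push_cast; linear_combination e1 - e2
        · refine natCast_ne_zero (n := n) (v := n + i) (by omega) (by omega) ?_
          push_cast; linear_combination e2 - e1
        · refine natCast_ne_zero (n := n) (v := i + 1) (by omega) (by omega) ?_
          push_cast; linear_combination e2 - e1)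
    refine Set.disjoint_left.mp hY3 hmem ?_
    have e : b - 1 - ((n - 2 : ℕ) : ZMod (n - 1 + n)) - b = ((n : ℕ) : ZMod (n - 1 + n)) := by
      rw [Nat.cast_sub (by omega)]; push_cast; linear_combination -h2n
    rw [Finset.mem_coe, h.mem_arc (by omega), e, ZMod.val_natCast_of_lt (by omega)]
    omega

theorem family_succ_of_conCloseVia {k : ℕ} {P : LaurentPolynomial ℕ}
    (hP : (Φ, P) ∈ family t 1 k) {c : ZMod (n - 1 + n)} {Y : Finset (Fin (n - 1 + n))}
    (hY : ConCloseVia t 1 Φ (ε c) Y) (Φ' : Finset (Fin (n - 1 + n) → Bool))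
    (hΦ' : Φ' = (open Classical in insert (ε c) Φ)) : ∃ P', (Φ', P') ∈ family t 1 (k + 1) := by
  obtain ⟨d, hd⟩ := exists_conDist_eq hY
  exact ⟨_, Φ, P, hP, ε c, h.mem c, d, hd, by rw [hΦ']⟩

theorem exists_arc_mem_family {k : ℕ} (hk : k ≤ n + 1) :
    ∃ P, (arc ε 0 k, P) ∈ family t 1 k := by
  induction k with
  | zero => exact ⟨0, rfl⟩
  | succ k ih =>
    obtain ⟨P, hP⟩ := ih (by omega)
    have hY : ∃ Y, ConCloseVia t 1 (arc ε 0 k) (ε (0 + (k : ZMod (n - 1 + n)))) Y := by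
      rcases Nat.eq_zero_or_pos k with rfl | hk0
      · exact ⟨∅, h.conCloseVia_empty _⟩
      · exact h.exists_conCloseVia hk0 (by omega)
    obtain ⟨Y, hY⟩ := hY
    refine h.family_succ_of_conCloseVia hP hY _ ?_
    rw [← insert_arc_top]

/-- The sets stored by the algorithm up to step `n + 1` are arcs. -/
theorem exists_eq_arc {k : ℕ} (hk0 : 1 ≤ k) (hk : k ≤ n + 1)
    {P : LaurentPolynomial ℕ} (hP : (Φ, P) ∈ family t 1 k) : ∃ b, Φ = arc ε b k := by
  classical
  induction k, hk0 using Nat.le_induction generalizing Φ P with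
  | base =>
    obtain ⟨Φ', P', hP', δ, hδ, d, -, e⟩ := hP
    obtain ⟨rfl, rfl⟩ := Prod.mk.inj (Set.mem_singleton_iff.mp hP')
    obtain ⟨c, rfl⟩ := (h.mem_iff δ).mp hδ
    refine ⟨c, ?_⟩
    rw [(Prod.mk.inj e).1]
    ext x
    simp [arc]
  | succ k hk0 ih =>
    have hn := h.three_le
    obtain ⟨Φ', P', hP', δ, hδ, d, hd, e⟩ := hP
    obtain ⟨b, rfl⟩ := ih (by omega) hP'
    obtain ⟨c, rfl⟩ := (h.mem_iff δ).mp hδ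
    obtain ⟨Y, hY⟩ := exists_conCloseVia_of_conDist hd
    have e' : Φ = insert (ε c) (arc ε b k) := by
      rw [(Prod.mk.inj e).1]
    rcases h.eq_or_eq_of_conCloseVia hk0 (by omega) hY with ⟨rfl, -⟩ | ⟨rfl, -⟩
    · refine ⟨b, ?_⟩
      rw [e', ← insert_arc_top]
    · refine ⟨b - 1, ?_⟩
      rw [e', ← insert_arc_bot]

theorem stopsPrematurelyAt (hn4 : 4 ≤ n) : StopsPrematurelyAt t 1 (n + 1) := by
  refine ⟨?_, fun j hj => ?_, ?_⟩
  · rw [h.card_subTo]; omega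
  · obtain ⟨P, hP⟩ := h.exists_arc_mem_family hj
    exact ⟨_, hP⟩
  · rw [Set.eq_empty_iff_forall_notMem]
    rintro x ⟨Φ, P, hP, δ, hδ, d, hd, -⟩
    obtain ⟨b, rfl⟩ := h.exists_eq_arc (by omega) le_rfl hP
    obtain ⟨c, rfl⟩ := (h.mem_iff δ).mp hδ
    obtain ⟨Y, hY⟩ := exists_conCloseVia_of_conDist hd
    exact h.not_conCloseVia hn4 hY

theorem not_stopsPrematurelyAt (hn3 : n = 3) (j : ℕ) : ¬ StopsPrematurelyAt t 1 j := by
  rintro ⟨hj, -, hempty⟩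
  rw [h.card_subTo] at hj
  suffices hne : (family t 1 (j + 1)).Nonempty by
    rw [hempty] at hne
    exact Set.not_nonempty_empty hne
  rcases (show j ≤ n ∨ j = n + 1 by omega) with hj' | rfl
  · obtain ⟨P, hP⟩ := h.exists_arc_mem_family (show j + 1 ≤ n + 1 by omega)
    exact ⟨_, hP⟩
  · obtain ⟨P, hP⟩ := h.exists_arc_mem_family (le_refl (n + 1))
    obtain ⟨Y, hY⟩ := h.exists_conCloseVia_last 0
    rw [show n - 1 + n - 1 = n + 1 by omega] at hY
    obtain ⟨P', hP'⟩ := h.family_succ_of_conCloseVia hP hY _ rfl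
    exact ⟨_, hP'⟩

end IsSubCycle

/-! ### Homogeneous linear forms in a polynomial ring -/

noncomputable section

section LinearForms

variable {B : Type*}

theorem mem_symGr {d : ℤ} {x : MvPolynomial B ℝ} :
    x ∈ symGr B d ↔ MvPolynomial.IsWeightedHomogeneous (fun _ : B => (2 : ℤ)) x d := Iff.rfl

theorem toSym_mem_symGr (v : B →₀ ℝ) : toSym v ∈ symGr B 2 := by
  rw [toSym, Finsupp.linearCombination_apply, Finsupp.sum]
  refine AddSubgroup.sum_mem _ fun b _ => ?_
  rw [mem_symGr, MvPolynomial.smul_eq_C_mul]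
  exact (MvPolynomial.isWeightedHomogeneous_X ℝ _ b).C_mul _

theorem mul_mem_symGr {d e : ℤ} {x y : MvPolynomial B ℝ} (hx : x ∈ symGr B d)
    (hy : y ∈ symGr B e) : x * y ∈ symGr B (d + e) :=
  MvPolynomial.IsWeightedHomogeneous.mul hx hy

theorem toSym_injective : Function.Injective (toSym : (B →₀ ℝ) → MvPolynomial B ℝ) := by
  intro v w h
  ext b
  have := congrArg (MvPolynomial.coeff (Finsupp.single b 1)) h
  exact (MvPolynomial.coeff_sumSMulX v b).symm.trans (this.trans (MvPolynomial.coeff_sumSMulX w b))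

theorem toSym_ne_zero {v : B →₀ ℝ} (hv : v ≠ 0) : toSym v ≠ 0 := fun h =>
  hv (toSym_injective (h.trans (map_zero toSym).symm))

/-- A quotient of homogeneous polynomials is homogeneous. -/
theorem mem_symGr_of_mul_mem {d e : ℤ} {x y : MvPolynomial B ℝ} (hx0 : x ≠ 0) (hx : x ∈ symGr B d)
    (h : x * y ∈ symGr B (d + e)) : y ∈ symGr B e := by
  classical
  let _ := MvPolynomial.weightedGradedAlgebra ℝ (fun _ : B => (2 : ℤ))
  have key : ∀ j, j ≠ e → (DirectSum.decompose
      (MvPolynomial.weightedHomogeneousSubmodule ℝ (fun _ : B => (2 : ℤ))) y j :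
        MvPolynomial B ℝ) = 0 := by
    intro j hj
    have h1 := DirectSum.coe_decompose_mul_add_of_left_mem (b := y) (j := j)
      (MvPolynomial.weightedHomogeneousSubmodule ℝ (fun _ : B => (2 : ℤ))) hx
    rw [DirectSum.decompose_of_mem_ne
      (MvPolynomial.weightedHomogeneousSubmodule ℝ (fun _ : B => (2 : ℤ))) h
      (by simpa using hj.symm)] at h1
    exact (mul_eq_zero.mp h1.symm).resolve_left hx0
  rw [← DirectSum.sum_support_decompose
    (MvPolynomial.weightedHomogeneousSubmodule ℝ (fun _ : B => (2 : ℤ))) y]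
  refine AddSubgroup.sum_mem _ fun j _ => ?_
  by_cases hj : j = e
  · rw [← hj]; exact SetLike.coe_mem _
  · rw [key j hj]; exact AddSubgroup.zero_mem _

theorem toSym_prime {v : B →₀ ℝ} (hv : v ≠ 0) : Prime (toSym v) := by
  obtain ⟨b, hb⟩ := Finsupp.support_nonempty_iff.mpr hv
  refine (MvPolynomial.irreducible_sumSMulX v ⟨b, hb⟩ fun r hr => ?_).prime
  refine isUnit_iff_ne_zero.mpr fun h0 => ?_
  have := hr b
  rw [h0, zero_dvd_iff] at this
  exact Finsupp.mem_support_iff.mp hb this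

theorem toSym_not_dvd {v w : B →₀ ℝ} (h : LinearIndependent ℝ ![v, w]) :
    ¬ toSym w ∣ toSym v := by
  have hv : v ≠ 0 := h.ne_zero 0
  have hw : w ≠ 0 := h.ne_zero 1
  intro hdvd
  obtain ⟨c, hc⟩ := (toSym_prime hw).associated_of_dvd (toSym_prime hv) hdvd
  obtain ⟨r, -, hr⟩ := MvPolynomial.isUnit_iff_eq_C_of_isReduced.mp c.isUnit
  have e : v = r • w := by
    apply toSym_injective
    rw [← hc, hr, map_smul, MvPolynomial.smul_eq_C_mul, mul_comm]
  have h2 := LinearIndependent.pair_iff.mp h 1 (-r) (by rw [e]; module)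
  exact one_ne_zero h2.1

end LinearForms

/-! ### Isomorphisms of graded modules -/

section GradedIsoLemmas

variable {A : Type*} [CommRing A] {N N' N'' : Type*} [AddCommGroup N] [Module A N]
  [AddCommGroup N'] [Module A N'] [AddCommGroup N''] [Module A N'']
  {𝒩 : ℤ → AddSubgroup N} {𝒩' : ℤ → AddSubgroup N'} {𝒩'' : ℤ → AddSubgroup N''}

theorem GradedIso.symm (h : GradedIso A 𝒩 𝒩') : GradedIso A 𝒩' 𝒩 := by
  obtain ⟨e, he⟩ := h
  exact ⟨e.symm, fun d x => by rw [he, e.apply_symm_apply]⟩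

theorem GradedIso.trans (h : GradedIso A 𝒩 𝒩') (h' : GradedIso A 𝒩' 𝒩'') : GradedIso A 𝒩 𝒩'' := by
  obtain ⟨e, he⟩ := h
  obtain ⟨e', he'⟩ := h'
  exact ⟨e.trans e', fun d x => by rw [he, he']; rfl⟩

theorem GradedIso.refl : GradedIso A 𝒩 𝒩 := ⟨LinearEquiv.refl A N, fun _ _ => Iff.rfl⟩

theorem GradedIso.prod {P P' : Type*} [AddCommGroup P] [Module A P] [AddCommGroup P'] [Module A P']
    {𝒬 : ℤ → AddSubgroup P} {𝒬' : ℤ → AddSubgroup P'} (h : GradedIso A 𝒩 𝒩')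
    (h' : GradedIso A 𝒬 𝒬') : GradedIso A (prodGr 𝒩 𝒬) (prodGr 𝒩' 𝒬') := by
  obtain ⟨e, he⟩ := h
  obtain ⟨e', he'⟩ := h'
  exact ⟨e.prodCongr e', fun d x => and_congr (he d x.1) (he' d x.2)⟩

end GradedIsoLemmas

/-! ### The module of a cycle -/

/-- The functions on the vertices of a cycle of length `m` whose differences along the edge from `a`
to `a + 1` are divisible by the label `L (a + 1)`. -/
def cycleModule {A : Type*} [CommRing A] {m : ℕ} (L : ZMod m → A) : Submodule A (ZMod m → A) where
  carrier := {f | ∀ a, L (a + 1) ∣ f a - f (a + 1)}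
  zero_mem' := by simp
  add_mem' := by
    intro f g hf hg a
    have := dvd_add (hf a) (hg a)
    rwa [sub_add_sub_comm] at this
  smul_mem' := by
    intro c f hf a
    have := Dvd.dvd.mul_left (hf a) c
    rwa [mul_sub] at this

section EvenSum

variable {W : Type*} [Group W] {m : ℕ} {A : Type*} [CommRing A]

theorem valueAt_of_mem {t : Fin m → W} {w : W} {g : subTo t w → A} {δ : Fin m → Bool}
    (hδ : δ ∈ subTo t w) : valueAt t w g δ = g ⟨δ, hδ⟩ := dif_pos hδ

theorem evenSum_pair (t : Fin m → W) (w : W) (δ : Fin m → Bool) {lo hi : Fin m} (h : lo < hi)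
    (g : subTo t w → A) :
    evenSum t w δ {lo, hi} g = valueAt t w g δ - valueAt t w g (fold {lo, hi} δ) := by
  classical
  have hne := h.ne
  have e1 : (({lo, hi} : Finset (Fin m)).powerset.filter fun Y => Even Y.card) =
      {∅, {lo, hi}} := by
    ext Y
    simp only [Finset.mem_filter, Finset.mem_powerset, Finset.mem_insert, Finset.mem_singleton]
    constructor
    · rintro ⟨hY, heven⟩
      have hc := Finset.card_le_card hY
      rw [Finset.card_pair hne] at hc
      rcases Nat.eq_zero_or_pos Y.card with h0 | h0
      · exact Or.inl (Finset.card_eq_zero.mp h0)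
      · right
        refine Finset.eq_of_subset_of_card_le hY ?_
        rw [Finset.card_pair hne]
        obtain ⟨k, hk⟩ := heven
        omega
    · rintro (rfl | rfl)
      · simp
      · exact ⟨subset_rfl, by rw [Finset.card_pair hne]; exact even_two⟩
  have hne' : (∅ : Finset (Fin m)) ≠ {lo, hi} := fun e => by
    have := congrArg Finset.card e
    rw [Finset.card_pair hne] at this
    simp at this
  have e2 : relCard (∅ : Finset (Fin m)) {lo, hi} = 0 := by simp [relCard]
  -- the position `hi` is the first one counted decreasingly, and `lo` is the second one
  have e3 : relCard ({lo, hi} : Finset (Fin m)) {lo, hi} = 1 := by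
    have f1 : (({lo, hi} : Finset (Fin m)).filter fun x => lo ≤ x) = {lo, hi} := by
      rw [Finset.filter_eq_self]
      intro x hx
      rcases Finset.mem_insert.mp hx with rfl | hx
      · exact le_rfl
      · rw [Finset.mem_singleton.mp hx]; exact h.le
    have f2 : (({lo, hi} : Finset (Fin m)).filter fun x => hi ≤ x) = {hi} := by
      ext x
      simp only [Finset.mem_filter, Finset.mem_insert, Finset.mem_singleton]
      constructor
      · rintro ⟨rfl | rfl, hx⟩
        · exact absurd h (not_lt.mpr hx)
        · rfl
      · rintro rfl
        exact ⟨Or.inr rfl, le_rfl⟩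
    rw [relCard, Finset.filter_insert, f1, Finset.card_pair hne, if_neg (by decide),
      Finset.filter_singleton, f2, Finset.card_singleton, if_pos odd_one, Finset.card_singleton]
  rw [evenSum, e1, Finset.sum_pair hne', e2, e3, fold_empty]
  ring

end EvenSum

namespace IsSubCycle

variable {W : Type*} [Group W] {n : ℕ} {t : Fin (n - 1 + n) → W}
  {ε : ZMod (n - 1 + n) → Fin (n - 1 + n) → Bool} {ρ : ZMod (n - 1 + n) → W}
  (h : IsSubCycle t ε ρ) {A : Type*} [CommRing A]

include h

/-- Only the two chords of `ε a` give non-trivial divisibility conditions at `ε a`. -/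
theorem mem_moduleX_iff (β : W → A) (g : subTo t 1 → A) :
    g ∈ moduleX β t 1 ↔
      ∀ a, β (ρ (a + 1)) ∣ g ⟨ε a, h.mem a⟩ - g ⟨ε (a + 1), h.mem (a + 1)⟩ := by
  have hn := h.three_le
  have hsum : ∀ a, evenSum t 1 (ε a) (chordPos n (a + 1)) g =
      g ⟨ε a, h.mem a⟩ - g ⟨ε (a + 1), h.mem (a + 1)⟩ := by
    intro a
    obtain ⟨lo, hi, hlt, he, -⟩ := exists_chordPos_succ hn a
    rw [he, evenSum_pair t 1 _ hlt g, ← he, ← h.succ, valueAt_of_mem (h.mem a),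
      valueAt_of_mem (h.mem (a + 1))]
  have hsum' : ∀ a, evenSum t 1 (ε (a + 1)) (chordPos n (a + 1)) g =
      g ⟨ε (a + 1), h.mem (a + 1)⟩ - g ⟨ε a, h.mem a⟩ := by
    intro a
    obtain ⟨lo, hi, hlt, he, -⟩ := exists_chordPos_succ hn a
    have hp := h.pred (a + 1)
    rw [add_sub_cancel_right] at hp
    rw [he, evenSum_pair t 1 _ hlt g, ← he, ← hp, valueAt_of_mem (h.mem a),
      valueAt_of_mem (h.mem (a + 1))]
  constructor
  · intro hg a
    have := hg (ε a) (h.mem a) (ρ (a + 1)) (chordPos n (a + 1)) (by rw [h.posOf_right])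
      (by rw [← Finset.card_pos, card_chordPos hn]; norm_num)
    rwa [card_chordPos hn, pow_one, hsum] at this
  · intro hg δ hδ p X hX hX0
    obtain ⟨a, rfl⟩ := (h.mem_iff δ).mp hδ
    have h0 := Finset.card_pos.mpr hX0
    have hle := Finset.card_le_card hX
    rcases (show X.card = 1 ∨ 2 ≤ X.card by omega) with h1 | h2
    · rw [h1, Nat.sub_self, pow_zero]; exact one_dvd _
    by_cases e1 : p = ρ a
    · rw [e1, h.posOf_left] at hX
      have hX' := Finset.eq_of_subset_of_card_le hX (by rw [card_chordPos hn]; omega)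
      have e := hsum' (a - 1)
      have hd := hg (a - 1)
      simp only [sub_add_cancel] at e hd
      rw [hX', e, card_chordPos hn, pow_one, e1, dvd_sub_comm]
      exact hd
    by_cases e2 : p = ρ (a + 1)
    · rw [e2, h.posOf_right] at hX
      have hX' := Finset.eq_of_subset_of_card_le hX (by rw [card_chordPos hn]; omega)
      rw [hX', hsum, card_chordPos hn, pow_one, e2]
      exact hg a
    have := h.posOf_other a p e1 e2
    omega

theorem gradedIso_cycleModule (β : W → A) (𝒜 : ℤ → AddSubgroup A) :
    GradedIso A (subGr (powGr (subTo t 1) 𝒜) (moduleX β t 1))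
      (subGr (powGr (ZMod (n - 1 + n)) 𝒜) (cycleModule fun a => β (ρ a))) := by
  let σ : ZMod (n - 1 + n) ≃ subTo t 1 := Equiv.ofBijective (fun a => ⟨ε a, h.mem a⟩)
    ⟨fun a b e => h.injective (congrArg Subtype.val e), fun δ => by
      obtain ⟨a, ha⟩ := (h.mem_iff δ.1).mp δ.2
      exact ⟨a, Subtype.ext ha⟩⟩
  let F : (subTo t 1 → A) ≃ₗ[A] (ZMod (n - 1 + n) → A) := LinearEquiv.funCongrLeft A A σ
  have hF : (moduleX β t 1).map (F : (subTo t 1 → A) →ₗ[A] _) = cycleModule fun a => β (ρ a) := by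
    ext f
    rw [Submodule.mem_map_equiv, h.mem_moduleX_iff]
    refine forall_congr' fun a => ?_
    have e : ∀ b, (F.symm f) ⟨ε b, h.mem b⟩ = f b := fun b =>
      congrArg f (σ.symm_apply_apply b)
    rw [e, e]
  refine ⟨(F.submoduleMap (moduleX β t 1)).trans (LinearEquiv.ofEq _ _ hF), fun d x => ?_⟩
  simp only [subGr, powGr, AddSubgroup.mem_comap, AddSubgroup.mem_pi, Set.mem_univ, true_imp_iff]
  constructor
  · intro hx a
    exact hx (σ a)
  · intro hx δ
    obtain ⟨a, rfl⟩ := σ.surjective δ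
    exact hx a

end IsSubCycle

/-! ### Splitting off free summands -/

section Splitting

variable {B : Type*} {n : ℕ}

/-- A sequence of length `n - 2`, shifted by one place and extended by `0`. -/
def padded {A : Type*} [Zero A] (s : Fin (n - 3 + 1) → A) (j : ℕ) : A :=
  if h : 1 ≤ j ∧ j - 1 < n - 3 + 1 then s ⟨j - 1, h.2⟩ else 0

theorem padded_zero {A : Type*} [Zero A] (s : Fin (n - 3 + 1) → A) : padded s 0 = 0 :=
  dif_neg (by omega)

theorem padded_succ {A : Type*} [Zero A] (s : Fin (n - 3 + 1) → A) (j : Fin (n - 3 + 1)) :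
    padded s (j + 1) = s j := by
  rw [padded, dif_pos ⟨by omega, by omega⟩]
  rfl

theorem padded_of_ge {A : Type*} [Zero A] (hn : 3 ≤ n) (s : Fin (n - 3 + 1) → A) {j : ℕ}
    (hj : n - 1 ≤ j) : padded s j = 0 := dif_neg (by omega)

/-- A string is a sequence that starts and ends with `0` and has differences divisible by the labels. -/
theorem mem_stringModule_iff {A : Type*} [CommRing A] (hn : 3 ≤ n) (x : ℕ → A)
    (s : Fin (n - 3 + 1) → A) :
    (s ∈ stringModule fun j : Fin (n - 3 + 2) => x j) ↔
      ∀ j < n - 1, x j ∣ padded s (j + 1) - padded s j := by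
  have e0 : padded s 0 = 0 := padded_zero s
  have e1 : padded s 1 = s 0 := padded_succ s 0
  have e2 : padded s (n - 1) = 0 := padded_of_ge hn s le_rfl
  have e3 : padded s (n - 2) = s (Fin.last (n - 3)) := by
    have := padded_succ s (Fin.last (n - 3))
    rwa [Fin.val_last, show n - 3 + 1 = n - 2 by omega] at this
  constructor
  · rintro ⟨h1, h2, h3⟩ j hj
    rcases Nat.eq_zero_or_pos j with rfl | hj0
    · rw [e0, e1, sub_zero]; exact h1
    rcases (show j = n - 2 ∨ j < n - 2 by omega) with rfl | hj2
    · rw [show n - 2 + 1 = n - 1 by omega, e2, e3, zero_sub, dvd_neg]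
      dsimp only at h2
      rw [Fin.val_last, show n - 3 + 1 = n - 2 by omega] at h2
      exact h2
    · have h := h3 ⟨j - 1, by omega⟩
      rw [← padded_succ s (Fin.succ _), ← padded_succ s (Fin.castSucc _)] at h
      simpa [Nat.sub_add_cancel hj0] using h
  · intro h
    refine ⟨?_, ?_, fun i => ?_⟩
    · have := h 0 (by omega)
      rwa [zero_add, e0, e1, sub_zero] at this
    · have := h (n - 2) (by omega)
      rw [show n - 2 + 1 = n - 1 by omega, e2, e3, zero_sub, dvd_neg] at this
      dsimp only
      rwa [Fin.val_last, show n - 3 + 1 = n - 2 by omega]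
    · have := h (i + 1) (by omega)
      rw [← padded_succ s i.succ, ← padded_succ s i.castSucc]
      simpa using this

variable (y : ℕ → MvPolynomial B ℝ) (C : Fin n → ℕ → ℝ)

/-- The sum of the steps, up to the place `j`, that compensate the jumps `u q * y (n - 1 + q)`; it is spread
over the first `n - 1` edges by means of the relations `y (n - 1 + q) = ∑ i, C q i * y i`. -/
def compensation (u : Fin n → MvPolynomial B ℝ) (j : ℕ) : MvPolynomial B ℝ :=
  ∑ i ∈ Finset.range (min j (n - 1)), ∑ q, u q * (MvPolynomial.C (C q i) * y i)

/-- The sum of the jumps `u q * y (n - 1 + q)` up to the place `j`. -/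
def jumps (u : Fin n → MvPolynomial B ℝ) (j : ℕ) : MvPolynomial B ℝ :=
  ∑ q : Fin n, if n - 1 + q < j then u q * y (n - 1 + q) else 0

theorem compensation_succ (u : Fin n → MvPolynomial B ℝ) {j : ℕ} (hj : j < n - 1) :
    compensation y C u (j + 1) =
      compensation y C u j + (∑ q, u q * MvPolynomial.C (C q j)) * y j := by
  rw [compensation, compensation, Nat.min_eq_left (by omega), Nat.min_eq_left (by omega),
    Finset.sum_range_succ, Finset.sum_mul]
  simp only [mul_assoc]

theorem compensation_of_ge (u : Fin n → MvPolynomial B ℝ) {j : ℕ} (hj : n - 1 ≤ j) :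
    compensation y C u j = compensation y C u (n - 1) := by
  rw [compensation, compensation, Nat.min_eq_right hj, Nat.min_self]

theorem jumps_of_le (u : Fin n → MvPolynomial B ℝ) {j : ℕ} (hj : j ≤ n - 1) :
    jumps y u j = 0 :=
  Finset.sum_eq_zero fun q _ => if_neg (by omega)

theorem jumps_succ (u : Fin n → MvPolynomial B ℝ) (q : Fin n) :
    jumps y u (n - 1 + q + 1) = jumps y u (n - 1 + q) + u q * y (n - 1 + q) := by
  have e : u q * y (n - 1 + q) =
      ∑ p : Fin n, if p = q then u p * y (n - 1 + p) else 0 := by simp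
  rw [jumps, jumps, e, ← Finset.sum_add_distrib]
  refine Finset.sum_congr rfl fun p _ => ?_
  rcases lt_trichotomy p q with h | h | h
  · rw [if_pos (by omega), if_pos (by omega), if_neg h.ne, add_zero]
  · rw [if_pos (by omega), if_neg (by omega), if_pos h, zero_add]
  · rw [if_neg (by omega), if_neg (by omega), if_neg h.ne', add_zero]

/-- The compensation is chosen so that the function closes up after one turn around the cycle. -/
theorem jumps_last (hy : ∀ q : Fin n, y (n - 1 + q) =
      ∑ i ∈ Finset.range (n - 1), MvPolynomial.C (C q i) * y i) (u : Fin n → MvPolynomial B ℝ) :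
    jumps y u (n - 1 + n) = compensation y C u (n - 1) := by
  rw [jumps, compensation, Nat.min_self, Finset.sum_comm]
  refine Finset.sum_congr rfl fun q _ => ?_
  rw [if_pos (by omega), hy, Finset.mul_sum]

/-- The function on the places `0, …, 2n - 1` with the initial value `c`, the given jumps and the given
string. -/
def splitFun (c : MvPolynomial B ℝ) (u : Fin n → MvPolynomial B ℝ)
    (s : Fin (n - 3 + 1) → MvPolynomial B ℝ) (j : ℕ) : MvPolynomial B ℝ :=
  c + padded s j - compensation y C u j + jumps y u j

variable {y C} {c : MvPolynomial B ℝ} {u : Fin n → MvPolynomial B ℝ}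
  {s : Fin (n - 3 + 1) → MvPolynomial B ℝ}

theorem splitFun_zero : splitFun y C c u s 0 = c := by
  rw [splitFun, padded_zero, jumps_of_le y u (by omega)]
  simp [compensation]

theorem splitFun_succ {j : ℕ} (hj : j < n - 1) :
    splitFun y C c u s (j + 1) - splitFun y C c u s j =
      padded s (j + 1) - padded s j - (∑ q, u q * MvPolynomial.C (C q j)) * y j := by
  rw [splitFun, splitFun, compensation_succ y C u hj, jumps_of_le y u (by omega),
    jumps_of_le y u (by omega)]
  ring

theorem splitFun_jump (hn : 3 ≤ n) (q : Fin n) :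
    splitFun y C c u s (n - 1 + q + 1) - splitFun y C c u s (n - 1 + q) =
      u q * y (n - 1 + q) := by
  rw [splitFun, splitFun, jumps_succ, compensation_of_ge y C u (j := n - 1 + q + 1) (by omega),
    compensation_of_ge y C u (j := n - 1 + q) (by omega), padded_of_ge hn s (by omega),
    padded_of_ge hn s (by omega)]
  ring

theorem splitFun_last (hn : 3 ≤ n) (hy : ∀ q : Fin n, y (n - 1 + q) =
      ∑ i ∈ Finset.range (n - 1), MvPolynomial.C (C q i) * y i) :
    splitFun y C c u s (n - 1 + n) = c := by
  rw [splitFun, jumps_last y C hy, compensation_of_ge y C u (by omega),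
    padded_of_ge hn s (by omega)]
  ring

theorem dvd_splitFun (hn : 3 ≤ n) (hs : s ∈ stringModule fun j : Fin (n - 3 + 2) => y j) {j : ℕ}
    (hj : j < n - 1 + n) : y j ∣ splitFun y C c u s (j + 1) - splitFun y C c u s j := by
  rcases Nat.lt_or_ge j (n - 1) with h | h
  · rw [splitFun_succ h]
    exact dvd_sub ((mem_stringModule_iff hn y s).mp hs j h) (Dvd.intro_left _ rfl)
  · have := splitFun_jump (y := y) (C := C) (c := c) (u := u) (s := s) hn ⟨j - (n - 1), by omega⟩
    simp only [Nat.add_sub_cancel' h] at this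
    rw [this]
    exact Dvd.intro_left _ rfl

variable (y C) in
/-- The isomorphism of the splitting as a linear map to all functions on the cycle; the place `0` is
the vertex `a - 1`. -/
def splitMap (a : ZMod (n - 1 + n)) :
    (MvPolynomial B ℝ × ((Fin n → MvPolynomial B ℝ) ×
      stringModule fun j : Fin (n - 3 + 2) => y j)) →ₗ[MvPolynomial B ℝ]
    (ZMod (n - 1 + n) → MvPolynomial B ℝ) where
  toFun x z := splitFun y C x.1 x.2.1 x.2.2 (z - (a - 1)).val
  map_add' x x' := by
    funext z
    have e : ∀ j, padded (x.2.2.1 + x'.2.2.1) j = padded x.2.2.1 j + padded x'.2.2.1 j := by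
      intro j
      unfold padded
      split_ifs <;> simp
    simp only [splitFun, Prod.fst_add, Prod.snd_add, Submodule.coe_add, e, Pi.add_apply, compensation,
      jumps, add_mul, Finset.sum_add_distrib, ite_add_zero]
    ring
  map_smul' r x := by
    funext z
    have e : ∀ j, padded (r • x.2.2.1) j = r * padded x.2.2.1 j := by
      intro j
      unfold padded
      split_ifs <;> simp
    simp only [splitFun, Prod.smul_fst, Prod.smul_snd, Submodule.coe_smul, e, Pi.smul_apply,
      compensation, jumps, smul_eq_mul, mul_assoc, ← Finset.mul_sum, RingHom.id_apply, ← mul_ite_zero]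
    ring

theorem splitMap_apply (hn : 3 ≤ n) (hy : ∀ q : Fin n, y (n - 1 + q) =
      ∑ i ∈ Finset.range (n - 1), MvPolynomial.C (C q i) * y i) (a : ZMod (n - 1 + n))
    (x : MvPolynomial B ℝ × ((Fin n → MvPolynomial B ℝ) ×
      stringModule fun j : Fin (n - 3 + 2) => y j)) {j : ℕ} (hj : j ≤ n - 1 + n) :
    splitMap y C a x (a - 1 + j) = splitFun y C x.1 x.2.1 x.2.2 j := by
  change splitFun y C x.1 x.2.1 x.2.2 (a - 1 + (j : ZMod (n - 1 + n)) - (a - 1)).val = _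
  rw [add_sub_cancel_left]
  rcases (show j < n - 1 + n ∨ j = n - 1 + n by omega) with h | rfl
  · rw [ZMod.val_natCast_of_lt h]
  · rw [ZMod.natCast_self, ZMod.val_zero, splitFun_zero, splitFun_last hn hy]

theorem exists_natCast_eq (hn : 3 ≤ n) (a z : ZMod (n - 1 + n)) :
    ∃ j < n - 1 + n, z = a - 1 + (j : ℕ) := by
  have : NeZero (n - 1 + n) := ⟨by omega⟩
  exact ⟨(z - (a - 1)).val, ZMod.val_lt _, by rw [ZMod.natCast_zmod_val]; ring⟩

/-- If the labels of a cycle are linear forms and each of them is a linear combination of `n - 1`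
consecutive ones, then the functions on the cycle are described by the value at a vertex, the quotients
of `n` differences by the labels, and a string for the `n - 1` consecutive labels. -/
theorem gradedIso_split (hn : 3 ≤ n) {v : ZMod (n - 1 + n) → (B →₀ ℝ)} (hv : ∀ a, v a ≠ 0)
    (a : ZMod (n - 1 + n))
    (hspan : ∀ b, v b ∈ Submodule.span ℝ (Set.range fun j : Fin (n - 1) =>
      v ((j : ℕ) + a))) :
    GradedIso (MvPolynomial B ℝ)
      (subGr (powGr (ZMod (n - 1 + n)) (symGr B)) (cycleModule fun b => toSym (v b)))
      (prodGr (symGr B) (prodGr (powGr (Fin n) (shiftGr (symGr B) (-2)))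
        (subGr (powGr (Fin (n - 3 + 1)) (symGr B))
          (stringModule fun j : Fin (n - 3 + 2) => toSym (v ((j : ℕ) + a)))))) := by
  have : NeZero (n - 1 + n) := ⟨by omega⟩
  set y : ℕ → MvPolynomial B ℝ := fun j => toSym (v (j + a)) with hydef
  have hcoef : ∀ q : Fin n, ∃ c : ℕ → ℝ, y (n - 1 + q) =
      ∑ i ∈ Finset.range (n - 1), MvPolynomial.C (c i) * y i := by
    intro q
    obtain ⟨c, hc⟩ := (Submodule.mem_span_range_iff_exists_fun ℝ).mp
      (hspan (((n - 1 + q : ℕ) : ZMod (n - 1 + n)) + a))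
    refine ⟨fun i => if h : i < n - 1 then c ⟨i, h⟩ else 0, ?_⟩
    simp only [hydef]
    rw [← hc, map_sum, ← Fin.sum_univ_eq_sum_range (fun i => MvPolynomial.C
      (if h : i < n - 1 then c ⟨i, h⟩ else 0) * toSym (v (((i : ℕ) : ZMod (n - 1 + n)) + a)))]
    refine Finset.sum_congr rfl fun i _ => ?_
    rw [map_smul, MvPolynomial.smul_eq_C_mul, dif_pos i.isLt]
  choose C hy using hcoef
  have hy0 : ∀ j, y j ≠ 0 := fun j => toSym_ne_zero (hv _)
  have hy2 : ∀ j, y j ∈ symGr B 2 := fun j => toSym_mem_symGr _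
  have hmem : ∀ x, splitMap y C a x ∈ cycleModule fun b => toSym (v b) := by
    intro x b
    obtain ⟨j, hj, rfl⟩ := exists_natCast_eq hn a b
    have e : a - 1 + (j : ZMod (n - 1 + n)) + 1 = a - 1 + ((j + 1 : ℕ) : ZMod (n - 1 + n)) := by
      push_cast; ring
    have e' : a - 1 + ((j + 1 : ℕ) : ZMod (n - 1 + n)) = j + a := by push_cast; ring
    rw [e, splitMap_apply hn hy a x (by omega), splitMap_apply hn hy a x (by omega), dvd_sub_comm,
      e']
    exact dvd_splitFun hn x.2.2.2 hj
  let Ψ := (splitMap y C a).codRestrict _ hmem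
  -- the components of `x` are recovered from the values of `splitMap y C a x`
  have hval : ∀ x, ∀ j ≤ n - 1 + n, (Ψ x).1 (a - 1 + (j : ℕ)) =
      splitFun y C x.1 x.2.1 x.2.2 j := fun x j hj => splitMap_apply hn hy a x hj
  have hgr : ∀ (d : ℤ) x, Ψ x ∈ subGr (powGr (ZMod (n - 1 + n)) (symGr B))
      (cycleModule fun b => toSym (v b)) d ↔
      x ∈ prodGr (symGr B) (prodGr (powGr (Fin n) (shiftGr (symGr B) (-2)))
        (subGr (powGr (Fin (n - 3 + 1)) (symGr B))
          (stringModule fun j : Fin (n - 3 + 2) => y j))) d := by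
    intro d x
    have hcomp : (∀ q, x.2.1 q ∈ symGr B (-2 + d)) → ∀ j, compensation y C x.2.1 j ∈ symGr B d := by
      intro hu j
      refine AddSubgroup.sum_mem _ fun i _ => AddSubgroup.sum_mem _ fun q _ => ?_
      have := mul_mem_symGr (hu q) (mul_mem_symGr
        (MvPolynomial.isWeightedHomogeneous_C (fun _ : B => (2 : ℤ)) (C q i)) (hy2 i))
      rwa [show -2 + d + (0 + 2) = d by ring] at this
    have hjump : (∀ q, x.2.1 q ∈ symGr B (-2 + d)) → ∀ j, jumps y x.2.1 j ∈ symGr B d := by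
      intro hu j
      refine AddSubgroup.sum_mem _ fun q _ => ?_
      split_ifs
      · have := mul_mem_symGr (hu q) (hy2 (n - 1 + q))
        rwa [show -2 + d + 2 = d by ring] at this
      · exact AddSubgroup.zero_mem _
    have hL : Ψ x ∈ subGr (powGr (ZMod (n - 1 + n)) (symGr B))
        (cycleModule fun b => toSym (v b)) d ↔
        ∀ j ≤ n - 1 + n, splitFun y C x.1 x.2.1 x.2.2 j ∈ symGr B d := by
      simp only [subGr, powGr, AddSubgroup.mem_comap, AddSubgroup.mem_pi, Set.mem_univ, true_imp_iff]
      constructor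
      · intro H j hj
        rw [← hval x j hj]
        exact H _
      · intro H z
        obtain ⟨j, hj, rfl⟩ := exists_natCast_eq hn a z
        have := H j hj.le
        rwa [← hval x j hj.le] at this
    have hR : x ∈ prodGr (symGr B) (prodGr (powGr (Fin n) (shiftGr (symGr B) (-2)))
        (subGr (powGr (Fin (n - 3 + 1)) (symGr B))
          (stringModule fun j : Fin (n - 3 + 2) => y j))) d ↔
        x.1 ∈ symGr B d ∧ (∀ q, x.2.1 q ∈ symGr B (-2 + d)) ∧ ∀ i, x.2.2.1 i ∈ symGr B d := by
      simp only [prodGr, subGr, powGr, shiftGr, AddSubgroup.mem_prod, AddSubgroup.mem_comap,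
        AddSubgroup.mem_pi, Set.mem_univ, true_imp_iff]
      rfl
    rw [hL, hR]
    constructor
    · intro H
      have h1 : x.1 ∈ symGr B d := by
        have := H 0 (by omega)
        rwa [splitFun_zero] at this
      have h2 : ∀ q, x.2.1 q ∈ symGr B (-2 + d) := by
        intro q
        refine mem_symGr_of_mul_mem (hy0 (n - 1 + q)) (hy2 _) ?_
        rw [mul_comm, ← splitFun_jump (C := C) (c := x.1) (s := x.2.2.1) hn q,
          show 2 + (-2 + d) = d by ring]
        exact AddSubgroup.sub_mem _ (H _ (by omega)) (H _ (by omega))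
      refine ⟨h1, h2, fun i => ?_⟩
      have e := H (i + 1) (by omega)
      rw [splitFun, padded_succ] at e
      have e2 := AddSubgroup.sub_mem _ (AddSubgroup.add_mem _ (AddSubgroup.sub_mem _ e
        (hjump h2 (i + 1))) (hcomp h2 (i + 1))) h1
      convert e2 using 1
      ring
    · rintro ⟨h1, h2, h3⟩ j -
      refine AddSubgroup.add_mem _ (AddSubgroup.sub_mem _ (AddSubgroup.add_mem _ h1 ?_)
        (hcomp h2 j)) (hjump h2 j)
      unfold padded
      split_ifs
      · exact h3 _
      · exact AddSubgroup.zero_mem _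
  have hinj : Function.Injective Ψ := by
    rw [← LinearMap.ker_eq_bot, LinearMap.ker_eq_bot']
    intro x hx
    have H : ∀ j ≤ n - 1 + n, splitFun y C x.1 x.2.1 x.2.2 j = 0 := by
      intro j hj
      rw [← hval x j hj, hx]
      rfl
    have h1 : x.1 = 0 := by
      rw [← H 0 (by omega), splitFun_zero]
    have h2 : x.2.1 = 0 := by
      funext q
      have := splitFun_jump (y := y) (C := C) (c := x.1) (u := x.2.1) (s := x.2.2.1) hn q
      rw [H _ (by omega), H _ (by omega), sub_zero] at this
      exact (mul_eq_zero.mp this.symm).resolve_right (hy0 _)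
    have h3 : x.2.2 = 0 := by
      apply Subtype.ext
      funext i
      have := H (i + 1) (by omega)
      rw [splitFun, padded_succ, h1, h2] at this
      simpa [compensation, jumps] using this
    exact Prod.ext h1 (Prod.ext h2 h3)
  have hsurj : Function.Surjective Ψ := by
    rintro ⟨f, hf⟩
    -- the jumps are the quotients of the last `n` differences of `f` by the labels
    have hstep : ∀ j : ℕ, y j ∣ f (a - 1 + ((j + 1 : ℕ) : ZMod (n - 1 + n))) - f (a - 1 + j) := by
      intro j
      have := hf (a - 1 + j)
      have e : a - 1 + (j : ZMod (n - 1 + n)) + 1 = a - 1 + ((j + 1 : ℕ) : ZMod (n - 1 + n)) := by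
        push_cast; ring
      have e' : a - 1 + ((j + 1 : ℕ) : ZMod (n - 1 + n)) = j + a := by push_cast; ring
      rw [dvd_sub_comm, e] at this
      have e2 : y j = toSym (v (a - 1 + ((j + 1 : ℕ) : ZMod (n - 1 + n)))) := by rw [e']
      rw [e2]
      exact this
    choose w hw using hstep
    set u : Fin n → MvPolynomial B ℝ := fun q => w (n - 1 + q) with hu
    -- the string is what remains on the places `0, …, n - 1`; it ends with `0` since `f` closes up
    set S : ℕ → MvPolynomial B ℝ := fun j => f (a - 1 + (j : ℕ)) - f (a - 1) +
      compensation y C u j with hS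
    have hS0 : S 0 = 0 := by simp [hS, compensation]
    have hSlast : S (n - 1) = 0 := by
      have hj : ∀ p ≤ n, jumps y u (n - 1 + p) =
          f (a - 1 + ((n - 1 + p : ℕ) : ZMod (n - 1 + n))) -
            f (a - 1 + ((n - 1 : ℕ) : ZMod (n - 1 + n))) := by
        intro p hp
        induction p with
        | zero => rw [add_zero, jumps_of_le y u le_rfl, sub_self]
        | succ p ih =>
          have e := jumps_succ y u ⟨p, hp⟩
          simp only at e
          rw [← add_assoc, e, ih (by omega)]
          have e2 := hw (n - 1 + p)
          rw [eq_comm, sub_eq_iff_eq_add]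
          simp only [hu]
          linear_combination e2
      have := hj n le_rfl
      rw [jumps_last y C hy, ZMod.natCast_self, add_zero] at this
      simp only [hS]
      rw [this]
      ring
    have hpad : ∀ j ≤ n - 1, padded (fun i : Fin (n - 3 + 1) => S (i + 1)) j = S j := by
      intro j hj
      unfold padded
      split_ifs with h
      · simp only [Nat.sub_add_cancel h.1]
      · rcases (show j = 0 ∨ j = n - 1 by omega) with rfl | rfl
        · exact hS0.symm
        · exact hSlast.symm
    have hsmem : (fun i : Fin (n - 3 + 1) => S (i + 1)) ∈
        stringModule fun j : Fin (n - 3 + 2) => y j := by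
      rw [mem_stringModule_iff hn y]
      intro j hj
      rw [hpad j hj.le, hpad (j + 1) hj]
      simp only [hS]
      rw [compensation_succ y C u hj]
      have e := hw j
      refine ⟨w j + ∑ q, u q * MvPolynomial.C (C q j), ?_⟩
      linear_combination e
    refine ⟨(f (a - 1), u, ⟨_, hsmem⟩), Subtype.ext (funext fun z => ?_)⟩
    have key : ∀ j < n - 1 + n, splitFun y C (f (a - 1)) u (fun i : Fin (n - 3 + 1) => S (i + 1)) j =
        f (a - 1 + (j : ℕ)) := by
      intro j
      induction j with
      | zero => intro _; rw [splitFun_zero, Nat.cast_zero, add_zero]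
      | succ j ih =>
        intro hj
        have ih' := ih (by omega)
        have e := hw j
        rcases Nat.lt_or_ge j (n - 1) with h | h
        · have e2 := splitFun_succ (y := y) (C := C) (c := f (a - 1)) (u := u)
            (s := fun i : Fin (n - 3 + 1) => S (i + 1)) h
          rw [ih', hpad j h.le, hpad (j + 1) h] at e2
          simp only [hS] at e2
          rw [compensation_succ y C u h] at e2
          linear_combination e2
        · have e2 := splitFun_jump (y := y) (C := C) (c := f (a - 1)) (u := u)
            (s := fun i : Fin (n - 3 + 1) => S (i + 1)) hn ⟨j - (n - 1), by omega⟩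
          simp only [Nat.add_sub_cancel' h, hu] at e2
          rw [← hu, ih'] at e2
          linear_combination e2 - e
    obtain ⟨j, hj, rfl⟩ := exists_natCast_eq hn a z
    rw [hval _ j hj.le]
    exact key j hj
  refine GradedIso.symm ⟨LinearEquiv.ofBijective Ψ ⟨hinj, hsurj⟩, fun d x => ?_⟩
  exact (hgr d x).symm

/-- A string for two linearly independent linear forms is a multiple of their product. -/
theorem gradedIso_stringModule_two {x₀ x₁ : B →₀ ℝ} (h : LinearIndependent ℝ ![x₀, x₁])
    {x : Fin (0 + 2) → MvPolynomial B ℝ} (h0 : x 0 = toSym x₀) (h1 : x 1 = toSym x₁) :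
    GradedIso (MvPolynomial B ℝ) (subGr (powGr (Fin (0 + 1)) (symGr B)) (stringModule x))
      (shiftGr (symGr B) (-4)) := by
  have hx0 : x₀ ≠ 0 := h.ne_zero 0
  have hx1 : x₁ ≠ 0 := h.ne_zero 1
  have hp : toSym x₀ * toSym x₁ ≠ 0 := mul_ne_zero (toSym_ne_zero hx0) (toSym_ne_zero hx1)
  have hp4 : toSym x₀ * toSym x₁ ∈ symGr B 4 := mul_mem_symGr (toSym_mem_symGr x₀) (toSym_mem_symGr x₁)
  let Ψ : MvPolynomial B ℝ →ₗ[MvPolynomial B ℝ] stringModule x :=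
    { toFun := fun g => ⟨fun _ => toSym x₀ * toSym x₁ * g, by
        refine ⟨?_, ?_, fun i => i.elim0⟩
        · rw [h0]; exact ⟨toSym x₁ * g, by ring⟩
        · change x 1 ∣ _
          rw [h1]; exact ⟨toSym x₀ * g, by ring⟩⟩
      map_add' := fun g g' => Subtype.ext (funext fun _ => mul_add _ _ _)
      map_smul' := fun c g => Subtype.ext (funext fun _ => by
        change toSym x₀ * toSym x₁ * (c * g) = c * (toSym x₀ * toSym x₁ * g)
        ring) }
  have hinj : Function.Injective Ψ := by
    intro g g' e
    exact mul_left_cancel₀ hp (congrFun (congrArg Subtype.val e) 0)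
  have hsurj : Function.Surjective Ψ := by
    rintro ⟨f, hf0, hf1, -⟩
    change x 1 ∣ _ at hf1
    rw [h0] at hf0
    rw [h1] at hf1
    obtain ⟨k, hk⟩ := hf0
    change toSym x₁ ∣ f 0 at hf1
    rw [hk] at hf1
    obtain ⟨g, hg⟩ := ((toSym_prime hx1).dvd_or_dvd hf1).resolve_left (toSym_not_dvd h)
    refine ⟨g, Subtype.ext (funext fun i => ?_)⟩
    obtain rfl : i = 0 := Subsingleton.elim (α := Fin 1) i 0
    change toSym x₀ * toSym x₁ * g = f 0
    rw [hk, hg, mul_assoc]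
  refine GradedIso.symm ⟨LinearEquiv.ofBijective Ψ ⟨hinj, hsurj⟩, fun d g => ?_⟩
  simp only [subGr, powGr, shiftGr, AddSubgroup.mem_comap, AddSubgroup.mem_pi, Set.mem_univ,
    true_imp_iff]
  constructor
  · intro hg _
    have := mul_mem_symGr hp4 hg
    rwa [show (4 : ℤ) + (-4 + d) = d by ring] at this
  · intro hg
    refine mem_symGr_of_mul_mem hp hp4 ?_
    rw [show (4 : ℤ) + (-4 + d) = d by ring]
    exact hg 0

end Splitting

end

end ReflExpr

theorem mainTheorem6 {B W : Type*} [Group W] {M : CoxeterMatrix B} (cs : CoxeterSystem M W)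
    (n : ℕ) (hn : 3 ≤ n) (s : Fin (n - 1) → B)
    (hs : ∀ a b, M (s a) (s b) = CoxeterMatrix.A (n - 1) a b)
    (α : W → (B →₀ ℝ)) (hα : ∀ p, cs.IsReflection p → IsRootOf cs p (α p))
    (i : Equiv.Perm (Fin n)) (k : ℤ) (t : Fin (n - 1 + n) → W)
    (ht : t = cyclicShift (DSeq cs s i) k) :
    (n = 3 →
      (∀ j, ¬ StopsPrematurelyAt t 1 j) ∧
      GradedIso (MvPolynomial B ℝ)
        (subGr (powGr (subTo t 1) (symGr B)) (moduleX (fun p => toSym (α p)) t 1))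
        (prodGr (symGr B)
          (prodGr (powGr (Fin 3) (shiftGr (symGr B) (-2))) (shiftGr (symGr B) (-4))))) ∧
    (4 ≤ n →
      StopsPrematurelyAt t 1 (n + 1) ∧
      ∃ τ : ZMod (n - 1 + n) → W,
        (∀ a p, IsChordReflection n t a p ↔ p = τ a) ∧
        ∀ a : ZMod (n - 1 + n),
          LinearIndependent ℝ (fun j : Fin (n - 3 + 2) => α (τ ((j : ℕ) + a))) ∧
          GradedIso (MvPolynomial B ℝ)
            (subGr (powGr (subTo t 1) (symGr B)) (moduleX (fun p => toSym (α p)) t 1))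
            (prodGr (symGr B)
              (prodGr (powGr (Fin n) (shiftGr (symGr B) (-2)))
                (subGr (powGr (Fin (n - 3 + 1)) (symGr B))
                  (stringModule fun j : Fin (n - 3 + 2) => toSym (α (τ ((j : ℕ) + a)))))))) := by
  subst ht
  obtain ⟨ε, ρ, h, htree⟩ :=
    exists_isSubCycle cs hs hn (isLabelling_permLabel i) (isDSeq_cyclicShift cs hn s i k)
  -- the roots at `n - 1` consecutive chords form a basis of the span of the roots of the subgroup
  have hm : ∀ a : ZMod (n - 1 + n), LinearIndependent ℝ (fun j : Fin (n - 1) => α (ρ ((j : ℕ) + a))) ∧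
      ∀ x < n, ∀ y < n, x ≠ y → α (trans (simpleSeq cs s) x y) ∈
        Submodule.span ℝ (Set.range fun j : Fin (n - 1) => α (ρ ((j : ℕ) + a))) := by
    intro a
    obtain ⟨u, hu, hq⟩ := htree (a - 1)
    refine linearIndependent_of_tree cs hs hα hn hu fun j => ?_
    have := hq j j.isLt
    rwa [sub_add_cancel] at this
  have hv : ∀ b, α (ρ b) ≠ 0 := fun b => by
    simpa using (hm b).1.ne_zero ⟨0, by omega⟩
  have hspan : ∀ a b, α (ρ b) ∈
      Submodule.span ℝ (Set.range fun j : Fin (n - 1) => α (ρ ((j : ℕ) + a))) := by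
    intro a b
    obtain ⟨u, hu, hq⟩ := htree (b - 1)
    obtain ⟨y, hy, e⟩ := hq 0 (by omega)
    obtain rfl : y = 0 := by omega
    rw [Nat.cast_zero, zero_add, sub_add_cancel] at e
    rw [e]
    exact (hm a).2 _ (hu.lt _ (by omega)) _ (hu.lt _ (by omega)) fun e' =>
      zero_ne_one (hu.injOn 0 (by omega) 1 (by omega) e')
  have hiso := fun a => (h.gradedIso_cycleModule (fun p => toSym (α p)) (symGr B)).trans
    (gradedIso_split hn hv a (hspan a))
  refine ⟨fun hn3 => ?_, fun hn4 => ⟨h.stopsPrematurelyAt hn4, ρ, h.isChordReflection_iff,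
    fun a => ⟨?_, hiso a⟩⟩⟩
  · -- the string module of two linear forms is free of rank one
    subst hn3
    refine ⟨h.not_stopsPrematurelyAt rfl, (hiso 0).trans
      (GradedIso.refl.prod (GradedIso.refl.prod (gradedIso_stringModule_two
        (x₀ := α (ρ ((0 : ℕ) + 0))) (x₁ := α (ρ ((1 : ℕ) + 0))) ?_ rfl rfl)))⟩
    convert (hm 0).1 using 1
    funext j
    fin_cases j <;> rfl
  · exact (hm a).1.comp (Fin.cast (by omega : n - 3 + 2 = n - 1)) (Fin.cast_injective _)
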